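/- For $n\ge 1$ let $\mathcal T_n$ be the random binary search tree with $n$ nodes (the keys $1,\dots,n$ are inserted in uniformly random order), and let $\Lambda_n$ be the random recursive tree with $n$ nodes (start with a root labelled $1$; for $i=2,\dots,n$ the node $i$ is attached to a uniformly random one of the nodes $1,\dots,i-1$), regarded as an ordered tree with the children of each node ordered by their labels. A subtree (fringe subtree) of a tree consists of a node and all its descendants; its size is its number of nodes. A property $P$ is an arbitrary set of binary trees in the case of $\mathcal T_n$, and an arbitrary set of ordered rooted trees in the case of $\Lambda_n$. More generally, $P$ may be a set of increasing binary trees, respectively increasing ordered trees, where the nodes of $\mathcal T_n$ are labelled by the times at which their keys are inserted, $\Lambda_n$ carries its own labels, and increasing trees whose labels are in the same relative order are identified. Let $X_{n,k}^P$ and $\hat X_{n,k}^P$ be the numbers of subtrees of size $k$ with property $P$ in $\mathcal T_n$ and in $\Lambda_n$, respectively, let $p_{k,P}:=\mathbb P(\mathcal T_k\in P)$ and $\hat p_{k,P}:=\mathbb P(\Lambda_k\in P)$, and let $\mu_{n,k}^P:=\mathbb E X_{n,k}^P$ and $\hat\mu_{n,k}^P:=\mathbb E\hat X_{n,k}^P$.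 Let $d_{TV}(\nu_1,\nu_2):=\sup_A|\nu_1(A)-\nu_2(A)|$ be the total variation distance. Let $1\le k<n$. Then $$\mu_{n,k}^P=\frac{2(n+1)p_{k,P}}{(k+1)(k+2)},\qquad \hat\mu_{n,k}^P=\frac{n\,\hat p_{k,P}}{k(k+1)}.$$ For the binary search tree, $$d_{TV}(\mathcal L(X_{n,k}^P),\mathrm{Po}(\mu_{n,k}^P))=\frac12\sum_{l\ge0}\Bigl|\mathbb P(X_{n,k}^P=l)-e^{-\mu_{n,k}^P}\frac{(\mu_{n,k}^P)^l}{l!}\Bigr|,$$ and this distance is $$\begin{cases}O\bigl(p_{k,P}/k\bigr) & \text{if } k\ne(n-1)/2 \text{ and } \mu_{n,k}^P\ge1,\\ O\bigl(\mu_{n,k}^P\,p_{k,P}/k\bigr) & \text{if } k\ne(n-1)/2 \text{ and } \mu_{n,k}^P<1,\\ O\bigl(p_{k,P}^2/k\bigr) & \text{if } k=(n-1)/2.\end{cases}$$ For the random recursive tree, $$d_{TV}(\mathcal L(\hat X_{n,k}^P),\mathrm{Po}(\hat\mu_{n,k}^P))=\frac12\sum_{l\ge0}\Bigl|\mathbb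 P(\hat X_{n,k}^P=l)-e^{-\hat\mu_{n,k}^P}\frac{(\hat\mu_{n,k}^P)^l}{l!}\Bigr|,$$ and this distance is $O(\hat p_{k,P}/k)$ if $\hat\mu_{n,k}^P\ge1$ and $O(\hat\mu_{n,k}^P\,\hat p_{k,P}/k)$ if $\hat\mu_{n,k}^P<1$. Here the constants implicit in the $O$ terms are absolute: they do not depend on $n$, $k$ or $P$. Consequently, if $n\to\infty$ and $k=k_n\to\infty$ with $k_n<n$ (and $P=P_n$ possibly depending on $n$), then $d_{TV}(\mathcal L(X_{n,k}^P),\mathrm{Po}(\mu_{n,k}^P))\to0$ and $d_{TV}(\mathcal L(\hat X_{n,k}^P),\mathrm{Po}(\hat\mu_{n,k}^P))\to0$. -/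

import Mathlib

open MeasureTheory ProbabilityTheory Filter Topology

/-! ### Total variation distance -/

/-- The total variation distance `sup_A |μ₁(A) - μ₂(A)|` over all measurable sets `A`
(meant for probability measures, for which the supremum is over a set bounded by `1`). -/
noncomputable def tvDist {X : Type*} [MeasurableSpace X] (μ₁ μ₂ : Measure X) : ℝ :=
  ⨆ A : {A : Set X // MeasurableSet A}, |μ₁.real A.1 - μ₂.real A.1|

/-! ### The random binary search tree

Binary trees are Mathlib's `BinaryTree α`, with a label in `α` at every node; the unlabelled
binary trees are the elements of `BinaryTree Unit`. -/

/-- The unlabelled binary tree underlying a labelled one. -/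
def BinaryTree.shape {α : Type*} (t : BinaryTree α) : BinaryTree Unit :=
  t.map fun _ => ()

/-- All fringe subtrees of a binary tree: one for every node of the tree, consisting of this
node and all its descendants. -/
def BinaryTree.fringe {α : Type*} : BinaryTree α → List (BinaryTree α)
  | .nil => []
  | .node a l r => .node a l r :: (l.fringe ++ r.fringe)

/-- Insert the pair `x = (key, time stamp)` into a binary search tree with respect to the keys:
go to the left (right) child if the key is smaller (larger) than the key of the present node,
until the first empty position. -/
def bstInsert (x : ℕ × ℕ) : BinaryTree (ℕ × ℕ) → BinaryTree (ℕ × ℕ)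
  | .nil => .node x .nil .nil
  | .node y l r => if x.1 < y.1 then .node y (bstInsert x l) r else .node y l (bstInsert x r)

/-- The binary search tree obtained by drawing the keys in the order `σ 0, σ 1, …, σ (n - 1)`.
Every node carries as its label the time at which its key was drawn; the keys themselves,
which are determined by the tree, are forgotten. -/
def bstOfPerm {n : ℕ} (σ : Equiv.Perm (Fin n)) : BinaryTree ℕ :=
  ((List.finRange n).foldl (fun t i => bstInsert ((σ i : ℕ), (i : ℕ)) t) .nil).map Prod.snd

/-- The random binary search tree with `n` nodes, labelled by its time stamps:
the keys are drawn in uniformly random order. -/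
noncomputable def randomBST (n : ℕ) : PMF (BinaryTree ℕ) :=
  (PMF.uniformOfFintype (Equiv.Perm (Fin n))).map bstOfPerm

/-- A set of labelled binary trees is a property of increasing binary trees if it depends on
the labels only through their relative order, i.e. if it is stable under increasing
relabellings. -/
def BinaryTree.IsProperty (P : Set (BinaryTree ℕ)) : Prop :=
  ∀ f : ℕ → ℕ, StrictMono f → ∀ t : BinaryTree ℕ, t.map f ∈ P ↔ t ∈ P

/-- Every set of unlabelled binary trees is such a property. -/
theorem BinaryTree.isProperty_shape (Q : Set (BinaryTree Unit)) :
    BinaryTree.IsProperty {t | t.shape ∈ Q} := by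
  intro f _ t
  have h : (t.map f).shape = t.shape := (BinaryTree.comp_map f (fun _ => ()) t).symm
  simp only [Set.mem_ofPred_eq, h]

open Classical in
/-- The number of fringe subtrees of size `k` with property `P` in `t`. -/
noncomputable def BinaryTree.count (k : ℕ) (P : Set (BinaryTree ℕ)) (t : BinaryTree ℕ) : ℕ :=
  t.fringe.countP fun u => decide (u.numNodes = k ∧ u ∈ P)

/-- The probability `p_{k,P}` that the random binary search tree of size `k` has property `P`. -/
noncomputable def bstProb (k : ℕ) (P : Set (BinaryTree ℕ)) : ℝ :=
  ((randomBST k).toOuterMeasure P).toReal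

/-- The law of the number of subtrees of size `k` with property `P` in the random binary search
tree of size `n`. -/
noncomputable def bstLaw (n k : ℕ) (P : Set (BinaryTree ℕ)) : Measure ℕ :=
  ((randomBST n).map (BinaryTree.count k P)).toMeasure

/-- The expectation of the number of subtrees of size `k` with property `P` in the random binary
search tree of size `n`. -/
noncomputable def bstMean (n k : ℕ) (P : Set (BinaryTree ℕ)) : ℝ :=
  ∫ l, (l : ℝ) ∂(bstLaw n k P)

/-! ### The random recursive tree -/

/-- Ordered (plane) rooted trees with a label in `α` at every node: a node has a label and a
finite sequence of subtrees at its children. The unlabelled ordered trees are the elements of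
`OrdTree Unit`. -/
inductive OrdTree (α : Type) : Type
  | node (label : α) (children : List (OrdTree α)) : OrdTree α

/-- Apply `f` to every label. -/
def OrdTree.map {α β : Type} (f : α → β) : OrdTree α → OrdTree β
  | .node a ts => .node (f a) (ts.map (OrdTree.map f))

/-- The number of nodes. -/
def OrdTree.size {α : Type} : OrdTree α → ℕ
  | .node _ ts => (ts.map OrdTree.size).sum + 1

/-- The unlabelled ordered tree underlying a labelled one. -/
def OrdTree.shape {α : Type} (t : OrdTree α) : OrdTree Unit :=
  t.map fun _ => ()

/-- All fringe subtrees of an ordered tree: one for every node of the tree, consisting of this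
node and all its descendants. -/
def OrdTree.fringe {α : Type} : OrdTree α → List (OrdTree α)
  | .node a ts => .node a ts :: (ts.map OrdTree.fringe).flatten

/-- Attach a new last child with label `i` to the nodes with label `p`. -/
def OrdTree.attachChild (p i : ℕ) : OrdTree ℕ → OrdTree ℕ
  | .node a ts => .node a
      (ts.map (OrdTree.attachChild p i) ++ if a = p then [.node i []] else [])

/-- The random recursive tree with `n ≥ 1` nodes, labelled `1, …, n`: start with a root labelled
`1`; the node with the next label is attached to a node chosen uniformly at random among the
previous ones, as its last child (so children are ordered by their labels). The value at
`n = 0` has no meaning and is not used. -/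
noncomputable def randomRRT : ℕ → PMF (OrdTree ℕ)
  | 0 => PMF.pure (.node 1 [])
  | 1 => PMF.pure (.node 1 [])
  | n + 2 => (randomRRT (n + 1)).bind fun t =>
      (PMF.uniformOfFintype (Fin (n + 1))).map fun p => t.attachChild ((p : ℕ) + 1) (n + 2)

/-- A set of labelled ordered trees is a property of increasing ordered trees if it depends on
the labels only through their relative order, i.e. if it is stable under increasing
relabellings. -/
def OrdTree.IsProperty (P : Set (OrdTree ℕ)) : Prop :=
  ∀ f : ℕ → ℕ, StrictMono f → ∀ t : OrdTree ℕ, t.map f ∈ P ↔ t ∈ P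

theorem OrdTree.shape_map {α β : Type} (f : α → β) (t : OrdTree α) :
    (t.map f).shape = t.shape := by
  unfold OrdTree.shape
  induction t using OrdTree.map.induct with
  | case1 a ts ih =>
    simp only [OrdTree.map, List.map_map, OrdTree.node.injEq, true_and]
    exact List.map_congr_left ih

/-- Every set of unlabelled ordered trees is such a property. -/
theorem OrdTree.isProperty_shape (Q : Set (OrdTree Unit)) :
    OrdTree.IsProperty {t | t.shape ∈ Q} := by
  intro f _ t
  simp only [Set.mem_ofPred_eq, OrdTree.shape_map]

open Classical in
/-- The number of fringe subtrees of size `k` with property `P` in `t`. -/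
noncomputable def OrdTree.count (k : ℕ) (P : Set (OrdTree ℕ)) (t : OrdTree ℕ) : ℕ :=
  t.fringe.countP fun u => decide (u.size = k ∧ u ∈ P)

/-- The probability `p̂_{k,P}` that the random recursive tree of size `k` has property `P`. -/
noncomputable def rrtProb (k : ℕ) (P : Set (OrdTree ℕ)) : ℝ :=
  ((randomRRT k).toOuterMeasure P).toReal

/-- The law of the number of subtrees of size `k` with property `P` in the random recursive
tree of size `n`. -/
noncomputable def rrtLaw (n k : ℕ) (P : Set (OrdTree ℕ)) : Measure ℕ :=
  ((randomRRT n).map (OrdTree.count k P)).toMeasure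

/-- The expectation of the number of subtrees of size `k` with property `P` in the random
recursive tree of size `n`. -/
noncomputable def rrtMean (n k : ℕ) (P : Set (OrdTree ℕ)) : ℝ :=
  ∫ l, (l : ℝ) ∂(rrtLaw n k P)

/-! ### Distance to the Poisson distribution -/

/-- `d_TV(L(X), Po(E X))` for the number `X` of subtrees of size `k` with property `P` in the
random binary search tree of size `n`. -/
noncomputable def bstPoissonDist (n k : ℕ) (P : Set (BinaryTree ℕ)) : ℝ :=
  tvDist (bstLaw n k P) (poissonMeasure (bstMean n k P).toNNReal)

/-- `d_TV(L(X), Po(E X))` for the number `X` of subtrees of size `k` with property `P` in the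
random recursive tree of size `n`. -/
noncomputable def rrtPoissonDist (n k : ℕ) (P : Set (OrdTree ℕ)) : ℝ :=
  tvDist (rrtLaw n k P) (poissonMeasure (rrtMean n k P).toNNReal)

/-! Both counts are numbers of occurrences of an order pattern in the windows of a uniform random
permutation of cyclic positions.

Labelled by time stamps, a binary search tree is the unique heap-ordered tree whose symmetric order
lists the time stamps by key. Add one entry smaller than all others and close the sequence to a
cycle of n+1 entries. A fringe subtree of size k is then a run of k consecutive entries that are all
larger than the two entries bordering the run. The count is invariant under rotation, so the
arrangement may be taken uniform on all permutations of the n+1 positions (`bstLaw_eq`).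

For the recursive tree, let right subtrees carry children and left subtrees later siblings.
Attaching a new last child inserts the new, largest label directly behind its parent in symmetric
order. Hence that order is the label 1 followed by a uniform permutation of the other labels. A
fringe subtree of size k < n is a run of k entries of which the first is the smallest, followed by
an entry smaller than all of them, on a cycle of n entries (`rrtLaw_eq`).

So the count X consists of m indicators, one for each cyclic window of length w (k+2 or k+1), each
of probability q, and the mean μ = mq is exact. Disjoint windows are independent
(`expect_pattern_mul`). Occurrences at distance less than w-1 exclude each other. At distance w-1,
where adjacent windows share an end, both occur with probability at most c. The Chen-Stein method
for local dependence (`exists_stein_solution`, `abs_expect_stein_occCount_le`) bounds the distance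
by min(1, 1/μ)(2wqμ + 2mc).

Here wq has order p/k, and c has order p²/k³, by summing over which border of the two windows is the
smallest; both terms are then O(pμ/k). The exception is the search tree with n = 2k+1: two adjacent
windows share both borders, c has order only p²/k², and since m = 2k+2 the bound is of order p²/k.
-/

open scoped BigOperators

/-! ### Total variation distance of measures on `ℕ` -/

theorem tvDist_nonneg {X : Type*} [MeasurableSpace X] (μ ν : Measure X) : 0 ≤ tvDist μ ν :=
  Real.iSup_nonneg fun _ => abs_nonneg _

theorem tvDist_le {X : Type*} [MeasurableSpace X] {μ ν : Measure X} {c : ℝ}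
    (h : ∀ A : Set X, |μ.real A - ν.real A| ≤ c) : tvDist μ ν ≤ c :=
  haveI : Nonempty {A : Set X // MeasurableSet A} := ⟨⟨∅, MeasurableSet.empty⟩⟩
  ciSup_le fun A => h A.1

theorem hasSum_measureReal_indicator (μ : Measure ℕ) [IsFiniteMeasure μ] (A : Set ℕ) :
    HasSum (A.indicator fun l => μ.real {l}) (μ.real A) := by
  have h : HasSum (A.indicator fun l => μ {l}) (μ A) := by
    rw [← Measure.tsum_indicator_apply_singleton μ A A.to_countable.measurableSet]
    exact ENNReal.summable.hasSum
  have h2 := (ENNReal.hasSum_toReal (f := A.indicator fun l => μ {l}) (by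
    rw [h.tsum_eq]; exact measure_ne_top μ A))
  rw [← ENNReal.tsum_toReal_eq (fun l => ne_top_of_le_ne_top (measure_ne_top μ {l})
    (Set.indicator_le_self' (fun _ _ => zero_le) l)), h.tsum_eq] at h2
  convert! h2 using 2 with l
  by_cases hl : l ∈ A <;> simp [hl, Measure.real]

/-- The supremum is attained at the set `S` where `μ` dominates pointwise. Both measures have mass
1, so the excess of `μ` on `S` equals its deficit on the complement; this gives the factor 2. -/
theorem hasSum_abs_sub_measureReal_singleton (μ ν : Measure ℕ) [IsProbabilityMeasure μ]
    [IsProbabilityMeasure ν] :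
    HasSum (fun l => |μ.real {l} - ν.real {l}|) (2 * tvDist μ ν) := by
  set S : Set ℕ := {l | ν.real {l} ≤ μ.real {l}} with hS
  have hd : ∀ A : Set ℕ, HasSum (A.indicator fun l => μ.real {l} - ν.real {l})
      (μ.real A - ν.real A) := by
    intro A
    convert! (hasSum_measureReal_indicator μ A).sub (hasSum_measureReal_indicator ν A) using 2
    simp [Set.indicator_sub]
  have hc : μ.real Sᶜ - ν.real Sᶜ = -(μ.real S - ν.real S) := by
    rw [probReal_compl_eq_one_sub (Set.to_countable S).measurableSet,
      probReal_compl_eq_one_sub (Set.to_countable S).measurableSet]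
    ring
  have habs : HasSum (fun l => |μ.real {l} - ν.real {l}|) (2 * (μ.real S - ν.real S)) := by
    convert! (hd S).sub (hd Sᶜ) using 1
    · funext l
      by_cases hl : l ∈ S
      · simp only [Set.indicator_of_mem hl, Set.mem_compl_iff, hl, not_true_eq_false,
          not_false_eq_true, Set.indicator_of_notMem, sub_zero]
        exact abs_of_nonneg (sub_nonneg.2 hl)
      · simp only [Set.mem_compl_iff, hl, not_false_eq_true, Set.indicator_of_mem,
          Set.indicator_of_notMem, zero_sub]
        exact abs_of_nonpos (sub_nonpos.2 (not_le.1 hl).le)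
    · rw [hc]; ring
  have hle : ∀ A : Set ℕ, |μ.real A - ν.real A| ≤ μ.real S - ν.real S := by
    have h1 : ∀ A : Set ℕ, μ.real A - ν.real A ≤ μ.real S - ν.real S := by
      intro A
      refine hasSum_le (fun l => ?_) (hd A) (hd S)
      by_cases hl : l ∈ S <;> by_cases hA : l ∈ A <;> simp only [hl, hA, Set.indicator_of_mem,
        not_false_eq_true, Set.indicator_of_notMem, le_refl]
      · exact sub_nonneg.2 hl
      · exact sub_nonpos.2 (not_le.1 hl).le
    intro A
    refine abs_le.2 ⟨?_, h1 A⟩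
    have := h1 Aᶜ
    rw [probReal_compl_eq_one_sub (Set.to_countable A).measurableSet,
      probReal_compl_eq_one_sub (Set.to_countable A).measurableSet] at this
    linarith
  have htv : tvDist μ ν = μ.real S - ν.real S := by
    refine le_antisymm (tvDist_le hle) ?_
    refine le_trans (le_abs_self _) (le_ciSup (f := fun A : {A : Set ℕ // MeasurableSet A} =>
      |μ.real A.1 - ν.real A.1|) ?_ ⟨S, (Set.to_countable S).measurableSet⟩)
    exact ⟨μ.real S - ν.real S, by rintro _ ⟨A, rfl⟩; exact hle A.1⟩
  rwa [htv]

/-! ### The Stein equation for the Poisson distribution -/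

/-- The increment of the Stein solution at x = y+1, with denominators cleared. The numbers a, b, c
are the Poisson masses of the set below, at and above x; F and F' are the distribution function at y
and y+1. It is linear in a, b, c, and only the point x itself can contribute positively, by at most
(1 - p₀)/r after division; finally 1 - p₀ ≤ min(1, r). -/
theorem stein_increment_le {a b c p p₀ r x F F' : ℝ} (ha : 0 ≤ a) (hb : 0 ≤ b) (hbp : b ≤ p)
    (hc : 0 ≤ c) (hr : 0 < r) (hx : 0 < x) (hp₀ : 0 < p₀) (hF' : F' ≤ 1) (hF : 0 ≤ F)
    (h1 : r * F ≤ x * (F' - p₀)) (h2 : x * (1 - F') ≤ r * (1 - F)) (h3 : 1 - p₀ ≤ r) :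
    x * (a + b - (a + b + c) * F') - r * (a - (a + b + c) * F) ≤ min 1 (1 / r) * (r * x * p) := by
  have e1 : x * (a + b - (a + b + c) * F') - r * (a - (a + b + c) * F) =
      a * (x * (1 - F') - r * (1 - F)) + b * (x * (1 - F') + r * F) - c * (x * F' - r * F) := by
    ring
  have t0 : 0 ≤ x * p₀ := by positivity
  have t1 : a * (x * (1 - F') - r * (1 - F)) ≤ 0 :=
    mul_nonpos_of_nonneg_of_nonpos ha (by linarith)
  have t2 : 0 ≤ c * (x * F' - r * F) := mul_nonneg hc (by linarith)
  have t4 : 0 ≤ x * (1 - F') := mul_nonneg hx.le (by linarith)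
  have t3 : b * (x * (1 - F') + r * F) ≤ p * (x * (1 - F') + r * F) :=
    mul_le_mul_of_nonneg_right hbp (by positivity)
  have hp : 0 ≤ p := hb.trans hbp
  have t5 : x * (1 - F') + r * F ≤ x * (1 - p₀) := by linarith
  have t6 : p * (x * (1 - F') + r * F) ≤ p * (x * (1 - p₀)) := mul_le_mul_of_nonneg_left t5 hp
  have t7 : p * (x * (1 - p₀)) ≤ p * (x * r) := by gcongr
  have t8 : p * (x * (1 - p₀)) ≤ p * (x * 1) := by gcongr; linarith
  rcases min_choice (1 : ℝ) (1 / r) with h | h <;> rw [h]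
  · linarith
  · have : 1 / r * (r * x * p) = p * (x * 1) := by field_simp
    linarith

/-- The solution is explicit: G(x) = (Po(A ∩ [0,x]) - Po(A) Po([0,x])) / (r Po({x})). It is indexed
one lower than usual, so that x is multiplied by G(x-1). A one-sided increment bound for all sets
suffices, because passing to the complement changes the sign. -/
theorem exists_stein_solution_upper {r : NNReal} (hr : 0 < r) :
    ∃ G : Set ℕ → ℕ → ℝ, (∀ A x, (r : ℝ) * G A x - x * G A (x - 1) =
        A.indicator 1 x - (poissonMeasure r).real A) ∧
      (∀ A x, G Aᶜ x = - G A x) ∧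
      ∀ A x, G A (x + 1) - G A x ≤ min 1 (1 / (r : ℝ)) := by
  set p : ℕ → ℝ := fun x => (poissonMeasure r).real {x} with hp
  have hrr : (0 : ℝ) < r := hr
  have hp0 : ∀ x, 0 < p x := fun x => poissonMeasure_real_singleton_pos x hr
  have hps : ∀ x : ℕ, ((x : ℝ) + 1) * p (x + 1) = r * p x := by
    intro x
    simp only [hp, poissonMeasure_real_singleton, pow_succ, Nat.factorial_succ]
    push_cast
    field_simp
  have hsum : HasSum p 1 := by
    simpa [hp] using hasSum_measureReal_indicator (poissonMeasure r) Set.univ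
  have hpz : p 0 = Real.exp (-r) := by simp [hp, poissonMeasure_real_singleton]
  set F : ℕ → ℝ := fun x => ∑ i ∈ Finset.range (x + 1), p i with hF
  have hFs : ∀ x, F (x + 1) = F x + p (x + 1) := fun x => Finset.sum_range_succ _ _
  have hF0 : F 0 = p 0 := by simp [hF]
  -- Termwise: r p(i) = (i+1) p(i+1) ≤ (x+1) p(i+1) for i ≤ x. The next estimate does the same for
  -- the tails, where the index is larger than x.
  have hF1 : ∀ x : ℕ, r * F x ≤ ((x : ℝ) + 1) * (F (x + 1) - p 0) := by
    intro x
    simp only [hF, Finset.sum_range_succ' _ (x + 1), add_sub_cancel_right, Finset.mul_sum]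
    refine Finset.sum_le_sum fun i hi => ?_
    rw [← hps]
    have : (i : ℝ) ≤ x := by exact_mod_cast Nat.lt_succ_iff.1 (Finset.mem_range.1 hi)
    have := hp0 (i + 1)
    gcongr
  have hG : ∀ x : ℕ, ((x : ℝ) + 1) * (1 - F (x + 1)) ≤ r * (1 - F x) := by
    intro x
    have h1 := ((hasSum_nat_add_iff' (x + 1 + 1)).2 hsum).mul_left ((x : ℝ) + 1)
    have h2 := ((hasSum_nat_add_iff' (x + 1)).2 hsum).mul_left (r : ℝ)
    refine hasSum_le (fun i => ?_) h1 h2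
    rw [← hps]
    have := hp0 (i + (x + 1) + 1)
    rw [show i + (x + 1 + 1) = i + (x + 1) + 1 by ring]
    gcongr
    linarith [(Nat.cast_nonneg i : (0 : ℝ) ≤ i)]
  set S : Set ℕ → ℕ → ℝ := fun A x => ∑ i ∈ Finset.range (x + 1), A.indicator p i with hS
  have hSs : ∀ A x, S A (x + 1) = S A x + A.indicator p (x + 1) :=
    fun A x => Finset.sum_range_succ _ _
  have hind0 : ∀ (A : Set ℕ) i, 0 ≤ A.indicator p i :=
    fun A i => Set.indicator_nonneg (fun i _ => (hp0 i).le) i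
  have hindle : ∀ (A : Set ℕ) i, A.indicator p i ≤ p i :=
    fun A i => Set.indicator_le_self' (fun _ _ => (hp0 _).le) i
  have hindeq : ∀ (A : Set ℕ) i, A.indicator p i = A.indicator 1 i * p i := by
    intro A i; by_cases h : i ∈ A <;> simp [h]
  set q : Set ℕ → ℝ := fun A => (poissonMeasure r).real A with hq
  have hSq : ∀ A x, S A x ≤ q A := fun A x =>
    sum_le_hasSum _ (fun i _ => hind0 A i) (hasSum_measureReal_indicator (poissonMeasure r) A)
  have hS0 : ∀ A x, 0 ≤ S A x := fun A x => Finset.sum_nonneg fun i _ => hind0 A i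
  refine ⟨fun A x => (S A x - q A * F x) / (r * p x), ?_, ?_, ?_⟩
  · intro A x
    -- At x = 0 the truncated x - 1 is harmless, since its value is multiplied by 0.
    rcases x with _ | x
    · have h0 : S A 0 = A.indicator 1 0 * p 0 := by simp [hS, hindeq]
      have := hp0 0
      simp only [h0, hF0, Nat.cast_zero, zero_mul, sub_zero]
      field_simp
      rfl
    · have h1 := hp0 (x + 1)
      have h2 := hp0 x
      have h3 : ((x : ℝ) + 1) / (r * p x) = 1 / p (x + 1) := by
        rw [← hps]; field_simp
      have h4 : (((x + 1 : ℕ) : ℝ)) * ((S A x - q A * F x) / (r * p x)) =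
          (S A x - q A * F x) / p (x + 1) := by
        push_cast
        rw [mul_div_assoc', mul_comm, mul_div_assoc, h3]; ring
      simp only [Nat.add_sub_cancel]
      rw [h4, hSs, hFs, hindeq]
      field_simp
      ring
  · intro A x
    have h1 : q Aᶜ = 1 - q A := probReal_compl_eq_one_sub (Set.to_countable A).measurableSet
    have h2 : S Aᶜ x = F x - S A x := by
      simp only [hS, hF, ← Finset.sum_sub_distrib]
      refine Finset.sum_congr rfl fun i _ => ?_
      by_cases h : i ∈ A <;> simp [h]
    simp only [h1, h2]
    ring
  · intro A y
    have hpy := hp0 (y + 1)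
    set b := A.indicator p (y + 1) with hb
    have hb0 : 0 ≤ b := hind0 A _
    have hbp : b ≤ p (y + 1) := hindle A _
    set a := S A y with ha
    have ha0 : 0 ≤ a := hS0 A y
    have hc : 0 ≤ q A - a - b := by
      have := hSq A (y + 1); rw [hSs] at this; linarith
    have hy : (0 : ℝ) < (y : ℝ) + 1 := by positivity
    have hg : (S A (y + 1) - q A * F (y + 1)) / (r * p (y + 1)) - (S A y - q A * F y) / (r * p y)
        = (((y : ℝ) + 1) * (a + b - q A * F (y + 1)) - r * (a - q A * F y)) /
          (r * ((y + 1) * p (y + 1))) := by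
      rw [hSs, ← hps y]
      simp only [ha, hb]
      field_simp
    have hFy := hF1 y
    have hGy := hG y
    have hFle : F (y + 1) ≤ 1 := sum_le_hasSum _ (fun i _ => (hp0 i).le) hsum
    have hF0' : 0 ≤ F y := Finset.sum_nonneg fun i _ => (hp0 i).le
    have hexp : 1 - p 0 ≤ r := by rw [hpz]; linarith [Real.add_one_le_exp (-(r : ℝ))]
    rw [hg, div_le_iff₀ (by positivity)]
    have hkey := stein_increment_le (F := F y) (F' := F (y + 1)) ha0 hb0 hbp hc hrr hy (hp0 0)
      hFle hF0' hFy hGy hexp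
    rw [show a + b + (q A - a - b) = q A by ring] at hkey
    calc _ ≤ _ := hkey
      _ = _ := by ring

theorem exists_stein_solution {r : NNReal} (hr : 0 < r) (A : Set ℕ) :
    ∃ g : ℕ → ℝ, (∀ x : ℕ, (r : ℝ) * g x - x * g (x - 1) =
        A.indicator 1 x - (poissonMeasure r).real A) ∧
      ∀ x, |g (x + 1) - g x| ≤ min 1 (1 / (r : ℝ)) := by
  obtain ⟨G, h1, h2, h3⟩ := exists_stein_solution_upper hr
  refine ⟨G A, h1 A, fun x => abs_le.2 ⟨?_, h3 A x⟩⟩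
  have := h3 Aᶜ x
  rw [h2, h2] at this
  linarith

/-! ### Images of uniform distributions -/

section Uniform

variable {Ω : Type*} [Fintype Ω] [Nonempty Ω]

theorem integral_uniform_map (X : Ω → ℕ) (f : ℕ → ℝ) :
    Integrable f ((PMF.uniformOfFintype Ω).map X).toMeasure ∧
    ∫ l, f l ∂((PMF.uniformOfFintype Ω).map X).toMeasure = 𝔼 ω, f (X ω) := by
  let _ : MeasurableSpace Ω := ⊤
  have hX : Measurable X := measurable_from_top
  rw [← PMF.toMeasure_map X _ hX]
  constructor
  · rw [integrable_map_measure (measurable_of_countable f).aestronglyMeasurable hX.aemeasurable]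
    exact Integrable.of_finite
  · rw [integral_map hX.aemeasurable (measurable_of_countable f).aestronglyMeasurable,
      PMF.integral_eq_sum, Fintype.expect_eq_sum_div_card, Finset.sum_div]
    refine Finset.sum_congr rfl fun ω _ => ?_
    simp [div_eq_inv_mul]

theorem measureReal_uniform_map (X : Ω → ℕ) (A : Set ℕ) :
    ((PMF.uniformOfFintype Ω).map X).toMeasure.real A = 𝔼 ω, A.indicator 1 (X ω) := by
  rw [← (integral_uniform_map X (A.indicator 1)).2, integral_indicator_one]
  exact A.to_countable.measurableSet

open Classical in
theorem toOuterMeasure_uniform_map_toReal {β : Type*} (X : Ω → β) (P : Set β) :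
    (((PMF.uniformOfFintype Ω).map X).toOuterMeasure P).toReal =
      𝔼 ω, if X ω ∈ P then (1 : ℝ) else 0 := by
  rw [PMF.toOuterMeasure_map_apply, PMF.toOuterMeasure_uniformOfFintype_apply,
    Fintype.expect_eq_sum_div_card, Finset.sum_boole, Fintype.card_subtype]
  simp

/-- Stein's bound for the distance of the law of `X` to a Poisson distribution. -/
theorem tvDist_poisson_le (X : Ω → ℕ) {r : NNReal} (hr : 0 < r) {c : ℝ}
    (h : ∀ g : ℕ → ℝ, ∀ d : ℝ, (∀ x, |g (x + 1) - g x| ≤ d) →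
      |𝔼 ω, (r * g (X ω) - X ω * g (X ω - 1))| ≤ d * c) :
    tvDist ((PMF.uniformOfFintype Ω).map X).toMeasure (poissonMeasure r) ≤
      min 1 (1 / (r : ℝ)) * c := by
  refine tvDist_le fun A => ?_
  obtain ⟨g, hg, hd⟩ := exists_stein_solution hr A
  have := h g _ hd
  simp only [hg] at this
  rwa [Finset.expect_sub_distrib, ← measureReal_uniform_map, Fintype.expect_const] at this

end Uniform

/-! ### Order patterns in uniform random permutations -/

open Classical in
/-- The indicator of a proposition, as a real number. -/
noncomputable def ind (p : Prop) : ℝ := if p then 1 else 0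

theorem ind_true {p : Prop} (h : p) : ind p = 1 := if_pos h

theorem ind_false {p : Prop} (h : ¬p) : ind p = 0 := if_neg h

theorem ind_nonneg (p : Prop) : 0 ≤ ind p := by unfold ind; split_ifs <;> simp

theorem ind_le_one (p : Prop) : ind p ≤ 1 := by unfold ind; split_ifs <;> simp

theorem ind_and (p q : Prop) : ind (p ∧ q) = ind p * ind q := by
  by_cases hp : p <;> by_cases hq : q <;> simp [ind, hp, hq]

theorem ind_congr {p q : Prop} (h : p ↔ q) : ind p = ind q := by rw [propext h]

theorem ind_mono {p q : Prop} (h : p → q) : ind p ≤ ind q := by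
  by_cases hp : p
  · rw [ind_true hp, ind_true (h hp)]
  · rw [ind_false hp]; exact ind_nonneg q

/-- The values of a permutation of `Fin m`, read cyclically. -/
def cycSeq {m : ℕ} [NeZero m] (σ : Equiv.Perm (Fin m)) (x : ℕ) : ℕ := σ (Fin.ofNat m x)

theorem ofNat_eq_ofNat_iff {m : ℕ} [NeZero m] {x y : ℕ} :
    Fin.ofNat m x = Fin.ofNat m y ↔ x ≡ y [MOD m] := by
  simp [Fin.ext_iff, Fin.ofNat, Nat.ModEq]

theorem eq_of_ofNat_eq {m : ℕ} [NeZero m] {s x y : ℕ} (hx : s ≤ x) (hx' : x < s + m)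
    (hy : s ≤ y) (hy' : y < s + m) (h : Fin.ofNat m x = Fin.ofNat m y) : x = y := by
  rw [ofNat_eq_ofNat_iff] at h
  have h2 : x - s ≡ y - s [MOD m] := by
    refine Nat.ModEq.add_right_cancel' s ?_
    rwa [Nat.sub_add_cancel hx, Nat.sub_add_cancel hy]
  have := h2.eq_of_lt_of_lt (by omega) (by omega)
  omega

theorem cycSeq_add_self {m : ℕ} [NeZero m] (σ : Equiv.Perm (Fin m)) (x : ℕ) :
    cycSeq σ (x + m) = cycSeq σ x := by
  have : Fin.ofNat m (x + m) = Fin.ofNat m x :=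
    ofNat_eq_ofNat_iff.2 (by simp [Nat.ModEq])
  simp only [cycSeq, this]

theorem cycSeq_mod {m : ℕ} [NeZero m] (σ : Equiv.Perm (Fin m)) (x y : ℕ) :
    cycSeq σ (x % m + y) = cycSeq σ (x + y) := by
  have : Fin.ofNat m (x % m + y) = Fin.ofNat m (x + y) :=
    ofNat_eq_ofNat_iff.2 (by simp [Nat.ModEq])
  simp only [cycSeq, this]

/-- A property of sequences that depends only on the relative order of the first `w` entries. -/
structure IsPattern (w : ℕ) (Q : (ℕ → ℕ) → Prop) : Prop where
  congr : ∀ v v' : ℕ → ℕ, (∀ x < w, v x = v' x) → (Q v ↔ Q v')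
  comp : ∀ v f : ℕ → ℕ, StrictMono f → (Q (f ∘ v) ↔ Q v)

theorem IsPattern.and {w : ℕ} {Q R : (ℕ → ℕ) → Prop} (hQ : IsPattern w Q) (hR : IsPattern w R) :
    IsPattern w fun v => Q v ∧ R v :=
  ⟨fun v v' h => and_congr (hQ.congr v v' h) (hR.congr v v' h),
    fun v f hf => and_congr (hQ.comp v f hf) (hR.comp v f hf)⟩

theorem IsPattern.shift {w w' s : ℕ} {Q : (ℕ → ℕ) → Prop} (hQ : IsPattern w Q)
    (h : s + w ≤ w') : IsPattern w' fun v => Q fun x => v (s + x) :=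
  ⟨fun _ _ hv => hQ.congr _ _ fun _ hx => hv _ (by omega), fun _ f hf => hQ.comp _ f hf⟩

theorem isPattern_lt {w x y : ℕ} (hx : x < w) (hy : y < w) : IsPattern w fun v => v x < v y :=
  ⟨fun v v' hv => by rw [hv x hx, hv y hy], fun v f hf => hf.lt_iff_lt⟩

theorem IsPattern.forall {w : ℕ} {ι : Type*} {Q : ι → (ℕ → ℕ) → Prop}
    (hQ : ∀ i, IsPattern w (Q i)) : IsPattern w fun v => ∀ i, Q i v :=
  ⟨fun v v' h => forall_congr' fun i => (hQ i).congr v v' h,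
    fun v f hf => forall_congr' fun i => (hQ i).comp v f hf⟩

/-- The probability of a pattern in a uniform random permutation. -/
noncomputable def patternProb (w : ℕ) [NeZero w] (Q : (ℕ → ℕ) → Prop) : ℝ :=
  𝔼 τ : Equiv.Perm (Fin w), ind (Q (cycSeq τ))

theorem patternProb_nonneg (w : ℕ) [NeZero w] (Q : (ℕ → ℕ) → Prop) : 0 ≤ patternProb w Q :=
  Finset.expect_nonneg fun _ _ => ind_nonneg _

/-- Standardization: sorting the entries exhibits them as an increasing relabelling of a
permutation, which patterns do not see. -/
theorem exists_strictMono_comp_perm {w : ℕ} [NeZero w] (u : Fin w → ℕ)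
    (hu : Function.Injective u) :
    ∃ (ρ : Equiv.Perm (Fin w)) (f : ℕ → ℕ), StrictMono f ∧ ∀ x, u x = f (ρ x) := by
  have hw : 0 < w := Nat.pos_of_ne_zero (NeZero.ne w)
  have hs : StrictMono (u ∘ Tuple.sort u) :=
    (Tuple.monotone_sort u).strictMono_of_injective (hu.comp (Tuple.sort u).injective)
  set h := u ∘ Tuple.sort u with hh
  -- Beyond the index w - 1 the sorted sequence is continued with slope 1, to be strictly increasing
  -- on all of ℕ.
  refine ⟨(Tuple.sort u)⁻¹,
    fun x => h ⟨min x (w - 1), by omega⟩ + (x - (w - 1)), ?_, fun x => ?_⟩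
  · refine strictMono_nat_of_lt_succ fun x => ?_
    rcases lt_or_ge x (w - 1) with hx | hx
    · have := hs (a := ⟨min x (w - 1), by omega⟩) (b := ⟨min (x + 1) (w - 1), by omega⟩)
        (by simp only [Fin.mk_lt_mk]; omega)
      omega
    · have e : min (x + 1) (w - 1) = min x (w - 1) := by omega
      simp only [e]
      omega
  · have h1 : min (((Tuple.sort u)⁻¹ x : Fin w) : ℕ) (w - 1) = ((Tuple.sort u)⁻¹ x : Fin w) := by
      have := ((Tuple.sort u)⁻¹ x).2
      omega
    have h2 : (((Tuple.sort u)⁻¹ x : Fin w) : ℕ) - (w - 1) = 0 := by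
      have := ((Tuple.sort u)⁻¹ x).2
      omega
    simp only [h1, h2, Fin.eta, add_zero, hh, Function.comp_apply]
    exact congrArg u ((Tuple.sort u).apply_symm_apply x).symm

theorem cycSeq_of_lt {m : ℕ} [NeZero m] (σ : Equiv.Perm (Fin m)) {x : ℕ} (hx : x < m) :
    cycSeq σ x = σ ⟨x, hx⟩ := by
  have : Fin.ofNat m x = ⟨x, hx⟩ := Fin.ext (by simp [Fin.ofNat, Nat.mod_eq_of_lt hx])
  simp only [cycSeq, this]

/-- The relative order of the entries of a uniform random permutation at a set of positions is
uniform, and independent of everything that is symmetric in these positions. -/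
theorem expect_pattern_mul {m w : ℕ} [NeZero w] {Q : (ℕ → ℕ) → Prop}
    (hQ : IsPattern w Q) (e : ℕ → Fin m) (he : Set.InjOn e (Set.Iio w))
    (g : Equiv.Perm (Fin m) → ℝ)
    (hg : ∀ σ π : Equiv.Perm (Fin m), (∀ y, (∀ x < w, y ≠ e x) → π y = y) → g (σ * π) = g σ) :
    𝔼 σ : Equiv.Perm (Fin m), ind (Q fun x => (σ (e x) : ℕ)) * g σ =
      patternProb w Q * 𝔼 σ, g σ := by
  let e' : Fin w ↪ Fin m := ⟨fun x => e x, fun x y h => Fin.ext (he x.2 y.2 h)⟩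
  have hext : ∀ (τ : Equiv.Perm (Fin w)) (x : Fin w),
      τ.viaFintypeEmbedding e' (e x) = e (τ x) := fun τ x =>
    Equiv.Perm.viaFintypeEmbedding_apply_image (f := e') τ x
  have hfix : ∀ (τ : Equiv.Perm (Fin w)) (y), (∀ x < w, y ≠ e x) →
      τ.viaFintypeEmbedding e' y = y := fun τ y hy =>
    Equiv.Perm.viaFintypeEmbedding_apply_notMem_range (f := e') τ
      (by rintro ⟨x, rfl⟩; exact hy x x.2 rfl)
  -- Permuting the chosen positions by τ preserves the uniform law of σ and does not change g.
  have h1 : ∀ τ : Equiv.Perm (Fin w),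
      𝔼 σ : Equiv.Perm (Fin m), ind (Q fun x => (σ (e x) : ℕ)) * g σ =
      𝔼 σ : Equiv.Perm (Fin m),
        ind (Q fun x => (σ (τ.viaFintypeEmbedding e' (e x)) : ℕ)) * g σ := by
    intro τ
    refine (Fintype.expect_equiv (Equiv.mulRight (τ.viaFintypeEmbedding e')) _ _
      fun σ => ?_).symm
    simp only [Equiv.coe_mulRight, Equiv.Perm.mul_apply, hg σ _ (hfix τ)]
  -- For fixed σ, with ρ the relative order of its chosen entries, the pattern seen is that of ρτ,
  -- and this is uniform when τ is.
  have h2 : ∀ σ : Equiv.Perm (Fin m),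
      𝔼 τ : Equiv.Perm (Fin w), ind (Q fun x => (σ (τ.viaFintypeEmbedding e' (e x)) : ℕ)) =
        patternProb w Q := by
    intro σ
    obtain ⟨ρ, f, hf, hρ⟩ := exists_strictMono_comp_perm (fun x : Fin w => (σ (e x) : ℕ))
      (fun x y h => e'.injective (σ.injective (Fin.ext h)))
    refine Fintype.expect_equiv (Equiv.mulLeft ρ) _ _ fun τ => ind_congr ?_
    refine (hQ.congr _ _ fun x hx => ?_).trans (hQ.comp _ f hf)
    have := hext τ ⟨x, hx⟩
    simp only at this
    rw [this, hρ, Function.comp_apply, cycSeq_of_lt _ hx]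
    rfl
  have h3 : 𝔼 σ : Equiv.Perm (Fin m), ind (Q fun x => (σ (e x) : ℕ)) * g σ =
      𝔼 τ : Equiv.Perm (Fin w), 𝔼 σ : Equiv.Perm (Fin m),
        ind (Q fun x => (σ (τ.viaFintypeEmbedding e' (e x)) : ℕ)) * g σ := by
    rw [Finset.expect_congr rfl fun τ _ => (h1 τ).symm, Fintype.expect_const]
  rw [h3, Finset.expect_comm, Finset.mul_expect]
  refine Finset.expect_congr rfl fun σ _ => ?_
  rw [← Finset.expect_mul, h2]

/-- Every position of `W` is equally likely to carry the smallest entry in `W`. -/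
theorem expect_min_mul {m : ℕ} (W : Finset (Fin m)) {a : Fin m} (ha : a ∈ W)
    (g : Equiv.Perm (Fin m) → ℝ)
    (hg : ∀ b ∈ W, ∀ σ : Equiv.Perm (Fin m), g (σ * Equiv.swap a b) = g σ) :
    𝔼 σ : Equiv.Perm (Fin m), ind (∀ y ∈ W, y ≠ a → σ a < σ y) * g σ =
      (𝔼 σ, g σ) / W.card := by
  have hW : (W.card : ℝ) ≠ 0 := by
    exact_mod_cast (Finset.card_pos.2 ⟨a, ha⟩).ne'
  -- Exchanging the positions a and b moves the minimum from one to the other. The sum over b is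
  -- then evaluated by uniqueness of the minimum.
  have h1 : ∀ b ∈ W, 𝔼 σ : Equiv.Perm (Fin m), ind (∀ y ∈ W, y ≠ b → σ b < σ y) * g σ =
      𝔼 σ : Equiv.Perm (Fin m), ind (∀ y ∈ W, y ≠ a → σ a < σ y) * g σ := by
    intro b hb
    refine Fintype.expect_equiv (Equiv.mulRight (Equiv.swap a b)) _ _ fun σ => ?_
    have hmem : ∀ y ∈ W, Equiv.swap a b y ∈ W := by
      intro y hy
      rw [Equiv.swap_apply_def]
      split_ifs <;> assumption
    simp only [Equiv.coe_mulRight, hg b hb]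
    congr 1
    refine ind_congr ?_
    simp only [Equiv.Perm.mul_apply, Equiv.swap_apply_left]
    constructor
    · intro h y hy hya
      refine h _ (hmem y hy) fun h' => hya ?_
      have := congrArg (Equiv.swap a b) h'
      simpa using this
    · intro h y hy hyb
      have := h _ (hmem y hy) fun h' => hyb (by
        have := congrArg (Equiv.swap a b) h'
        simpa using this)
      simpa using this
  have h2 : ∀ σ : Equiv.Perm (Fin m), ∑ b ∈ W, ind (∀ y ∈ W, y ≠ b → σ b < σ y) = 1 := by
    intro σ
    obtain ⟨b, hb, hmin⟩ := Finset.exists_min_image W σ ⟨a, ha⟩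
    rw [Finset.sum_eq_single_of_mem b hb fun c hc hcb => ind_false fun h =>
      absurd (h b hb hcb.symm) (not_lt.2 (hmin c hc))]
    exact ind_true fun y hy hyb => lt_of_le_of_ne (hmin y hy) fun h => hyb (σ.injective h.symm)
  rw [eq_div_iff hW, mul_comm, ← nsmul_eq_mul, ← Finset.sum_const, ← Finset.sum_congr rfl h1,
    ← Finset.expect_sum_comm]
  refine Finset.expect_congr rfl fun σ _ => ?_
  rw [← Finset.sum_mul, h2, one_mul]

theorem abs_sub_le_of_increment {g : ℕ → ℝ} {d : ℝ} (h : ∀ x, |g (x + 1) - g x| ≤ d) (x k : ℕ) :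
    |g (x + k) - g x| ≤ d * k := by
  induction k with
  | zero => simp
  | succ k ih =>
    have := abs_sub_le (g (x + (k + 1))) (g (x + k)) (g x)
    have h2 := h (x + k)
    push_cast
    rw [← add_assoc] at *
    linarith

/-! ### Poisson approximation for the number of occurrences of a cyclic pattern -/

/-- The positions of the windows of length `w` that meet the window at `i`. -/
def nbhd (m w i : ℕ) : Finset ℕ :=
  (Finset.range (2 * w - 1)).image fun e => (i + (m - (w - 1)) + e) % m

/-- Only an inequality, since offsets coincide modulo m when m is less than 2w - 1. -/
theorem card_nbhd_le (m w i : ℕ) : (nbhd m w i).card ≤ 2 * w - 1 :=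
  Finset.card_image_le.trans (Finset.card_range _).le

theorem self_mem_nbhd {m w i : ℕ} (hw : 1 ≤ w) (hwm : w ≤ m) (hi : i < m) : i ∈ nbhd m w i := by
  refine Finset.mem_image.2 ⟨w - 1, Finset.mem_range.2 (by omega), ?_⟩
  rw [show i + (m - (w - 1)) + (w - 1) = i + m by omega, Nat.add_mod_right, Nat.mod_eq_of_lt hi]

section Cyclic

variable {m w : ℕ} [NeZero m] (Q : (ℕ → ℕ) → Prop)

/-- The indicator that the pattern `Q` occurs at the cyclic position `i`. -/
noncomputable def occ (i : ℕ) (σ : Equiv.Perm (Fin m)) : ℝ := ind (Q fun x => cycSeq σ (i + x))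

open Classical in
/-- The number of cyclic occurrences of the pattern `Q`. -/
noncomputable def occCount (σ : Equiv.Perm (Fin m)) : ℕ :=
  ((Finset.range m).filter fun i => Q fun x => cycSeq σ (i + x)).card

theorem occ_nonneg (i : ℕ) (σ : Equiv.Perm (Fin m)) : 0 ≤ occ Q i σ := ind_nonneg _

theorem occ_add_self (i : ℕ) (σ : Equiv.Perm (Fin m)) : occ Q (i + m) σ = occ Q i σ := by
  unfold occ
  congr 2
  funext x
  rw [add_right_comm, cycSeq_add_self]

theorem occ_mod (i : ℕ) (σ : Equiv.Perm (Fin m)) : occ Q (i % m) σ = occ Q i σ := by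
  unfold occ
  congr 2
  funext x
  rw [cycSeq_mod]

open Classical in
theorem cast_card_filter_occ (s : Finset ℕ) (σ : Equiv.Perm (Fin m)) :
    (((s.filter fun i => Q fun x => cycSeq σ (i + x)).card : ℕ) : ℝ) = ∑ i ∈ s, occ Q i σ := by
  rw [Finset.card_filter]
  push_cast
  refine Finset.sum_congr rfl fun i _ => ?_
  unfold occ ind
  rfl

theorem cast_occCount (σ : Equiv.Perm (Fin m)) :
    (occCount Q σ : ℝ) = ∑ i ∈ Finset.range m, occ Q i σ :=
  cast_card_filter_occ Q _ σ

variable {Q}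

theorem expect_occ_mul [NeZero w] (hQ : IsPattern w Q) (hwm : w ≤ m) (i : ℕ)
    (g : Equiv.Perm (Fin m) → ℝ)
    (hg : ∀ σ π : Equiv.Perm (Fin m), (∀ y, (∀ x < w, y ≠ Fin.ofNat m (i + x)) → π y = y) →
      g (σ * π) = g σ) :
    𝔼 σ, occ Q i σ * g σ = patternProb w Q * 𝔼 σ, g σ :=
  expect_pattern_mul hQ (fun x => Fin.ofNat m (i + x))
    (fun x hx y hy h => by
      have hx' : x < w := hx
      have hy' : y < w := hy
      have := eq_of_ofNat_eq (s := i) (by omega) (by omega) (by omega) (by omega) h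
      omega) g hg

theorem expect_occ [NeZero w] (hQ : IsPattern w Q) (hwm : w ≤ m) (i : ℕ) :
    𝔼 σ : Equiv.Perm (Fin m), occ Q i σ = patternProb w Q := by
  simpa using expect_occ_mul hQ hwm i (fun _ => 1) fun _ _ _ => rfl

theorem expect_occCount [NeZero w] (hQ : IsPattern w Q) (hwm : w ≤ m) :
    𝔼 σ : Equiv.Perm (Fin m), (occCount Q σ : ℝ) = m * patternProb w Q := by
  simp only [cast_occCount]
  rw [Finset.expect_sum_comm, Finset.sum_congr rfl fun i _ => expect_occ hQ hwm i]
  simp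

theorem nbhd_subset (i : ℕ) : nbhd m w i ⊆ Finset.range m := by
  intro j hj
  obtain ⟨e, _, rfl⟩ := Finset.mem_image.1 hj
  exact Finset.mem_range.2 (Nat.mod_lt _ (Nat.pos_of_ne_zero (NeZero.ne m)))

theorem ofNat_ne_of_notMem_nbhd {i j x y : ℕ} (hwm : w ≤ m) (hj : j < m)
    (hij : j ∉ nbhd m w i) (hx : x < w) (hy : y < w) :
    Fin.ofNat m (j + y) ≠ Fin.ofNat m (i + x) := by
  intro h
  -- A common position i + x ≡ j + y means j ≡ i - (w-1) + e with e = x + (w-1) - y.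
  refine hij (Finset.mem_image.2 ⟨x + (w - 1) - y, Finset.mem_range.2 (by omega), ?_⟩)
  rw [ofNat_eq_ofNat_iff] at h
  have h2 : i + (m - (w - 1)) + (x + (w - 1) - y) ≡ j [MOD m] := by
    refine Nat.ModEq.add_right_cancel' y ?_
    rw [show i + (m - (w - 1)) + (x + (w - 1) - y) + y = i + x + m by omega]
    exact (Nat.add_modEq_right).trans h.symm
  rw [h2, Nat.mod_eq_of_lt hj]

theorem occ_mul_of_notMem_nbhd (hQ : IsPattern w Q) {i j : ℕ} (hwm : w ≤ m) (hj : j < m)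
    (hij : j ∉ nbhd m w i) (σ π : Equiv.Perm (Fin m))
    (hπ : ∀ y, (∀ x < w, y ≠ Fin.ofNat m (i + x)) → π y = y) :
    (Q fun x => cycSeq (σ * π) (j + x)) ↔ Q fun x => cycSeq σ (j + x) := by
  refine hQ.congr _ _ fun y hy => ?_
  simp only [cycSeq, Equiv.Perm.mul_apply]
  rw [hπ _ fun x hx => ofNat_ne_of_notMem_nbhd hwm hj hij hx hy]

/-- Only the two neighbours at distance exactly w - 1, one on each side, can occur together with i;
these are the offsets e = 0 and e = 2w - 2. -/
theorem sum_nbhd_erase_le (hw : 2 ≤ w) (hwm : w ≤ m) {c : ℝ} (hc : 0 ≤ c)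
    (h0 : ∀ i d, 1 ≤ d → d < w - 1 → ∀ σ : Equiv.Perm (Fin m), occ Q i σ * occ Q (i + d) σ = 0)
    (h1 : ∀ i, 𝔼 σ : Equiv.Perm (Fin m), occ Q i σ * occ Q (i + (w - 1)) σ ≤ c) (i : ℕ)
    (hi : i < m) :
    ∑ j ∈ (nbhd m w i).erase i, 𝔼 σ : Equiv.Perm (Fin m), occ Q i σ * occ Q j σ ≤ 2 * c := by
  set F : ℕ → ℝ := fun j => 𝔼 σ : Equiv.Perm (Fin m), occ Q i σ * occ Q j σ with hF
  have hF0 : ∀ j, 0 ≤ F j := fun j =>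
    Finset.expect_nonneg fun σ _ => mul_nonneg (occ_nonneg Q _ σ) (occ_nonneg Q _ σ)
  have hsub : (nbhd m w i).erase i ⊆
      ((Finset.range (2 * w - 1)).erase (w - 1)).image fun e => (i + (m - (w - 1)) + e) % m := by
    intro j hj
    obtain ⟨hji, hj⟩ := Finset.mem_erase.1 hj
    obtain ⟨e, he, rfl⟩ := Finset.mem_image.1 hj
    refine Finset.mem_image_of_mem _ (Finset.mem_erase.2 ⟨?_, he⟩)
    rintro rfl
    rw [show i + (m - (w - 1)) + (w - 1) = i + m by omega, Nat.add_mod_right,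
      Nat.mod_eq_of_lt hi] at hji
    exact hji rfl
  have hterm : ∀ e ∈ (Finset.range (2 * w - 1)).erase (w - 1),
      F ((i + (m - (w - 1)) + e) % m) ≤
        (if e = 0 then c else 0) + (if e = 2 * w - 2 then c else 0) := by
    intro e he
    obtain ⟨hne, he⟩ := Finset.mem_erase.1 he
    have he := Finset.mem_range.1 he
    simp only [hF, occ_mod]
    rcases lt_or_gt_of_ne hne with hlt | hgt
    -- A left neighbour: the roles are exchanged, since i lies w - 1 - e steps after it on the
    -- cycle.
    · have e1 : ∀ σ : Equiv.Perm (Fin m), occ Q i σ * occ Q (i + (m - (w - 1)) + e) σ =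
          occ Q (i + (m - (w - 1)) + e) σ *
            occ Q ((i + (m - (w - 1)) + e) + (w - 1 - e)) σ := by
        intro σ
        rw [show (i + (m - (w - 1)) + e) + (w - 1 - e) = i + m by omega, occ_add_self, mul_comm]
      simp only [e1]
      rcases Nat.eq_zero_or_pos e with rfl | hpos
      · rw [if_pos rfl, if_neg (by omega)]
        simpa using h1 (i + (m - (w - 1)))
      · rw [if_neg (by omega), if_neg (by omega), add_zero,
          Finset.expect_eq_zero fun σ _ => h0 _ _ (by omega) (by omega) σ]
    · have e1 : ∀ σ : Equiv.Perm (Fin m), occ Q i σ * occ Q (i + (m - (w - 1)) + e) σ =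
          occ Q i σ * occ Q (i + (e - (w - 1))) σ := by
        intro σ
        rw [show i + (m - (w - 1)) + e = i + (e - (w - 1)) + m by omega, occ_add_self]
      simp only [e1]
      rcases eq_or_ne e (2 * w - 2) with rfl | hne'
      · rw [if_neg (by omega), if_pos rfl, zero_add,
          show 2 * w - 2 - (w - 1) = w - 1 by omega]
        exact h1 _
      · rw [if_neg (by omega), if_neg hne', add_zero,
          Finset.expect_eq_zero fun σ _ => h0 _ _ (by omega) (by omega) σ]
  calc ∑ j ∈ (nbhd m w i).erase i, F j
      ≤ ∑ j ∈ ((Finset.range (2 * w - 1)).erase (w - 1)).image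
          fun e => (i + (m - (w - 1)) + e) % m, F j :=
        Finset.sum_le_sum_of_subset_of_nonneg hsub fun j _ _ => hF0 j
    -- Different offsets may yield the same position on a short cycle; all terms are nonnegative, so
    -- counting it repeatedly only increases the sum.
    _ ≤ ∑ e ∈ (Finset.range (2 * w - 1)).erase (w - 1), F ((i + (m - (w - 1)) + e) % m) :=
        Finset.sum_image_le_of_nonneg fun j _ => hF0 _
    _ ≤ ∑ e ∈ (Finset.range (2 * w - 1)).erase (w - 1),
          ((if e = 0 then c else 0) + (if e = 2 * w - 2 then c else 0)) :=
        Finset.sum_le_sum hterm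
    _ ≤ 2 * c := by
        rw [Finset.sum_add_distrib, Finset.sum_ite_eq', Finset.sum_ite_eq']
        split_ifs <;> linarith

/-- Local Poisson approximation, in terms of the Stein operator. -/
theorem abs_expect_stein_occCount_le [NeZero w] (hQ : IsPattern w Q) (hw : 2 ≤ w) (hwm : w ≤ m)
    {c : ℝ} (hc : 0 ≤ c)
    (h0 : ∀ i d, 1 ≤ d → d < w - 1 → ∀ σ : Equiv.Perm (Fin m), occ Q i σ * occ Q (i + d) σ = 0)
    (h1 : ∀ i, 𝔼 σ : Equiv.Perm (Fin m), occ Q i σ * occ Q (i + (w - 1)) σ ≤ c)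
    {g : ℕ → ℝ} {d : ℝ} (hg : ∀ x, |g (x + 1) - g x| ≤ d) :
    |𝔼 σ : Equiv.Perm (Fin m), (m * patternProb w Q * g (occCount Q σ) -
        occCount Q σ * g (occCount Q σ - 1))| ≤
      d * (m * (2 * w) * patternProb w Q ^ 2 + 2 * m * c) := by
  classical
  have hd : 0 ≤ d := (abs_nonneg _).trans (hg 0)
  set q := patternProb w Q with hq
  have hq0 : 0 ≤ q := patternProb_nonneg _ _
  set V : ℕ → Equiv.Perm (Fin m) → ℕ := fun i σ =>
    ((Finset.range m \ nbhd m w i).filter fun j => Q fun x => cycSeq σ (j + x)).card with hV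
  set Y : ℕ → Equiv.Perm (Fin m) → ℕ := fun i σ =>
    ((nbhd m w i).filter fun j => Q fun x => cycSeq σ (j + x)).card with hY
  have hVY : ∀ i σ, occCount Q σ = V i σ + Y i σ := by
    intro i σ
    simp only [hV, hY, occCount, Finset.card_filter]
    rw [Finset.sum_sdiff (nbhd_subset i)]
  -- `V i` depends only on entries outside the window at i, so it is independent of the occurrence
  -- at i.
  have hVinv : ∀ i, 𝔼 σ : Equiv.Perm (Fin m), occ Q i σ * g (V i σ) = q * 𝔼 σ, g (V i σ) := by
    intro i
    refine expect_occ_mul hQ hwm i _ fun σ π hπ => ?_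
    congr 1
    simp only [hV]
    congr 1
    refine Finset.filter_congr fun j hj => ?_
    obtain ⟨hj1, hj2⟩ := Finset.mem_sdiff.1 hj
    exact occ_mul_of_notMem_nbhd hQ hwm (Finset.mem_range.1 hj1) hj2 σ π hπ
  have hYE : ∀ i, 𝔼 σ, (Y i σ : ℝ) ≤ 2 * w * q := by
    intro i
    simp only [hY, cast_card_filter_occ]
    rw [Finset.expect_sum_comm, Finset.sum_congr rfl fun i _ => expect_occ hQ hwm i,
      Finset.sum_const, nsmul_eq_mul]
    have : ((nbhd m w i).card : ℝ) ≤ 2 * w := by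
      have := card_nbhd_le m w i
      have : (nbhd m w i).card ≤ 2 * w := by omega
      exact_mod_cast this
    gcongr
  have hterm : ∀ i ∈ Finset.range m, |𝔼 σ : Equiv.Perm (Fin m),
      (q * g (occCount Q σ) - occ Q i σ * g (occCount Q σ - 1))| ≤
      d * (q * (2 * w * q)) + d * (2 * c) := by
    intro i hi
    have him := Finset.mem_range.1 hi
    -- Both arguments of g are compared with `V i`; by independence the two comparison terms cancel.
    have e1 : 𝔼 σ : Equiv.Perm (Fin m),
        (q * g (occCount Q σ) - occ Q i σ * g (occCount Q σ - 1)) =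
        𝔼 σ : Equiv.Perm (Fin m), (q * (g (occCount Q σ) - g (V i σ))) -
        𝔼 σ : Equiv.Perm (Fin m), (occ Q i σ * (g (occCount Q σ - 1) - g (V i σ))) := by
      simp only [mul_sub, Finset.expect_sub_distrib, hVinv i]
      rw [← Finset.mul_expect, ← Finset.mul_expect]
      ring
    have e2 : |𝔼 σ : Equiv.Perm (Fin m), (q * (g (occCount Q σ) - g (V i σ)))| ≤
        d * (q * (2 * w * q)) := by
      calc _ ≤ 𝔼 σ : Equiv.Perm (Fin m), |q * (g (occCount Q σ) - g (V i σ))| :=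
            Finset.abs_expect_le _ _
        _ ≤ 𝔼 σ : Equiv.Perm (Fin m), d * (q * (Y i σ : ℝ)) := by
            refine Finset.expect_le_expect fun σ _ => ?_
            rw [abs_mul, abs_of_nonneg hq0, hVY i σ]
            have := abs_sub_le_of_increment hg (V i σ) (Y i σ)
            calc _ ≤ q * (d * (Y i σ : ℝ)) := by gcongr
              _ = _ := by ring
        _ = d * (q * 𝔼 σ, (Y i σ : ℝ)) := by rw [← Finset.mul_expect, ← Finset.mul_expect]
        _ ≤ _ := by have := hYE i; gcongr
    have e3 : |𝔼 σ : Equiv.Perm (Fin m), (occ Q i σ * (g (occCount Q σ - 1) - g (V i σ)))| ≤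
        d * (2 * c) := by
      calc _ ≤ 𝔼 σ : Equiv.Perm (Fin m), |occ Q i σ * (g (occCount Q σ - 1) - g (V i σ))| :=
            Finset.abs_expect_le _ _
        _ ≤ 𝔼 σ : Equiv.Perm (Fin m),
              d * ∑ j ∈ (nbhd m w i).erase i, occ Q i σ * occ Q j σ := by
            refine Finset.expect_le_expect fun σ _ => ?_
            rw [abs_mul, abs_of_nonneg (occ_nonneg Q i σ), ← Finset.mul_sum]
            by_cases hQi : Q fun x => cycSeq σ (i + x)
            · have hocc : occ Q i σ = 1 := ind_true hQi
              have hY1 : (Y i σ : ℝ) = 1 + ∑ j ∈ (nbhd m w i).erase i, occ Q j σ := by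
                simp only [hY, cast_card_filter_occ]
                rw [← Finset.add_sum_erase _ _ (self_mem_nbhd (by omega) hwm him), hocc]
              have hY2 : 1 ≤ Y i σ := by
                have : (1 : ℝ) ≤ Y i σ := by
                  rw [hY1]
                  linarith [Finset.sum_nonneg fun j (_ : j ∈ (nbhd m w i).erase i) =>
                    occ_nonneg Q j σ]
                exact_mod_cast this
              -- When the pattern occurs at i, removing this occurrence leaves `V i` and the other
              -- neighbours; here the shifted index of g fits.
              have h2 : occCount Q σ - 1 = V i σ + (Y i σ - 1) := by rw [hVY i σ]; omega
              have := abs_sub_le_of_increment hg (V i σ) (Y i σ - 1)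
              rw [h2, hocc, one_mul, one_mul]
              refine this.trans (le_of_eq ?_)
              rw [Nat.cast_sub hY2, hY1]
              push_cast
              ring
            · have hocc : occ Q i σ = 0 := ind_false hQi
              simp [hocc]
        _ = d * ∑ j ∈ (nbhd m w i).erase i, 𝔼 σ : Equiv.Perm (Fin m), occ Q i σ * occ Q j σ := by
            rw [← Finset.mul_expect, Finset.expect_sum_comm]
        _ ≤ _ := by
            have := sum_nbhd_erase_le hw hwm hc h0 h1 i him
            gcongr
    rw [e1]
    exact (abs_sub _ _).trans (add_le_add e2 e3)
  have hsum : ∀ σ : Equiv.Perm (Fin m), (m * q * g (occCount Q σ) -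
      occCount Q σ * g (occCount Q σ - 1)) =
      ∑ i ∈ Finset.range m, (q * g (occCount Q σ) - occ Q i σ * g (occCount Q σ - 1)) := by
    intro σ
    rw [Finset.sum_sub_distrib, ← Finset.sum_mul _ _ (g (occCount Q σ - 1)), ← cast_occCount,
      Finset.sum_const, Finset.card_range, nsmul_eq_mul]
    ring
  simp only [hsum]
  rw [Finset.expect_sum_comm]
  refine (Finset.abs_sum_le_sum_abs _ _).trans ((Finset.sum_le_sum hterm).trans (le_of_eq ?_))
  rw [Finset.sum_const, Finset.card_range, nsmul_eq_mul]
  ring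

end Cyclic

/-! ### Heap-ordered binary trees of sequences -/

namespace BinaryTree

/-- `t` is heap-ordered, with the entries `v s, v (s + 1), …` as its labels in symmetric order. -/
def IsHeapOf (v : ℕ → ℕ) : ℕ → BinaryTree ℕ → Prop
  | _, nil => True
  | s, node a l r => v (s + l.numNodes) = a ∧ (∀ x < l.numNodes, a < v (s + x)) ∧
      (∀ x < r.numNodes, a < v (s + l.numNodes + 1 + x)) ∧
      IsHeapOf v s l ∧ IsHeapOf v (s + l.numNodes + 1) r

theorem IsHeapOf.congr {v v' : ℕ → ℕ} {t : BinaryTree ℕ} : ∀ {s s' : ℕ},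
    (∀ x < t.numNodes, v (s + x) = v' (s' + x)) → IsHeapOf v s t → IsHeapOf v' s' t := by
  induction t with
  | nil => intros; trivial
  | node a l r ihl ihr =>
    intro s s' h ⟨h1, h2, h3, h4, h5⟩
    simp only [numNodes] at h
    refine ⟨?_, fun x hx => ?_, fun x hx => ?_, ihl (fun x hx => h x (by omega)) h4,
      ihr (fun x hx => ?_) h5⟩
    · rw [← h _ (by omega), h1]
    · rw [← h _ (by omega)]; exact h2 x hx
    · have := h (l.numNodes + 1 + x) (by omega)
      simp only [← add_assoc] at this
      rw [← this]; exact h3 x hx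
    · have := h (l.numNodes + 1 + x) (by omega)
      simpa only [← add_assoc] using this

theorem numNodes_map {α β : Type*} (f : α → β) (t : BinaryTree α) :
    (t.map f).numNodes = t.numNodes := by
  induction t with
  | nil => rfl
  | node _ _ _ h h' => simp [BinaryTree.map, h, h']

theorem IsHeapOf.map {v : ℕ → ℕ} {f : ℕ → ℕ} (hf : StrictMono f) {t : BinaryTree ℕ} :
    ∀ {s : ℕ}, IsHeapOf v s t → IsHeapOf (f ∘ v) s (t.map f) := by
  induction t with
  | nil => intros; trivial
  | node a l r ihl ihr =>
    intro s ⟨h1, h2, h3, h4, h5⟩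
    simp only [BinaryTree.map, IsHeapOf, numNodes_map, Function.comp_apply]
    exact ⟨by rw [h1], fun x hx => hf (h2 x hx), fun x hx => hf (h3 x hx), ihl h4, ihr h5⟩

theorem IsHeapOf.of_comp {v : ℕ → ℕ} {f : ℕ → ℕ} (hf : StrictMono f) {t : BinaryTree ℕ} :
    ∀ {s : ℕ}, IsHeapOf (f ∘ v) s t → ∃ u : BinaryTree ℕ, t = u.map f ∧ IsHeapOf v s u := by
  induction t with
  | nil => exact fun _ => ⟨nil, rfl, trivial⟩
  | node a l r ihl ihr =>
    intro s ⟨h1, h2, h3, h4, h5⟩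
    obtain ⟨l', rfl, hl⟩ := ihl h4
    obtain ⟨r', rfl, hr⟩ := ihr h5
    simp only [numNodes_map, Function.comp_apply] at *
    subst h1
    exact ⟨node _ l' r', rfl, rfl, fun x hx => hf.lt_iff_lt.1 (h2 x hx),
      fun x hx => hf.lt_iff_lt.1 (h3 x hx), hl, hr⟩

/-- The root sits at the minimum of the block. If the left subtrees had different sizes, each root
would lie inside a subtree of the other and be larger than it. -/
theorem IsHeapOf.eq {v : ℕ → ℕ} {t : BinaryTree ℕ} : ∀ {t' : BinaryTree ℕ} {s : ℕ},
    IsHeapOf v s t → IsHeapOf v s t' → t.numNodes = t'.numNodes → t = t' := by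
  induction t with
  | nil =>
    rintro (_ | ⟨a, l, r⟩) s _ _ h
    · rfl
    · simp at h
  | node a l r ihl ihr =>
    rintro (_ | ⟨a', l', r'⟩) s ⟨h1, h2, h3, h4, h5⟩ h' h
    · simp at h
    · obtain ⟨h1', h2', h3', h4', h5'⟩ := h'
      simp only [numNodes] at h
      have hl : l.numNodes = l'.numNodes := by
        rcases lt_trichotomy l.numNodes l'.numNodes with hlt | heq | hgt
        · have e1 := h2' _ hlt
          have e2 := h3 (l'.numNodes - l.numNodes - 1) (by omega)
          rw [show s + l.numNodes + 1 + (l'.numNodes - l.numNodes - 1) = s + l'.numNodes by omega]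
            at e2
          omega
        · exact heq
        · have e1 := h2 _ hgt
          have e2 := h3' (l.numNodes - l'.numNodes - 1) (by omega)
          rw [show s + l'.numNodes + 1 + (l.numNodes - l'.numNodes - 1) = s + l.numNodes by omega]
            at e2
          omega
      rw [← hl] at h1' h5'
      rw [ihl h4 h4' hl, ihr h5 h5' (by omega), ← h1, h1']

/-- The heap-ordered tree of size `k` of the sequence `v` has property `P`. -/
def HeapIn (k : ℕ) (P : Set (BinaryTree ℕ)) (v : ℕ → ℕ) : Prop :=
  ∃ t : BinaryTree ℕ, t.numNodes = k ∧ IsHeapOf v 0 t ∧ t ∈ P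

theorem IsHeapOf.heapIn_iff {v : ℕ → ℕ} {s k : ℕ} {t : BinaryTree ℕ} (h : IsHeapOf v s t)
    (hk : t.numNodes = k) (P : Set (BinaryTree ℕ)) :
    HeapIn k P (fun x => v (s + x)) ↔ t ∈ P := by
  have h' : IsHeapOf (fun x => v (s + x)) 0 t := h.congr fun x _ => by simp
  refine ⟨fun ⟨u, hu, hv, hP⟩ => ?_, fun hP => ⟨t, hk, h', hP⟩⟩
  rwa [h'.eq hv (hk.trans hu.symm)]

/-- Relabelling the sequence relabels its heap-ordered tree, so stability of P under increasing
relabellings is what makes this a pattern. -/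
theorem isPattern_heapIn (k : ℕ) {P : Set (BinaryTree ℕ)} (hP : IsProperty P) :
    IsPattern k (HeapIn k P) := by
  have h1 : ∀ v v' : ℕ → ℕ, (∀ x < k, v x = v' x) → HeapIn k P v → HeapIn k P v' := by
    rintro v v' h ⟨t, rfl, ht, htP⟩
    exact ⟨t, rfl, ht.congr fun x hx => by simpa using h x hx, htP⟩
  refine ⟨fun v v' h => ⟨h1 v v' h, h1 v' v fun x hx => (h x hx).symm⟩, fun v f hf => ⟨?_, ?_⟩⟩
  · rintro ⟨t, rfl, ht, htP⟩
    obtain ⟨u, rfl, hu⟩ := ht.of_comp hf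
    exact ⟨u, (numNodes_map f u).symm, hu, (hP f hf u).1 htP⟩
  · rintro ⟨t, rfl, ht, htP⟩
    exact ⟨t.map f, numNodes_map f t, ht.map hf, (hP f hf t).2 htP⟩

/-! ### Counting fringe subtrees by windows of the sequence -/

open Classical in
/-- The indicator of a proposition, as a natural number. -/
noncomputable def natInd (p : Prop) : ℕ := if p then 1 else 0

theorem ite_eq_natInd (p : Prop) [Decidable p] : (if p then 1 else 0) = natInd p := by
  unfold natInd; congr

theorem natInd_congr {p q : Prop} (h : p ↔ q) : natInd p = natInd q := by rw [propext h]

/-- The number of nodes of `t` such that their left and right subtrees and the label satisfy `R`. -/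
noncomputable def countNodes (R : ℕ → BinaryTree ℕ → BinaryTree ℕ → Prop) : BinaryTree ℕ → ℕ
  | nil => 0
  | node a l r => natInd (R a l r) + countNodes R l + countNodes R r

theorem count_eq_countNodes (k : ℕ) (P : Set (BinaryTree ℕ)) (t : BinaryTree ℕ) :
    t.count k P = countNodes (fun a l r => (node a l r).numNodes = k ∧ node a l r ∈ P) t := by
  induction t with
  | nil => simp [count, fringe, countNodes]
  | node a l r ihl ihr =>
    simp only [count] at ihl ihr
    rw [count, fringe, countNodes, List.countP_cons, List.countP_append, ihl, ihr]
    simp only [decide_eq_true_eq, ite_eq_natInd]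
    rw [add_comm, add_assoc]

theorem count_map {f : ℕ → ℕ} (hf : StrictMono f) (k : ℕ) {P : Set (BinaryTree ℕ)}
    (hP : IsProperty P) (t : BinaryTree ℕ) : (t.map f).count k P = t.count k P := by
  simp only [count_eq_countNodes]
  induction t with
  | nil => rfl
  | node a l r ihl ihr =>
    have h1 : (node a l r).map f = node (f a) (l.map f) (r.map f) := rfl
    rw [h1, countNodes, ihl, ihr, countNodes]
    refine congrArg (· + _ + _) (natInd_congr (and_congr ?_ ?_))
    · rw [← h1, numNodes_map]
    · rw [← h1]; exact hP f hf _

open Classical in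
/-- Splitting the windows in a block of length `n` at the position `p`, where only one window
covers this position. -/
theorem card_filter_window_split {n p s i₀ k₀ k : ℕ} {W : ℕ → Prop} (hk : 1 ≤ k)
    (hi₀ : s ≤ i₀) (hi₀' : i₀ ≤ s + p) (hk₀ : s + p < i₀ + k₀) (hk₀' : i₀ + k₀ ≤ s + n)
    (hW : ∀ i, s ≤ i → i ≤ s + p → s + p < i + k → i + k ≤ s + n → W i → i = i₀ ∧ k = k₀) :
    ((Finset.Ico s (s + n)).filter fun i => i + k ≤ s + n ∧ W i).card =
      natInd (k = k₀ ∧ W i₀) +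
      ((Finset.Ico s (s + p)).filter fun i => i + k ≤ s + p ∧ W i).card +
      ((Finset.Ico (s + p + 1) (s + n)).filter fun i => i + k ≤ s + n ∧ W i).card := by
  have e1 : natInd (k = k₀ ∧ W i₀) =
      (({i₀} : Finset ℕ).filter fun i => k = k₀ ∧ W i).card := by
    rw [Finset.card_filter, Finset.sum_singleton, ite_eq_natInd]
  rw [e1, ← Finset.card_union_of_disjoint, ← Finset.card_union_of_disjoint]
  · congr 1
    ext i
    simp only [Finset.mem_filter, Finset.mem_Ico, Finset.mem_union, Finset.mem_singleton]
    constructor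
    · rintro ⟨⟨h1, h2⟩, h3, h4⟩
      rcases le_or_gt (i + k) (s + p) with h5 | h5
      · exact Or.inl (Or.inr ⟨⟨h1, by omega⟩, h5, h4⟩)
      · rcases lt_or_ge (s + p) i with h6 | h6
        · exact Or.inr ⟨⟨by omega, h2⟩, h3, h4⟩
        · obtain ⟨rfl, h⟩ := hW i h1 h6 h5 h3 h4
          exact Or.inl (Or.inl ⟨rfl, h, h4⟩)
    · rintro ((⟨rfl, h1, h2⟩ | ⟨⟨h1, h2⟩, h3, h4⟩) | ⟨⟨h1, h2⟩, h3, h4⟩)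
      · exact ⟨⟨by omega, by omega⟩, by omega, h2⟩
      · exact ⟨⟨h1, by omega⟩, by omega, h4⟩
      · exact ⟨⟨by omega, h2⟩, by omega, h4⟩
  · refine Finset.disjoint_left.2 fun i hi hi' => ?_
    simp only [Finset.mem_filter, Finset.mem_Ico, Finset.mem_union, Finset.mem_singleton] at hi hi'
    omega
  · refine Finset.disjoint_left.2 fun i hi hi' => ?_
    simp only [Finset.mem_filter, Finset.mem_Ico, Finset.mem_singleton] at hi hi'
    omega

/-- The window of length `k` at `i + 1` consists of a fringe subtree with property `P`. -/
def FringePattern (k : ℕ) (P : Set (BinaryTree ℕ)) (v : ℕ → ℕ) : Prop :=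
  (∀ x : Fin k, v 0 < v (1 + x) ∧ v (k + 1) < v (1 + x)) ∧ HeapIn k P fun x => v (1 + x)

theorem isPattern_fringePattern (k : ℕ) {P : Set (BinaryTree ℕ)} (hP : IsProperty P) :
    IsPattern (k + 2) (FringePattern k P) :=
  IsPattern.and (IsPattern.forall fun x => (isPattern_lt (by omega) (by omega)).and
    (isPattern_lt (by omega) (by omega))) ((isPattern_heapIn k hP).shift (by omega))

open Classical in
-- Windows are indexed by their left border. Each border of a window that contains the root has an
-- entry smaller than the root, hence lies outside the block, and the window is the whole block. The
-- other windows lie in the left or right subtree, where the root serves as a border for the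
-- induction.
theorem IsHeapOf.count_eq {v : ℕ → ℕ} {k : ℕ} (hk : 1 ≤ k) (P : Set (BinaryTree ℕ))
    {t : BinaryTree ℕ} : ∀ {s : ℕ}, IsHeapOf v (s + 1) t →
    (∀ x < t.numNodes, v s < v (s + 1 + x) ∧ v (s + 1 + t.numNodes) < v (s + 1 + x)) →
    t.count k P = ((Finset.Ico s (s + t.numNodes)).filter fun i =>
      i + k ≤ s + t.numNodes ∧ FringePattern k P fun x => v (i + x)).card := by
  simp only [count_eq_countNodes]
  induction t with
  | nil => simp [countNodes]
  | node a l r ihl ihr =>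
    intro s hh hb
    have hh' := hh
    obtain ⟨h1, h2, h3, h4, h5⟩ := hh
    have hn : (node a l r).numNodes = l.numNodes + r.numNodes + 1 := rfl
    rw [card_filter_window_split (p := l.numNodes) (i₀ := s) (k₀ := (node a l r).numNodes) hk
      le_rfl (by omega) (by omega) le_rfl]
    · have hb₀ := hb
      rw [hn] at hb
      have h5' : IsHeapOf v (s + l.numNodes + 1 + 1) r := by convert! h5 using 1; omega
      rw [countNodes, ihl h4, ihr h5']
      · refine congrArg₂ (· + ·) (congrArg₂ (· + ·) (natInd_congr ?_) rfl) ?_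
        · constructor
          · rintro ⟨rfl, hP⟩
            refine ⟨rfl, fun x => ?_, ?_⟩
            · have := hb₀ x x.2
              simpa only [← add_assoc, add_zero, add_right_comm s _ 1] using this
            · have := (hh'.heapIn_iff rfl P).2 hP
              simpa only [← add_assoc] using this
          · rintro ⟨rfl, -, hP⟩
            refine ⟨rfl, (hh'.heapIn_iff rfl P).1 ?_⟩
            simpa only [← add_assoc] using hP
        · rw [hn, show s + l.numNodes + 1 + r.numNodes = s + (l.numNodes + r.numNodes + 1) by omega]
      · intro x hx
        have e1 := h3 x hx
        have e2 := hb (l.numNodes + 1 + x) (by omega)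
        rw [show s + l.numNodes + 1 = s + 1 + l.numNodes by omega, h1]
        refine ⟨e1, ?_⟩
        convert! e2.2 using 2 <;> omega
      · intro x hx
        have e2 := hb x (by omega)
        rw [h1]
        exact ⟨e2.1, h2 x hx⟩
    · rintro i hi1 hi2 hi3 hi4 ⟨hW, -⟩
      have hroot := hW ⟨s + l.numNodes - i, by omega⟩
      simp only [add_zero] at hroot
      rw [show i + (1 + (s + l.numNodes - i)) = s + 1 + l.numNodes by omega, h1] at hroot
      have e1 : i = s := by
        by_contra hne
        have := h2 (i - s - 1) (by omega)
        rw [show s + 1 + (i - s - 1) = i by omega] at this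
        omega
      refine ⟨e1, ?_⟩
      by_contra hne
      have := h3 (i + k - s - l.numNodes - 1) (by omega)
      rw [show s + 1 + l.numNodes + 1 + (i + k - s - l.numNodes - 1) = i + (k + 1) by omega] at this
      omega

end BinaryTree

/-! ### Symmetric order -/

namespace BinaryTree

/-- The labels of a binary tree in symmetric order. -/
def inorder {α : Type*} : BinaryTree α → List α
  | nil => []
  | node a l r => l.inorder ++ a :: r.inorder

theorem length_inorder {α : Type*} (t : BinaryTree α) : t.inorder.length = t.numNodes := by
  induction t with
  | nil => rfl
  | node a l r ihl ihr =>
    simp only [inorder, numNodes, List.length_append, List.length_cons, ihl, ihr]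
    omega

theorem inorder_map {α β : Type*} (f : α → β) (t : BinaryTree α) :
    (t.map f).inorder = t.inorder.map f := by
  induction t with
  | nil => rfl
  | node a l r ihl ihr => simp [inorder, BinaryTree.map, ihl, ihr]

/-- The labels, measured by `f`, increase along every branch. -/
def IsHeap {α : Type*} (f : α → ℕ) : BinaryTree α → Prop
  | nil => True
  | node a l r => (∀ x ∈ l.inorder, f a < f x) ∧ (∀ x ∈ r.inorder, f a < f x) ∧
      IsHeap f l ∧ IsHeap f r

theorem IsHeap.map {α : Type*} {f : α → ℕ} {t : BinaryTree α} (h : IsHeap f t) :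
    IsHeap id (t.map f) := by
  induction t with
  | nil => trivial
  | node a l r ihl ihr =>
    obtain ⟨h1, h2, h3, h4⟩ := h
    refine ⟨fun x hx => ?_, fun x hx => ?_, ihl h3, ihr h4⟩
    · rw [inorder_map] at hx
      obtain ⟨y, hy, rfl⟩ := List.mem_map.1 hx
      exact h1 y hy
    · rw [inorder_map] at hx
      obtain ⟨y, hy, rfl⟩ := List.mem_map.1 hx
      exact h2 y hy

theorem IsHeap.isHeapOf {t : BinaryTree ℕ} (h : IsHeap id t) {v : ℕ → ℕ} : ∀ {s : ℕ},
    (∀ j < t.numNodes, t.inorder[j]? = some (v (s + j))) → IsHeapOf v s t := by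
  induction t with
  | nil => intros; trivial
  | node a l r ihl ihr =>
    intro s hv
    obtain ⟨h1, h2, h3, h4⟩ := h
    simp only [numNodes, inorder] at hv
    have hl : ∀ j < l.numNodes, l.inorder[j]? = some (v (s + j)) := by
      intro j hj
      rw [← hv j (by omega), List.getElem?_append_left (by rwa [length_inorder])]
    have hr : ∀ j < r.numNodes, r.inorder[j]? = some (v (s + l.numNodes + 1 + j)) := by
      intro j hj
      rw [show s + l.numNodes + 1 + j = s + (l.numNodes + (j + 1)) by omega,
        ← hv (l.numNodes + (j + 1)) (by omega),
        List.getElem?_append_right (by rw [length_inorder]; omega), length_inorder,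
        Nat.add_sub_cancel_left, List.getElem?_cons_succ]
    have ha : v (s + l.numNodes) = a := by
      have := hv l.numNodes (by omega)
      rw [List.getElem?_append_right (by rw [length_inorder]), length_inorder, Nat.sub_self,
        List.getElem?_cons_zero] at this
      exact (Option.some.inj this).symm
    exact ⟨ha, fun x hx => h1 _ (List.mem_of_getElem? (hl x hx)),
      fun x hx => h2 _ (List.mem_of_getElem? (hr x hx)), ihl h3 hl, ihr h4 hr⟩

end BinaryTree

/-! ### Binary search trees by insertion -/

open BinaryTree in
theorem inorder_bstInsert_perm (x : ℕ × ℕ) (t : BinaryTree (ℕ × ℕ)) :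
    (bstInsert x t).inorder.Perm (x :: t.inorder) := by
  induction t with
  | nil => exact List.Perm.refl _
  | node y l r ihl ihr =>
    unfold bstInsert
    split_ifs
    · exact ihl.append_right _
    · refine ((ihr.cons y).append_left _).trans ?_
      refine ((List.Perm.swap x y _).append_left _).trans ?_
      exact List.perm_middle

open BinaryTree in
theorem pairwise_inorder_bstInsert {x : ℕ × ℕ} {t : BinaryTree (ℕ × ℕ)}
    (ht : t.inorder.Pairwise fun y z => y.1 < z.1) (hx : ∀ y ∈ t.inorder, y.1 ≠ x.1) :
    (bstInsert x t).inorder.Pairwise fun y z => y.1 < z.1 := by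
  induction t with
  | nil => simp [bstInsert, inorder]
  | node y l r ihl ihr =>
    simp only [inorder] at ht hx
    obtain ⟨h1, h2, h3⟩ := List.pairwise_append.1 ht
    obtain ⟨h4, h5⟩ := List.pairwise_cons.1 h2
    have hy : y.1 ≠ x.1 := hx y (by simp)
    unfold bstInsert
    split_ifs with hxy
    · refine List.pairwise_append.2 ⟨ihl h1 fun z hz => hx z (by simp [hz]), h2, ?_⟩
      intro z hz u hu
      rcases List.mem_cons.1 ((inorder_bstInsert_perm x l).mem_iff.1 hz) with rfl | hz
      · rcases List.mem_cons.1 hu with rfl | hu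
        · exact hxy
        · exact hxy.trans (h4 u hu)
      · exact h3 z hz u hu
    · refine List.pairwise_append.2 ⟨h1, List.pairwise_cons.2
        ⟨?_, ihr h5 fun z hz => hx z (by simp [hz])⟩, ?_⟩
      · intro z hz
        rcases List.mem_cons.1 ((inorder_bstInsert_perm x r).mem_iff.1 hz) with rfl | hz
        · omega
        · exact h4 z hz
      · intro z hz u hu
        have hzy : z.1 < y.1 := h3 z hz y (by simp)
        rcases List.mem_cons.1 hu with rfl | hu
        · exact hzy
        · rcases List.mem_cons.1 ((inorder_bstInsert_perm x r).mem_iff.1 hu) with rfl | hu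
          · omega
          · exact hzy.trans (h4 u hu)

open BinaryTree in
theorem isHeap_bstInsert {x : ℕ × ℕ} {t : BinaryTree (ℕ × ℕ)} (ht : IsHeap Prod.snd t)
    (hx : ∀ y ∈ t.inorder, y.2 < x.2) : IsHeap Prod.snd (bstInsert x t) := by
  induction t with
  | nil => exact ⟨by simp [inorder], by simp [inorder], trivial, trivial⟩
  | node y l r ihl ihr =>
    simp only [inorder] at hx
    obtain ⟨h1, h2, h3, h4⟩ := ht
    unfold bstInsert
    split_ifs with hxy
    · refine ⟨fun z hz => ?_, h2, ihl h3 fun z hz => hx z (by simp [hz]), h4⟩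
      rcases List.mem_cons.1 ((inorder_bstInsert_perm x l).mem_iff.1 hz) with rfl | hz
      · exact hx y (by simp)
      · exact h1 z hz
    · refine ⟨h1, fun z hz => ?_, h3, ihr h4 fun z hz => hx z (by simp [hz])⟩
      rcases List.mem_cons.1 ((inorder_bstInsert_perm x r).mem_iff.1 hz) with rfl | hz
      · exact hx y (by simp)
      · exact h2 z hz

open BinaryTree in
-- Keys are sorted in symmetric order and time stamps form a heap. Each insertion adds a leaf with
-- the latest stamp, whence the induction from the end of the list.
theorem foldl_bstInsert (L : List (ℕ × ℕ)) (h1 : L.Pairwise fun x y => x.1 ≠ y.1)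
    (h2 : L.Pairwise fun x y => x.2 < y.2) :
    let t := L.foldl (fun t x => bstInsert x t) nil
    t.inorder.Perm L ∧ t.inorder.Pairwise (fun y z => y.1 < z.1) ∧ IsHeap Prod.snd t := by
  induction L using List.reverseRecOn with
  | nil => exact ⟨List.Perm.refl _, List.Pairwise.nil, trivial⟩
  | append_singleton L x ih =>
    obtain ⟨h1a, -, h1b⟩ := List.pairwise_append.1 h1
    obtain ⟨h2a, -, h2b⟩ := List.pairwise_append.1 h2
    obtain ⟨i1, i2, i3⟩ := ih h1a h2a
    simp only [List.foldl_append, List.foldl_cons, List.foldl_nil]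
    refine ⟨?_, pairwise_inorder_bstInsert i2 fun y hy => ?_, isHeap_bstInsert i3 fun y hy => ?_⟩
    · refine (inorder_bstInsert_perm _ _).trans ((i1.cons x).trans ?_)
      exact (List.perm_append_singleton x L).symm
    · exact h1b y (i1.mem_iff.1 hy) x (by simp)
    · exact h2b y (i1.mem_iff.1 hy) x (by simp)

open BinaryTree in
theorem bstOfPerm_spec {n : ℕ} (σ : Equiv.Perm (Fin n)) :
    IsHeap id (bstOfPerm σ) ∧
      (bstOfPerm σ).inorder = List.ofFn fun x : Fin n => ((σ.symm x : Fin n) : ℕ) := by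
  set L : List (ℕ × ℕ) := (List.finRange n).map fun i => ((σ i : ℕ), (i : ℕ)) with hL
  have hfold : bstOfPerm σ = (L.foldl (fun t x => bstInsert x t) nil).map Prod.snd := by
    rw [bstOfPerm, hL, List.foldl_map]
  have hfin : (List.finRange n).Pairwise (· < ·) := List.pairwise_lt_finRange n
  obtain ⟨i1, i2, i3⟩ := foldl_bstInsert L
    (by
      rw [hL, List.pairwise_map]
      exact hfin.imp fun {a b} h h' => h.ne (σ.injective (Fin.ext h')))
    (by
      rw [hL, List.pairwise_map]
      exact hfin.imp fun {a b} h => h)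
  set t := L.foldl (fun t x => bstInsert x t) nil
  set M : List (ℕ × ℕ) := (List.finRange n).map fun x : Fin n => ((x : ℕ), ((σ.symm x : Fin n) : ℕ)) with hM
  have hM2 : M.Pairwise fun y z => y.1 < z.1 := by
    rw [hM, List.pairwise_map]
    exact hfin.imp fun {a b} h => h
  have hML : M.Perm L := by
    have h1 : L = ((List.finRange n).map σ).map
        fun x : Fin n => ((x : ℕ), ((σ.symm x : Fin n) : ℕ)) := by
      rw [hL, List.map_map]
      simp [Function.comp_def]
    rw [h1, hM]
    exact (Equiv.Perm.map_finRange_perm σ).symm.map _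
  -- Both lists are sorted by key and are permutations of each other.
  have htM : t.inorder = M :=
    List.Perm.eq_of_pairwise (fun a b _ _ h h' => absurd (h.trans h') (lt_irrefl _)) i2 hM2
      (i1.trans hML.symm)
  rw [hfold]
  refine ⟨i3.map, ?_⟩
  rw [inorder_map, htM, hM, List.map_map, List.ofFn_eq_map]
  rfl

/-! ### Ordered forests as binary trees -/

/-- The binary tree of an ordered forest: the right subtree of a node carries its children, the
left subtree its later siblings. -/
def forestBin {α : Type} : List (OrdTree α) → BinaryTree α
  | [] => .nil
  | .node a cs :: ts => .node a (forestBin ts) (forestBin cs)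

/-- The ordered forest of a binary tree. -/
def binForest {α : Type} : BinaryTree α → List (OrdTree α)
  | .nil => []
  | .node a l r => .node a (binForest r) :: binForest l

theorem binForest_forestBin {α : Type} (ts : List (OrdTree α)) : binForest (forestBin ts) = ts := by
  induction ts using forestBin.induct with
  | case1 => simp [forestBin, binForest]
  | case2 a cs ts ih1 ih2 => simp [forestBin, binForest, ih1, ih2]

theorem forestBin_binForest {α : Type} (b : BinaryTree α) : forestBin (binForest b) = b := by
  induction b with
  | nil => simp [forestBin, binForest]
  | node a l r ihl ihr => simp [forestBin, binForest, ihl, ihr]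

theorem numNodes_forestBin {α : Type} (ts : List (OrdTree α)) :
    (forestBin ts).numNodes = (ts.map OrdTree.size).sum := by
  induction ts using forestBin.induct with
  | case1 => simp [forestBin]
  | case2 a cs ts ih1 ih2 => simp [forestBin, OrdTree.size, ih1, ih2]; omega

theorem forestBin_map {α β : Type} (f : α → β) (ts : List (OrdTree α)) :
    forestBin (ts.map (OrdTree.map f)) = (forestBin ts).map f := by
  induction ts using forestBin.induct with
  | case1 => simp [forestBin, BinaryTree.map]
  | case2 a cs ts ih1 ih2 => simp [forestBin, OrdTree.map, BinaryTree.map, ih1, ih2]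

theorem binForest_map {α β : Type} (f : α → β) (b : BinaryTree α) :
    binForest (b.map f) = (binForest b).map (OrdTree.map f) := by
  induction b with
  | nil => simp [binForest, BinaryTree.map]
  | node a l r ihl ihr => simp [binForest, BinaryTree.map, OrdTree.map, ihl, ihr]

open Classical in
-- A fringe subtree of the forest is a node with its right subtree; the left subtree holds later
-- siblings and is irrelevant.
theorem countP_fringe_forest (k : ℕ) (P : Set (OrdTree ℕ)) (ts : List (OrdTree ℕ)) :
    (ts.map OrdTree.fringe).flatten.countP (fun u => decide (u.size = k ∧ u ∈ P)) =
      (forestBin ts).countNodes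
        (fun a _ r => r.numNodes + 1 = k ∧ OrdTree.node a (binForest r) ∈ P) := by
  induction ts using forestBin.induct with
  | case1 => simp [forestBin, BinaryTree.countNodes]
  | case2 a cs ts ih1 ih2 =>
    rw [forestBin, BinaryTree.countNodes, List.map_cons, List.flatten_cons, List.countP_append,
      OrdTree.fringe, List.countP_cons, ih1, ih2]
    simp only [decide_eq_true_eq, BinaryTree.ite_eq_natInd, binForest_forestBin, numNodes_forestBin,
      OrdTree.size]
    omega

theorem OrdTree.count_eq_countNodes (k : ℕ) (P : Set (OrdTree ℕ)) (t : OrdTree ℕ) :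
    t.count k P = (forestBin [t]).countNodes
      (fun a _ r => r.numNodes + 1 = k ∧ OrdTree.node a (binForest r) ∈ P) := by
  rw [← countP_fringe_forest]
  simp [OrdTree.count]

/-- The binary trees of the ordered trees in `P`. -/
def binProperty (P : Set (OrdTree ℕ)) : Set (BinaryTree ℕ) :=
  {b | ∃ t ∈ P, b = forestBin [t]}

theorem forestBin_singleton_mem_binProperty {P : Set (OrdTree ℕ)} {t : OrdTree ℕ} :
    forestBin [t] ∈ binProperty P ↔ t ∈ P := by
  refine ⟨fun ⟨u, hu, h⟩ => ?_, fun h => ⟨t, h, rfl⟩⟩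
  have := congrArg binForest h
  rw [binForest_forestBin, binForest_forestBin] at this
  rwa [List.singleton_inj.1 this]

theorem forestBin_singleton {α : Type} (a : α) (cs : List (OrdTree α)) :
    forestBin [.node a cs] = .node a .nil (forestBin cs) := by
  simp [forestBin]

theorem node_nil_mem_binProperty {P : Set (OrdTree ℕ)} {a : ℕ} {r : BinaryTree ℕ} :
    .node a .nil r ∈ binProperty P ↔ OrdTree.node a (binForest r) ∈ P := by
  rw [← forestBin_singleton_mem_binProperty, forestBin_singleton, forestBin_binForest]

theorem isProperty_binProperty {P : Set (OrdTree ℕ)} (hP : OrdTree.IsProperty P) :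
    BinaryTree.IsProperty (binProperty P) := by
  have h1 : ∀ (f : ℕ → ℕ) (t : OrdTree ℕ), forestBin [t.map f] = (forestBin [t]).map f :=
    fun f t => by rw [← forestBin_map]; rfl
  intro f hf b
  constructor
  · rintro ⟨t, ht, h⟩
    have h2 := congrArg binForest h
    rw [binForest_map, binForest_forestBin] at h2
    obtain ⟨u, hu, rfl⟩ := List.map_eq_singleton_iff.1 h2
    refine ⟨u, (hP f hf u).1 ht, ?_⟩
    rw [← hu, forestBin_binForest]
  · rintro ⟨t, ht, rfl⟩
    exact ⟨t.map f, (hP f hf t).2 ht, (h1 f t).symm⟩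

/-- The window of length `k` at `0` consists of a fringe subtree with property `P`, in the depth
first order where later siblings come first. -/
def RecursivePattern (k : ℕ) (P : Set (OrdTree ℕ)) (v : ℕ → ℕ) : Prop :=
  (∀ x : Fin k, v k < v x) ∧ BinaryTree.HeapIn k (binProperty P) v

theorem isPattern_recursivePattern (k : ℕ) {P : Set (OrdTree ℕ)} (hP : OrdTree.IsProperty P) :
    IsPattern (k + 1) (RecursivePattern k P) :=
  IsPattern.and (IsPattern.forall fun x => isPattern_lt (by omega) (by omega)) <| by
    simpa using (BinaryTree.isPattern_heapIn k (isProperty_binProperty hP)).shift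
      (w' := k + 1) (s := 0) (by omega)

/-- A single ordered tree is encoded with an empty left subtree at its root, so the minimum comes
first. -/
theorem lt_of_heapIn_binProperty {k : ℕ} {P : Set (OrdTree ℕ)} {v : ℕ → ℕ}
    (h : BinaryTree.HeapIn k (binProperty P) v) {x : ℕ} (hx : x ≠ 0) (hxk : x < k) :
    v 0 < v x := by
  obtain ⟨t, rfl, ht, ⟨a, cs⟩, -, rfl⟩ := h
  rw [forestBin_singleton] at ht hxk
  obtain ⟨h1, -, h3, -, -⟩ := ht
  simp only [BinaryTree.numNodes, add_zero, zero_add] at h1 h3 hxk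
  have := h3 (x - 1) (by omega)
  rw [show 1 + (x - 1) = x by omega] at this
  rwa [h1]

open Classical BinaryTree in
-- A window containing the root of the block starts there, because its first entry is its smallest.
-- It extends to the end of the block, because the entry behind it must be smaller than the root. So
-- the root accounts for exactly one window, of length one plus the size of the right subtree.
theorem BinaryTree.IsHeapOf.countNodes_eq {v : ℕ → ℕ} {k : ℕ} (hk : 1 ≤ k) (P : Set (OrdTree ℕ))
    {t : BinaryTree ℕ} : ∀ {s : ℕ}, IsHeapOf v s t →
    (∀ x < t.numNodes, v (s + t.numNodes) < v (s + x)) →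
    t.countNodes (fun a _ r => r.numNodes + 1 = k ∧ OrdTree.node a (binForest r) ∈ P) =
      ((Finset.Ico s (s + t.numNodes)).filter fun i =>
        i + k ≤ s + t.numNodes ∧ RecursivePattern k P fun x => v (i + x)).card := by
  induction t with
  | nil => simp [countNodes]
  | node a l r ihl ihr =>
    intro s hh hb
    obtain ⟨h1, h2, h3, h4, h5⟩ := hh
    have hn : (node a l r).numNodes = l.numNodes + r.numNodes + 1 := rfl
    rw [card_filter_window_split (p := l.numNodes) (i₀ := s + l.numNodes)
      (k₀ := r.numNodes + 1) hk (by omega) (by omega) (by omega) (by omega)]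
    · rw [hn] at hb
      rw [BinaryTree.countNodes, ihl h4, ihr h5]
      · refine congrArg₂ (· + ·) (congrArg₂ (· + ·) (natInd_congr ?_) rfl) ?_
        · have hroot : IsHeapOf v (s + l.numNodes) (node a nil r) :=
            ⟨by simpa using h1, by simp, by simpa using h3, trivial, by simpa using h5⟩
          have hiff := hroot.heapIn_iff (k := r.numNodes + 1) (by simp) (binProperty P)
          rw [node_nil_mem_binProperty] at hiff
          constructor
          · rintro ⟨rfl, hP⟩
            refine ⟨rfl, fun x => ?_, hiff.2 hP⟩
            have := hb (l.numNodes + x) (by omega)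
            simpa only [← add_assoc] using this
          · rintro ⟨rfl, -, hP⟩
            exact ⟨rfl, hiff.1 hP⟩
        · rw [hn, show s + l.numNodes + 1 + r.numNodes = s + (l.numNodes + r.numNodes + 1) by omega]
      · intro x hx
        have := hb (l.numNodes + 1 + x) (by omega)
        convert! this using 2 <;> omega
      · intro x hx
        rw [h1]
        exact h2 x hx
    · rintro i hi1 hi2 hi3 hi4 ⟨hW, hH⟩
      have e1 : i = s + l.numNodes := by
        by_contra hne
        have e2 := lt_of_heapIn_binProperty hH (x := s + l.numNodes - i) (by omega) (by omega)
        simp only [add_zero] at e2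
        have e3 := h2 (i - s) (by omega)
        rw [show i + (s + l.numNodes - i) = s + l.numNodes by omega, h1] at e2
        rw [show s + (i - s) = i by omega] at e3
        omega
      refine ⟨e1, ?_⟩
      by_contra hne
      have e2 := hW ⟨0, by omega⟩
      simp only [add_zero] at e2
      have e3 := h3 (k - 1) (by omega)
      rw [e1, h1] at e2
      rw [show s + l.numNodes + 1 + (k - 1) = s + l.numNodes + k by omega] at e3
      omega

/-! ### Attaching a node -/

namespace BinaryTree

/-- Insert a node in front of all others in symmetric order. -/
def insertFirst {α : Type*} (i : α) : BinaryTree α → BinaryTree α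
  | nil => node i nil nil
  | node a l r => node a (insertFirst i l) r

/-- Insert a node with label `i` directly behind the nodes with label `p` in symmetric order. -/
def insertBehind (p i : ℕ) : BinaryTree ℕ → BinaryTree ℕ
  | nil => nil
  | node a l r => node a (insertBehind p i l)
      (if a = p then insertFirst i (insertBehind p i r) else insertBehind p i r)

theorem inorder_insertFirst {α : Type*} (i : α) (t : BinaryTree α) :
    (insertFirst i t).inorder = i :: t.inorder := by
  induction t with
  | nil => rfl
  | node a l r ihl _ => simp [insertFirst, inorder, ihl]

theorem inorder_insertBehind (p i : ℕ) (t : BinaryTree ℕ) :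
    (insertBehind p i t).inorder = t.inorder.flatMap fun x => if x = p then [x, i] else [x] := by
  induction t with
  | nil => rfl
  | node a l r ihl ihr =>
    simp only [insertBehind, inorder, ihl, List.flatMap_append, List.flatMap_cons]
    split_ifs <;> simp [inorder_insertFirst, ihr]

theorem IsHeap.insertFirst {i : ℕ} {t : BinaryTree ℕ} (ht : IsHeap id t)
    (hi : ∀ x ∈ t.inorder, x < i) : IsHeap id (insertFirst i t) := by
  induction t with
  | nil => exact ⟨by simp [inorder], by simp [inorder], trivial, trivial⟩
  | node a l r ihl _ =>
    obtain ⟨h1, h2, h3, h4⟩ := ht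
    simp only [inorder] at hi
    refine ⟨fun x hx => ?_, h2, ihl h3 fun x hx => hi x (by simp [hx]), h4⟩
    rw [inorder_insertFirst] at hx
    rcases List.mem_cons.1 hx with rfl | hx
    · exact hi a (by simp)
    · exact h1 x hx

theorem mem_inorder_insertBehind {p i x : ℕ} {t : BinaryTree ℕ}
    (hx : x ∈ (insertBehind p i t).inorder) : x = i ∨ x ∈ t.inorder := by
  rw [inorder_insertBehind] at hx
  obtain ⟨y, hy, hxy⟩ := List.mem_flatMap.1 hx
  split_ifs at hxy
  · rcases List.mem_cons.1 hxy with rfl | h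
    · exact Or.inr hy
    · exact Or.inl (by simpa using h)
  · exact Or.inr (by rwa [List.mem_singleton.1 hxy])

theorem IsHeap.insertBehind {p i : ℕ} {t : BinaryTree ℕ} (ht : IsHeap id t)
    (hi : ∀ x ∈ t.inorder, x < i) : IsHeap id (insertBehind p i t) := by
  induction t with
  | nil => trivial
  | node a l r ihl ihr =>
    obtain ⟨h1, h2, h3, h4⟩ := ht
    simp only [inorder] at hi
    have ha : a < i := hi a (by simp)
    have hr := ihr h4 fun x hx => hi x (by simp [hx])
    have hr2 : ∀ x ∈ (BinaryTree.insertBehind p i r).inorder, a < x := by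
      intro x hx
      rcases mem_inorder_insertBehind hx with rfl | hx
      · exact ha
      · exact h2 x hx
    refine ⟨fun x hx => ?_, ?_, ihl h3 fun x hx => hi x (by simp [hx]), ?_⟩
    · rcases mem_inorder_insertBehind hx with rfl | hx
      · exact ha
      · exact h1 x hx
    · split_ifs
      · intro x hx
        rw [inorder_insertFirst] at hx
        rcases List.mem_cons.1 hx with rfl | hx
        · exact ha
        · exact hr2 x hx
      · exact hr2
    · split_ifs with hap
      -- Below a node labelled p all labels exceed p, so the recursive insertion changes nothing
      -- there and the new label is placed only once.
      · refine hr.insertFirst fun x hx => ?_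
        rw [inorder_insertBehind] at hx
        obtain ⟨y, hy, hxy⟩ := List.mem_flatMap.1 hx
        have hya : a < y := h2 y hy
        rw [if_neg (by omega), List.mem_singleton] at hxy
        exact hi x (by simp [hxy, hy])
      · exact hr

end BinaryTree

open BinaryTree in
-- Later siblings lie to the left, so a new last tree becomes the leftmost node.
theorem forestBin_append_leaf {α : Type} (i : α) (ts : List (OrdTree α)) :
    forestBin (ts ++ [.node i []]) = insertFirst i (forestBin ts) := by
  induction ts with
  | nil => simp [forestBin, insertFirst]
  | cons t ts ih =>
    obtain ⟨a, cs⟩ := t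
    simp [forestBin, insertFirst, ih]

open BinaryTree in
theorem forestBin_attachChild (p i : ℕ) (ts : List (OrdTree ℕ)) :
    forestBin (ts.map (OrdTree.attachChild p i)) = insertBehind p i (forestBin ts) := by
  induction ts using forestBin.induct with
  | case1 => simp [forestBin, insertBehind]
  | case2 a cs ts ih1 ih2 =>
    rw [List.map_cons, OrdTree.attachChild, forestBin, forestBin, insertBehind, ih1]
    split_ifs
    · rw [forestBin_append_leaf, ih2]
    · rw [List.append_nil, ih2]

/-! ### Permutations that fix the first position -/

/-- The permutation of `Fin (n + 1)` that fixes `0` and acts as `ρ` on the others. -/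
def fixZero {n : ℕ} (ρ : Equiv.Perm (Fin n)) : Equiv.Perm (Fin (n + 1)) :=
  Equiv.Perm.decomposeFin.symm (0, ρ)

theorem fixZero_zero {n : ℕ} (ρ : Equiv.Perm (Fin n)) : fixZero ρ 0 = 0 :=
  Equiv.Perm.decomposeFin_symm_apply_zero _ _

theorem fixZero_succ {n : ℕ} (ρ : Equiv.Perm (Fin n)) (x : Fin n) :
    fixZero ρ x.succ = (ρ x).succ := by
  rw [fixZero, Equiv.Perm.decomposeFin_symm_apply_succ, Equiv.swap_self, Equiv.refl_apply]

theorem fixZero_injective {n : ℕ} : Function.Injective (fixZero (n := n)) := by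
  intro ρ ρ' h
  have := Equiv.Perm.decomposeFin.symm.injective h
  exact (Prod.mk.inj this).2

/-- Every permutation has exactly one rotation with the value 0 at the position 0. -/
theorem bijective_fixZero_mul_addRight (n : ℕ) :
    Function.Bijective fun x : Fin (n + 1) × Equiv.Perm (Fin n) =>
      fixZero x.2 * Equiv.addRight x.1 := by
  rw [Fintype.bijective_iff_injective_and_card]
  constructor
  · rintro ⟨c, ρ⟩ ⟨c', ρ'⟩ h
    simp only at h
    have hc : c = c' := by
      have h1 := congrArg (fun π : Equiv.Perm (Fin (n + 1)) => π (-c)) h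
      simp only [Equiv.Perm.mul_apply, Equiv.coe_addRight, neg_add_cancel, fixZero_zero] at h1
      rw [← fixZero_zero ρ'] at h1
      have h2 := (fixZero ρ').injective h1
      exact (neg_add_eq_zero.1 h2.symm)
    subst hc
    rw [fixZero_injective (mul_right_cancel h)]
  · simp [Fintype.card_perm, Nat.factorial_succ]

/-- This trades the linear sequence with an added smallest entry for a uniform cyclic arrangement,
in which all windows are alike. -/
theorem expect_eq_expect_fixZero {n : ℕ} (F : Equiv.Perm (Fin (n + 1)) → ℝ)
    (hF : ∀ σ c, F (σ * Equiv.addRight c) = F σ) :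
    𝔼 σ, F σ = 𝔼 ρ : Equiv.Perm (Fin n), F (fixZero ρ) := by
  rw [← Fintype.expect_bijective _ (bijective_fixZero_mul_addRight n)
    (fun x => F (fixZero x.2)) F fun x => (hF _ _).symm, ← Finset.univ_product_univ,
    Finset.expect_product' _ _ (fun (_ : Fin (n + 1)) ρ => F (fixZero ρ)), Fintype.expect_const]

theorem cycSeq_fixZero_zero {n : ℕ} (ρ : Equiv.Perm (Fin n)) : cycSeq (fixZero ρ) 0 = 0 := by
  rw [cycSeq_of_lt _ (Nat.succ_pos n)]
  exact congrArg Fin.val (fixZero_zero ρ)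

theorem cycSeq_fixZero_succ {n : ℕ} (ρ : Equiv.Perm (Fin n)) {x : ℕ} (hx : x < n) :
    cycSeq (fixZero ρ) (1 + x) = ρ ⟨x, hx⟩ + 1 := by
  rw [cycSeq_of_lt _ (by omega : 1 + x < n + 1)]
  have : (⟨1 + x, by omega⟩ : Fin (n + 1)) = Fin.succ ⟨x, hx⟩ := Fin.ext (by simp; omega)
  rw [this, fixZero_succ, Fin.val_succ]

theorem cycSeq_fixZero_self {n : ℕ} (ρ : Equiv.Perm (Fin n)) : cycSeq (fixZero ρ) (n + 1) = 0 := by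
  have := cycSeq_add_self (fixZero ρ) 0
  rwa [zero_add, cycSeq_fixZero_zero] at this

theorem occCount_mul_addRight {m : ℕ} [NeZero m] (Q : (ℕ → ℕ) → Prop) (σ : Equiv.Perm (Fin m))
    (c : Fin m) : occCount Q (σ * Equiv.addRight c) = occCount Q σ := by
  have h1 : ∀ i, occ Q i (σ * Equiv.addRight c) = occ Q (i + c) σ := by
    intro i
    unfold occ
    congr 2
    funext x
    simp only [cycSeq, Equiv.Perm.mul_apply, Equiv.coe_addRight]
    congr 2
    rw [Fin.ext_iff]
    simp [Fin.ofNat, Fin.val_add, add_right_comm]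
  have h2 : ∀ c : ℕ, ∑ i ∈ Finset.range m, occ Q (i + c) σ = ∑ i ∈ Finset.range m, occ Q i σ := by
    intro c
    induction c with
    | zero => rfl
    | succ c ih =>
      rw [← ih]
      have e1 := Finset.sum_range_succ' (fun i => occ Q (i + c) σ) m
      rw [Finset.sum_range_succ, zero_add, add_comm m c, occ_add_self] at e1
      have e2 := add_right_cancel e1
      rw [e2]
      exact Finset.sum_congr rfl fun i _ => by rw [add_assoc, add_comm 1 c]
  have h3 : (occCount Q (σ * Equiv.addRight c) : ℝ) = occCount Q σ := by
    rw [cast_occCount, cast_occCount, Finset.sum_congr rfl fun i _ => h1 i, h2]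
  exact_mod_cast h3

theorem toMeasure_uniform_map_congr {Ω Ω' : Type*} [Fintype Ω] [Nonempty Ω] [Fintype Ω']
    [Nonempty Ω'] {X : Ω → ℕ} {Y : Ω' → ℕ}
    (h : ∀ f : ℕ → ℝ, 𝔼 ω, f (X ω) = 𝔼 ω, f (Y ω)) :
    ((PMF.uniformOfFintype Ω).map X).toMeasure = ((PMF.uniformOfFintype Ω').map Y).toMeasure := by
  refine Measure.ext fun A _ => ?_
  refine (ENNReal.toReal_eq_toReal_iff' (measure_ne_top _ A) (measure_ne_top _ A)).1 ?_
  have h1 := measureReal_uniform_map X A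
  have h2 := measureReal_uniform_map Y A
  rw [h, ← h2] at h1
  exact h1

/-! ### The law of the number of fringe subtrees of the random binary search tree -/

theorem BinaryTree.IsHeap.comp_strictMono {α : Type*} {f : α → ℕ} {g : ℕ → ℕ} (hg : StrictMono g)
    {t : BinaryTree α} (h : IsHeap f t) : IsHeap (fun x => g (f x)) t := by
  induction t with
  | nil => trivial
  | node a l r ihl ihr =>
    obtain ⟨i1, i2, i3, i4⟩ := h
    exact ⟨fun x hx => hg (i1 x hx), fun x hx => hg (i2 x hx), ihl i3, ihr i4⟩

open BinaryTree in
-- Time stamps are raised by 1, so that the entry 0 at the position 0 is smaller than all of them.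
theorem isHeapOf_bstOfPerm {n : ℕ} (σ : Equiv.Perm (Fin n)) :
    IsHeapOf (cycSeq (fixZero σ.symm)) 1 ((bstOfPerm σ).map (· + 1)) ∧
      ((bstOfPerm σ).map (· + 1)).numNodes = n := by
  obtain ⟨h1, h2⟩ := bstOfPerm_spec σ
  have hn : ((bstOfPerm σ).map (· + 1)).numNodes = n := by
    rw [numNodes_map, ← length_inorder, h2, List.length_ofFn]
  have h3 : IsHeap (· + 1) (bstOfPerm σ) :=
    h1.comp_strictMono (g := (· + 1)) fun a b h => Nat.succ_lt_succ h
  refine ⟨h3.map.isHeapOf fun j hj => ?_, hn⟩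
  rw [hn] at hj
  rw [inorder_map, h2, List.getElem?_map, List.getElem?_ofFn, dif_pos hj, Option.map_some,
    cycSeq_fixZero_succ _ hj]

open BinaryTree in
-- Read cyclically, the entry 0 stands at positions 0 and n + 1 and borders the sequence on both
-- sides.
theorem count_bstOfPerm {n k : ℕ} (hk : 1 ≤ k) {P : Set (BinaryTree ℕ)} (hP : IsProperty P)
    (σ : Equiv.Perm (Fin n)) :
    (bstOfPerm σ).count k P = occCount (FringePattern k P) (fixZero σ.symm) := by
  classical
  obtain ⟨h1, hn⟩ := isHeapOf_bstOfPerm σ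
  set v := cycSeq (fixZero σ.symm) with hv
  have hv0 : v 0 = 0 := cycSeq_fixZero_zero _
  have hvn : v (n + 1) = 0 := cycSeq_fixZero_self _
  rw [← count_map (f := (· + 1)) (fun a b h => Nat.succ_lt_succ h) k hP,
    IsHeapOf.count_eq hk P (s := 0) h1]
  · rw [hn, occCount]
    congr 1
    ext i
    simp only [Finset.mem_filter, Finset.mem_Ico, Finset.mem_range]
    constructor
    · rintro ⟨⟨-, h2⟩, -, h4⟩
      exact ⟨by omega, h4⟩
    · rintro ⟨h2, h3⟩
      have h5 : i + k ≤ n := by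
        by_contra hlt
        have := (h3.1 ⟨n - i, by omega⟩).1
        rw [← hv] at this
        simp only [show i + (1 + (n - i)) = n + 1 by omega, hvn] at this
        omega
      exact ⟨⟨by omega, by omega⟩, by omega, h3⟩
  · intro x hx
    rw [hn] at hx ⊢
    rw [zero_add, hv0, add_comm 1 n, hvn, hv, cycSeq_fixZero_succ _ hx]
    omega

theorem bstLaw_eq {n k : ℕ} (hk : 1 ≤ k) {P : Set (BinaryTree ℕ)} (hP : BinaryTree.IsProperty P) :
    bstLaw n k P = ((PMF.uniformOfFintype (Equiv.Perm (Fin (n + 1)))).map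
      (occCount (BinaryTree.FringePattern k P))).toMeasure := by
  rw [bstLaw, randomBST, PMF.map_comp]
  refine toMeasure_uniform_map_congr fun f => ?_
  rw [expect_eq_expect_fixZero (fun σ => f (occCount (BinaryTree.FringePattern k P) σ))
    fun σ c => by rw [occCount_mul_addRight]]
  refine Fintype.expect_equiv (Equiv.inv _) _ _ fun σ => ?_
  rw [Function.comp_apply, count_bstOfPerm hk hP]
  rfl

theorem patternProb_heapIn {k : ℕ} [NeZero k] {P : Set (BinaryTree ℕ)}
    (hP : BinaryTree.IsProperty P) :
    patternProb k (BinaryTree.HeapIn k P) = bstProb k P := by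
  classical
  rw [bstProb, randomBST, toOuterMeasure_uniform_map_toReal]
  refine (Fintype.expect_equiv (Equiv.inv _) _ _ fun σ => ?_).symm
  obtain ⟨h1, hn⟩ := isHeapOf_bstOfPerm σ
  have h2 : BinaryTree.HeapIn k P (cycSeq σ⁻¹) ↔ bstOfPerm σ ∈ P := by
    rw [← hP (· + 1) (fun a b h => Nat.succ_lt_succ h), ← h1.heapIn_iff hn P,
      ← (BinaryTree.isPattern_heapIn k hP).comp (cycSeq σ⁻¹) (· + 1)
        (fun a b h => Nat.succ_lt_succ h)]
    refine (BinaryTree.isPattern_heapIn k hP).congr _ _ fun x hx => ?_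
    rw [cycSeq_fixZero_succ _ hx, Function.comp_apply, cycSeq_of_lt _ hx]
    rfl
  rw [Equiv.inv_apply, ind_congr h2, ind]

/-! ### The law of the number of fringe subtrees of the random recursive tree -/

theorem uniform_bind_map {α β γ : Type*} [Fintype α] [Nonempty α] [Fintype β] [Nonempty β]
    (f : α → β → γ) :
    ((PMF.uniformOfFintype α).bind fun a => (PMF.uniformOfFintype β).map (f a)) =
      (PMF.uniformOfFintype (α × β)).map fun x => f x.1 x.2 := by
  classical
  ext c
  simp only [PMF.bind_apply, PMF.map_apply, PMF.uniformOfFintype_apply, tsum_fintype,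
    Fintype.sum_prod_type, Finset.mul_sum, mul_ite, mul_zero, Fintype.card_prod, Nat.cast_mul]
  rw [ENNReal.mul_inv (Or.inr (ENNReal.natCast_ne_top _)) (Or.inl (ENNReal.natCast_ne_top _))]

theorem uniform_map_equiv {α β : Type*} [Fintype α] [Nonempty α] [Fintype β] [Nonempty β]
    (e : α ≃ β) : (PMF.uniformOfFintype α).map e = PMF.uniformOfFintype β := by
  classical
  ext b
  rw [PMF.map_apply, tsum_eq_single (e.symm b) fun a ha => if_neg fun h => ha (by simp [h]),
    if_pos (by simp), PMF.uniformOfFintype_apply, PMF.uniformOfFintype_apply, Fintype.card_congr e]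

/-- Insert a new largest value at the position `q`. -/
def insertMax {n : ℕ} (σ : Equiv.Perm (Fin n)) (q : Fin (n + 1)) : Equiv.Perm (Fin (n + 1)) :=
  (finSuccEquiv' q).trans ((Equiv.optionCongr σ).trans (finSuccEquiv' (Fin.last n)).symm)

theorem insertMax_self {n : ℕ} (σ : Equiv.Perm (Fin n)) (q : Fin (n + 1)) :
    insertMax σ q q = Fin.last n := by
  simp [insertMax]

theorem insertMax_succAbove {n : ℕ} (σ : Equiv.Perm (Fin n)) (q : Fin (n + 1)) (j : Fin n) :
    insertMax σ q (q.succAbove j) = (σ j).castSucc := by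
  simp [insertMax]

theorem bijective_insertMax (n : ℕ) :
    Function.Bijective fun x : Equiv.Perm (Fin n) × Fin (n + 1) => insertMax x.1 x.2 := by
  rw [Fintype.bijective_iff_injective_and_card]
  constructor
  · rintro ⟨σ, q⟩ ⟨σ', q'⟩ h
    simp only at h
    have hq : q = q' := by
      have h1 := insertMax_self σ q
      rw [h, ← insertMax_self σ' q'] at h1
      exact (insertMax σ' q').injective h1
    subst hq
    have hσ : σ = σ' := by
      ext j
      have h1 := insertMax_succAbove σ q j
      rw [h, insertMax_succAbove] at h1
      simpa [Fin.ext_iff] using h1.symm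
    rw [hσ]
  · simp [Fintype.card_perm, Nat.factorial_succ, mul_comm]

theorem flatMap_insert {L : List ℕ} (hL : L.Nodup) {q p i : ℕ} (hq : L[q]? = some p) :
    (L.flatMap fun x => if x = p then [x, i] else [x]) = L.insertIdx (q + 1) i := by
  induction L generalizing q with
  | nil => simp at hq
  | cons a L ih =>
    obtain ⟨ha, hL⟩ := List.nodup_cons.1 hL
    rcases q with _ | q
    · rw [List.getElem?_cons_zero] at hq
      obtain rfl := Option.some.inj hq
      have : (L.flatMap fun x => if x = a then [x, i] else [x]) = L.flatMap fun x => [x] :=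
        List.flatMap_congr fun x hx => if_neg fun h => by rw [h] at hx; exact ha hx
      rw [List.flatMap_cons, if_pos rfl, this]
      simp
    · rw [List.getElem?_cons_succ] at hq
      have hap : a ≠ p := fun h => ha (h ▸ List.mem_of_getElem? hq)
      rw [List.flatMap_cons, if_neg hap, ih hL hq]
      simp

/-- Position q + 1 of the list is position q after the leading 1, so the root remains in front. -/
theorem insertIdx_ofFn_fixZero {n : ℕ} (σ : Equiv.Perm (Fin n)) (q : Fin (n + 1)) :
    (List.ofFn fun x => (fixZero σ x : ℕ) + 1).insertIdx (q + 1) (n + 2) =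
      List.ofFn fun x => (fixZero (insertMax σ q) x : ℕ) + 1 := by
  refine List.ext_getElem ?_ fun j h1 h2 => ?_
  · rw [List.length_insertIdx, List.length_ofFn, List.length_ofFn, if_pos (by omega)]
  · rw [List.getElem_insertIdx, List.getElem_ofFn]
    rw [List.length_ofFn] at h2
    rcases j with _ | j
    · rw [dif_pos (by omega), List.getElem_ofFn]
      have e1 : fixZero σ ⟨0, by omega⟩ = 0 := fixZero_zero σ
      have e2 : fixZero (insertMax σ q) ⟨0, by omega⟩ = 0 := fixZero_zero _
      rw [e1, e2]
      rfl
    · have e0 : (⟨j + 1, h2⟩ : Fin (n + 2)) = Fin.succ ⟨j, by omega⟩ := rfl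
      rw [e0, fixZero_succ, Fin.val_succ]
      split_ifs with hlt heq
      · have hjq : j < q := by omega
        rw [List.getElem_ofFn]
        have e1 : (⟨j + 1, by omega⟩ : Fin (n + 1)) = Fin.succ ⟨j, by omega⟩ := rfl
        have e2 : (⟨j, by omega⟩ : Fin (n + 1)) = q.succAbove ⟨j, by omega⟩ := by
          rw [Fin.succAbove_of_castSucc_lt]
          · rfl
          · exact hjq
        rw [e1, fixZero_succ, e2, insertMax_succAbove]
        rfl
      · have e2 : (⟨j, by omega⟩ : Fin (n + 1)) = q := Fin.ext (by simpa using heq)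
        rw [e2, insertMax_self]
        rfl
      · rw [List.getElem_ofFn]
        have hjq : (q : ℕ) < j := by omega
        obtain ⟨i, rfl⟩ : ∃ i, j = i + 1 := ⟨j - 1, by omega⟩
        have e1 : (⟨i + 1 + 1 - 1, by omega⟩ : Fin (n + 1)) = Fin.succ ⟨i, by omega⟩ := rfl
        have e2 : (⟨i + 1, by omega⟩ : Fin (n + 1)) = q.succAbove ⟨i, by omega⟩ := by
          rw [Fin.succAbove_of_le_castSucc]
          · rfl
          · rw [Fin.le_def]; simp only [Fin.val_castSucc]; omega
        rw [e1, fixZero_succ, e2, insertMax_succAbove]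
        rfl

open BinaryTree in
-- Behind the label 1, the symmetric order is a uniform permutation: a uniform parent means that the
-- new largest label is inserted at a uniform place, and these insertions build each permutation
-- once.
theorem exists_randomRRT_eq_uniform_map (n : ℕ) :
    ∃ T : Equiv.Perm (Fin n) → OrdTree ℕ,
      randomRRT (n + 1) = (PMF.uniformOfFintype _).map T ∧
      ∀ σ, IsHeap id (forestBin [T σ]) ∧
        (forestBin [T σ]).inorder = List.ofFn fun x => (fixZero σ x : ℕ) + 1 := by
  induction n with
  | zero =>
    refine ⟨fun _ => .node 1 [], ?_, fun σ => ⟨?_, ?_⟩⟩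
    · rw [randomRRT]
      exact (PMF.map_const _ _).symm
    · rw [forestBin_singleton]
      exact ⟨by simp [inorder], by simp [forestBin, inorder], trivial, by
        rw [forestBin]; trivial⟩
    · rw [forestBin_singleton]
      simp [forestBin, inorder]
  | succ n ih =>
    obtain ⟨T, hT, hspec⟩ := ih
    let E : Equiv.Perm (Fin n) × Fin (n + 1) ≃ Equiv.Perm (Fin (n + 1)) :=
      Equiv.ofBijective _ (bijective_insertMax n)
    -- The parent is chosen by its position q in symmetric order instead of its label.
    let U : Equiv.Perm (Fin n) × Fin (n + 1) → OrdTree ℕ := fun x =>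
      (T x.1).attachChild ((fixZero x.1 x.2 : ℕ) + 1) (n + 2)
    have hU : ∀ x, IsHeap id (forestBin [U x]) ∧
        (forestBin [U x]).inorder = List.ofFn fun y => (fixZero (E x) y : ℕ) + 1 := by
      rintro ⟨σ, q⟩
      obtain ⟨h1, h2⟩ := hspec σ
      have h3 : forestBin [U (σ, q)] =
          insertBehind ((fixZero σ q : ℕ) + 1) (n + 2) (forestBin [T σ]) := by
        rw [← forestBin_attachChild]
        rfl
      rw [h3, inorder_insertBehind, h2]
      constructor
      · refine h1.insertBehind fun x hx => ?_
        rw [h2] at hx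
        obtain ⟨y, rfl⟩ := List.mem_ofFn.1 hx
        have := (fixZero σ y).2
        omega
      · rw [flatMap_insert (q := q), insertIdx_ofFn_fixZero]
        · rfl
        · rw [List.nodup_ofFn]
          intro x y h
          exact (fixZero σ).injective (Fin.ext (Nat.succ_injective h))
        · rw [List.getElem?_ofFn, dif_pos q.2]
    refine ⟨U ∘ E.symm, ?_, fun σ => ?_⟩
    · rw [randomRRT, hT, PMF.bind_map, ← PMF.map_comp, uniform_map_equiv]
      rw [← uniform_bind_map
        (fun (σ : Equiv.Perm (Fin n)) q => (T σ).attachChild ((fixZero σ q : ℕ) + 1) (n + 2))]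
      congr 1
      funext σ
      rw [Function.comp_apply]
      -- The label found at a uniform position is again uniform.
      have h3 := PMF.map_comp (fixZero σ) (PMF.uniformOfFintype (Fin (n + 1)))
        (fun p : Fin (n + 1) => (T σ).attachChild ((p : ℕ) + 1) (n + 2))
      rw [uniform_map_equiv] at h3
      exact (PMF.map_comp _ _ _).trans h3
    · have := hU (E.symm σ)
      rwa [Equiv.apply_symm_apply] at this

open BinaryTree in
theorem isHeapOf_forestBin {n : ℕ} {T : OrdTree ℕ} {σ : Equiv.Perm (Fin n)}
    (h : IsHeap id (forestBin [T]) ∧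
      (forestBin [T]).inorder = List.ofFn fun x => (fixZero σ x : ℕ) + 1) :
    IsHeapOf ((· + 1) ∘ cycSeq (fixZero σ)) 0 (forestBin [T]) ∧
      (forestBin [T]).numNodes = n + 1 := by
  have hn : (forestBin [T]).numNodes = n + 1 := by
    rw [← length_inorder, h.2, List.length_ofFn]
  refine ⟨h.1.isHeapOf fun j hj => ?_, hn⟩
  rw [hn] at hj
  rw [h.2, List.getElem?_ofFn, dif_pos hj, zero_add, Function.comp_apply, cycSeq_of_lt _ hj]

open BinaryTree in
theorem count_recursive_tree {n k : ℕ} (hk : 1 ≤ k) (hkn : k < n + 1) {P : Set (OrdTree ℕ)}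
    (hP : OrdTree.IsProperty P) {T : OrdTree ℕ} {σ : Equiv.Perm (Fin n)}
    (h : IsHeap id (forestBin [T]) ∧
      (forestBin [T]).inorder = List.ofFn fun x => (fixZero σ x : ℕ) + 1) :
    T.count k P = occCount (RecursivePattern k P) (fixZero σ) := by
  classical
  obtain ⟨h1, hn⟩ := isHeapOf_forestBin h
  obtain ⟨a, cs⟩ := T
  rw [OrdTree.count_eq_countNodes]
  rw [forestBin_singleton] at h1 hn ⊢
  obtain ⟨-, -, -, -, h5⟩ := h1
  simp only [numNodes, zero_add] at h5 hn
  have hn : (forestBin cs).numNodes = n := by omega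
  -- The root contributes nothing, its subtree having n + 1 > k nodes; only the forest of its
  -- children, at positions 1 to n, is counted.
  have hne : ¬((forestBin cs).numNodes + 1 = k ∧ OrdTree.node a (binForest (forestBin cs)) ∈ P) :=
    fun h => by omega
  have hvn := cycSeq_fixZero_self σ
  have hv0 := cycSeq_fixZero_zero σ
  rw [countNodes, countNodes, BinaryTree.IsHeapOf.countNodes_eq hk P h5]
  · rw [natInd, if_neg hne, hn, occCount, zero_add]
    conv_lhs => rw [zero_add]
    congr 1
    ext i
    simp only [Finset.mem_filter, Finset.mem_Ico, Finset.mem_range]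
    have hiff : (RecursivePattern k P fun x => ((· + 1) ∘ cycSeq (fixZero σ)) (i + x)) ↔
        RecursivePattern k P fun x => cycSeq (fixZero σ) (i + x) :=
      (isPattern_recursivePattern k hP).comp (fun x => cycSeq (fixZero σ) (i + x)) (· + 1)
        fun a b h => Nat.succ_lt_succ h
    rw [hiff]
    constructor
    · rintro ⟨⟨h2, h3⟩, -, h4⟩
      exact ⟨by omega, h4⟩
    · rintro ⟨h2, h3⟩
      have hi0 : i ≠ 0 := by
        rintro rfl
        have := h3.1 ⟨0, by omega⟩
        simp only [add_zero, hv0] at this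
        omega
      have h6 : i + k ≤ n + 1 := by
        by_contra hlt
        have := h3.1 ⟨n + 1 - i, by omega⟩
        simp only [show i + (n + 1 - i) = n + 1 by omega, hvn] at this
        omega
      exact ⟨⟨by omega, by omega⟩, by omega, h3⟩
  · intro x hx
    rw [hn] at hx ⊢
    simp only [Function.comp_apply]
    rw [add_comm 1 n, hvn, cycSeq_fixZero_succ _ hx]
    omega

theorem rrtLaw_eq {n k : ℕ} (hk : 1 ≤ k) (hkn : k < n + 1) {P : Set (OrdTree ℕ)}
    (hP : OrdTree.IsProperty P) :
    rrtLaw (n + 1) k P = ((PMF.uniformOfFintype (Equiv.Perm (Fin (n + 1)))).map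
      (occCount (RecursivePattern k P))).toMeasure := by
  obtain ⟨T, hT, hspec⟩ := exists_randomRRT_eq_uniform_map n
  rw [rrtLaw, hT, PMF.map_comp]
  refine toMeasure_uniform_map_congr fun f => ?_
  rw [expect_eq_expect_fixZero (fun σ => f (occCount (RecursivePattern k P) σ))
    fun σ c => by rw [occCount_mul_addRight]]
  refine Finset.expect_congr rfl fun σ _ => ?_
  rw [Function.comp_apply, count_recursive_tree hk hkn hP (hspec σ)]

/-- The smallest entry must come first, which has probability 1/k; the remaining entries are then
uniform and give the recursive tree. -/
theorem patternProb_heapIn_binProperty {k : ℕ} [NeZero k] {P : Set (OrdTree ℕ)}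
    (hP : OrdTree.IsProperty P) :
    patternProb k (BinaryTree.HeapIn k (binProperty P)) = rrtProb k P / k := by
  classical
  obtain ⟨n, rfl⟩ : ∃ n, k = n + 1 := ⟨k - 1, by have := NeZero.ne k; omega⟩
  obtain ⟨T, hT, hspec⟩ := exists_randomRRT_eq_uniform_map n
  rw [rrtProb, hT, toOuterMeasure_uniform_map_toReal, patternProb]
  have hQ := BinaryTree.isPattern_heapIn (n + 1) (isProperty_binProperty hP)
  have h1 : ∀ σ, BinaryTree.HeapIn (n + 1) (binProperty P) (cycSeq (fixZero σ)) ↔ T σ ∈ P := by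
    intro σ
    obtain ⟨h1, hn⟩ := isHeapOf_forestBin (hspec σ)
    rw [← forestBin_singleton_mem_binProperty, ← h1.heapIn_iff hn,
      ← hQ.comp (cycSeq (fixZero σ)) (· + 1) (fun a b h => Nat.succ_lt_succ h)]
    simp only [zero_add]
  have h2 : ∀ (p : Fin (n + 1)) (σ : Equiv.Perm (Fin n)),
      ind (BinaryTree.HeapIn (n + 1) (binProperty P)
        (cycSeq (Equiv.Perm.decomposeFin.symm (p, σ)))) =
      if p = 0 then (if T σ ∈ P then 1 else 0) else 0 := by
    intro p σ
    split_ifs with hp hσ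
    · subst hp; exact ind_true ((h1 σ).2 hσ)
    · subst hp; exact ind_false fun h => hσ ((h1 σ).1 h)
    · refine ind_false fun h => ?_
      set τ := Equiv.Perm.decomposeFin.symm (p, σ) with hτ
      have hτ0 : τ 0 = p := Equiv.Perm.decomposeFin_symm_apply_zero _ _
      obtain ⟨x, hx⟩ := τ.surjective 0
      have hx0 : (x : ℕ) ≠ 0 := by
        intro h0
        have : x = 0 := Fin.ext h0
        rw [this, hτ0] at hx
        exact hp hx
      have := lt_of_heapIn_binProperty h hx0 x.2
      rw [cycSeq_of_lt τ x.2, Fin.eta, hx] at this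
      simp at this
  rw [Fintype.expect_equiv Equiv.Perm.decomposeFin _
    (fun x : Fin (n + 1) × Equiv.Perm (Fin n) => if x.1 = 0 then (if T x.2 ∈ P then (1 : ℝ) else 0)
      else 0) fun τ => by
      rw [← h2, Prod.mk.eta, Equiv.symm_apply_apply],
    ← Finset.univ_product_univ, Finset.expect_product' _ _
      (fun (p : Fin (n + 1)) σ => if p = 0 then (if T σ ∈ P then (1 : ℝ) else 0) else 0),
    Finset.expect_comm, Finset.expect_div]
  refine Finset.expect_congr rfl fun σ _ => ?_
  rw [Fintype.expect_eq_sum_div_card, Finset.sum_ite_eq' Finset.univ (0 : Fin (n + 1))]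
  simp

/-! ### Minima over several sets of positions -/

section Minima

variable {m : ℕ}

/-- The entry at `a` is the smallest one among those in `W`. -/
def IsMinAt (W : Finset (Fin m)) (a : Fin m) (σ : Equiv.Perm (Fin m)) : Prop :=
  ∀ y ∈ W, y ≠ a → σ a < σ y

theorem isMinAt_mul {W : Finset (Fin m)} {a : Fin m} {σ π : Equiv.Perm (Fin m)} (ha : π a = a)
    (hW : ∀ y, π y ∈ W ↔ y ∈ W) : IsMinAt W a (σ * π) ↔ IsMinAt W a σ := by
  simp only [IsMinAt, Equiv.Perm.mul_apply, ha]
  constructor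
  · intro h y hy hya
    have := h (π.symm y) ((hW _).1 (by simpa using hy)) fun h' => hya (by
      rw [← ha, ← h', Equiv.apply_symm_apply])
    simpa using this
  · intro h y hy hya
    exact h _ ((hW y).2 hy) fun h' => hya (π.injective (h'.trans ha.symm))

theorem swap_mem_iff {W : Finset (Fin m)} {a b y : Fin m} (h : a ∈ W ↔ b ∈ W) :
    Equiv.swap a b y ∈ W ↔ y ∈ W := by
  rw [Equiv.swap_apply_def]
  split_ifs with h1 h2
  · rw [h1, h]
  · rw [h2, h]
  · rfl

theorem expect_isMinAt {W : Finset (Fin m)} {a : Fin m} (ha : a ∈ W) :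
    𝔼 σ : Equiv.Perm (Fin m), ind (IsMinAt W a σ) = 1 / W.card := by
  have := expect_min_mul W ha (fun _ => 1) fun _ _ _ => rfl
  simp only [mul_one, Fintype.expect_const] at this
  exact this

/-- Exchanging positions inside V does not affect a minimum of W attained outside V, so the two
events are independent. -/
theorem expect_isMinAt_pair {W V : Finset (Fin m)} {a b : Fin m} (ha : a ∈ W) (hb : b ∈ V)
    (hVW : V ⊆ W) (haV : a ∉ V) :
    𝔼 σ : Equiv.Perm (Fin m), ind (IsMinAt V b σ) * ind (IsMinAt W a σ) =
      1 / (W.card * V.card) := by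
  have h := expect_min_mul V hb (fun σ => ind (IsMinAt W a σ)) fun c hc σ =>
    ind_congr (isMinAt_mul (Equiv.swap_apply_of_ne_of_ne (fun h => haV (h ▸ hb))
      fun h => haV (h ▸ hc)) fun y => swap_mem_iff (by simp [hVW hb, hVW hc]))
  rw [expect_isMinAt ha, div_div] at h
  exact h

theorem expect_isMinAt_triple {W A B : Finset (Fin m)} {x y z : Fin m} (hx : x ∈ W) (hy : y ∈ A)
    (hz : z ∈ B) (hA : A ⊆ W) (hB : B ⊆ W) (hxA : x ∉ A) (hxB : x ∉ B) (hAB : Disjoint A B) :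
    𝔼 σ : Equiv.Perm (Fin m),
      ind (IsMinAt B z σ) * (ind (IsMinAt A y σ) * ind (IsMinAt W x σ)) =
      1 / (W.card * A.card * B.card) := by
  have h := expect_min_mul B hz
    (fun σ => ind (IsMinAt A y σ) * ind (IsMinAt W x σ)) fun c hc σ => by
      have hn : ∀ u ∈ A, ∀ w ∈ B, u ≠ w := fun u hu w hw h =>
        Finset.disjoint_left.1 hAB hu (h ▸ hw)
      refine congrArg₂ (· * ·) (ind_congr (isMinAt_mul ?_ fun u => swap_mem_iff ?_))
        (ind_congr (isMinAt_mul ?_ fun u => swap_mem_iff ?_))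
      · exact Equiv.swap_apply_of_ne_of_ne (hn y hy z hz) (hn y hy c hc)
      · exact iff_of_false (fun h => hn z h z hz rfl) fun h => hn c h c hc rfl
      · exact Equiv.swap_apply_of_ne_of_ne (fun h => hxB (h ▸ hz)) fun h => hxB (h ▸ hc)
      · simp [hB hz, hB hc]
  rw [expect_isMinAt_pair hx hy hA hxA, div_div] at h
  exact h

end Minima

/-- The block of `w` cyclic positions starting at `s`. -/
def block (m : ℕ) [NeZero m] (s w : ℕ) : Finset (Fin m) :=
  (Finset.Ico s (s + w)).image (Fin.ofNat m)

/-! ### Blocks of consecutive cyclic positions and their minima -/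

section Block

variable {m : ℕ} [NeZero m]

theorem mem_block {s w : ℕ} {y : Fin m} :
    y ∈ block m s w ↔ ∃ x, s ≤ x ∧ x < s + w ∧ Fin.ofNat m x = y := by
  simp [block, and_assoc]

theorem ofNat_mem_block {s w x : ℕ} (h1 : s ≤ x) (h2 : x < s + w) :
    Fin.ofNat m x ∈ block m s w := mem_block.2 ⟨x, h1, h2, rfl⟩

theorem ofNat_notMem_block {s w s' x : ℕ} (hs : s' ≤ s) (hw : s + w ≤ s' + m) (hx : s' ≤ x)
    (hx' : x < s' + m) (h : x < s ∨ s + w ≤ x) : Fin.ofNat m x ∉ block m s w := by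
  intro hmem
  obtain ⟨y, hy1, hy2, hy⟩ := mem_block.1 hmem
  have := eq_of_ofNat_eq (s := s') (by omega) (by omega) hx hx' hy
  omega

theorem card_block {s w : ℕ} (h : w ≤ m) : (block m s w).card = w := by
  rw [block, Finset.card_image_of_injOn, Nat.card_Ico, Nat.add_sub_cancel_left]
  intro x hx y hy hxy
  simp only [Finset.coe_Ico, Set.mem_Ico] at hx hy
  exact eq_of_ofNat_eq hx.1 (by omega) hy.1 (by omega) hxy

theorem block_subset {s w s' w' : ℕ} (h1 : s' ≤ s) (h2 : s + w ≤ s' + w') :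
    block m s w ⊆ block m s' w' := by
  intro y hy
  obtain ⟨x, hx1, hx2, rfl⟩ := mem_block.1 hy
  exact ofNat_mem_block (by omega) (by omega)

theorem disjoint_block {s w s' w' : ℕ} (h1 : s + w ≤ s') (h2 : s' + w' ≤ s + m) :
    Disjoint (block m s w) (block m s' w') := by
  refine Finset.disjoint_left.2 fun y hy hy' => ?_
  obtain ⟨x, hx1, hx2, rfl⟩ := mem_block.1 hy
  exact ofNat_notMem_block (s' := s) (by omega) h2 hx1 (by omega) (Or.inl (by omega)) hy'

theorem isMinAt_block {σ : Equiv.Perm (Fin m)} {s w a : ℕ}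
    (h : ∀ x, s ≤ x → x < s + w → Fin.ofNat m x ≠ Fin.ofNat m a → cycSeq σ a < cycSeq σ x) :
    IsMinAt (block m s w) (Fin.ofNat m a) σ := by
  intro y hy hya
  obtain ⟨x, hx1, hx2, rfl⟩ := mem_block.1 hy
  exact h x hx1 hx2 hya

theorem exists_isMinAt_block (σ : Equiv.Perm (Fin m)) (s : ℕ) {w : ℕ} (hw : 1 ≤ w) :
    ∃ x, s ≤ x ∧ x < s + w ∧ IsMinAt (block m s w) (Fin.ofNat m x) σ := by
  obtain ⟨b, hb, hmin⟩ := Finset.exists_min_image (block m s w) σ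
    ⟨_, ofNat_mem_block le_rfl (by omega)⟩
  obtain ⟨x, hx1, hx2, rfl⟩ := mem_block.1 hb
  exact ⟨x, hx1, hx2, fun y hy hyb =>
    lt_of_le_of_ne (hmin y hy) fun h => hyb (σ.injective h.symm)⟩

theorem IsMinAt.lt_of_block {σ : Equiv.Perm (Fin m)} {s w a x : ℕ}
    (h : IsMinAt (block m s w) (Fin.ofNat m a) σ) (h1 : s ≤ x) (h2 : x < s + w)
    (hxa : x ≠ a) (hd : x < a + m) (hd' : a < x + m) : cycSeq σ a < cycSeq σ x := by
  refine h _ (ofNat_mem_block h1 h2) fun he => hxa ?_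
  rcases le_total x a with h3 | h3
  · exact eq_of_ofNat_eq (s := x) le_rfl (by omega) h3 hd' he
  · exact eq_of_ofNat_eq (s := a) h3 hd le_rfl (by omega) he

/-- The patterns in a block and everything that is symmetric in the positions of the block
are independent. -/
theorem expect_pattern_block_mul {w : ℕ} [NeZero w] {Q : (ℕ → ℕ) → Prop} (hQ : IsPattern w Q)
    (hwm : w ≤ m) (s : ℕ) (g : Equiv.Perm (Fin m) → ℝ)
    (hg : ∀ σ π : Equiv.Perm (Fin m), (∀ y ∉ block m s w, π y = y) →
      (∀ y, π y ∈ block m s w ↔ y ∈ block m s w) → g (σ * π) = g σ) :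
    𝔼 σ, ind (Q fun x => cycSeq σ (s + x)) * g σ = patternProb w Q * 𝔼 σ, g σ := by
  refine expect_occ_mul hQ hwm s g fun σ π hπ => ?_
  have h1 : ∀ y ∉ block m s w, π y = y := fun y hy =>
    hπ y fun x hx h => hy (h ▸ ofNat_mem_block (by omega) (by omega))
  refine hg σ π h1 fun y => ⟨fun h => ?_, fun h => ?_⟩
  · by_contra hy
    rw [h1 y hy] at h
    exact hy h
  · by_contra hy
    have := π.injective (h1 _ hy)
    rw [this] at hy
    exact hy h

end Block

theorem isMinAt_mul_of_block {m : ℕ} [NeZero m] {s w : ℕ} {W : Finset (Fin m)} {a : Fin m}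
    {σ π : Equiv.Perm (Fin m)} (h1 : ∀ y ∉ block m s w, π y = y)
    (h2 : ∀ y, π y ∈ block m s w ↔ y ∈ block m s w) (ha : a ∉ block m s w)
    (hW : block m s w ⊆ W) : IsMinAt W a (σ * π) ↔ IsMinAt W a σ := by
  refine isMinAt_mul (h1 a ha) fun y => ?_
  by_cases hy : y ∈ block m s w
  · exact iff_of_true (hW ((h2 y).2 hy)) (hW hy)
  · rw [h1 y hy]

theorem pattern_mul_of_block {m : ℕ} [NeZero m] {s w s' w' : ℕ} {Q : (ℕ → ℕ) → Prop}
    (hQ : IsPattern w' Q) {σ π : Equiv.Perm (Fin m)} (h1 : ∀ y ∉ block m s w, π y = y)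
    (hd : Disjoint (block m s w) (block m s' w')) :
    (Q fun x => cycSeq (σ * π) (s' + x)) ↔ Q fun x => cycSeq σ (s' + x) := by
  refine hQ.congr _ _ fun x hx => ?_
  simp only [cycSeq, Equiv.Perm.mul_apply]
  rw [h1 _ fun h => Finset.disjoint_left.1 hd h (ofNat_mem_block (by omega) (by omega))]

/-! ### Fringe subtrees of the binary search tree -/

section BST

open BinaryTree

variable {k : ℕ} {P : Set (BinaryTree ℕ)}

/-- Separates the relative order inside the window from the conditions on its two borders, which are
symmetric in the interior positions. -/
theorem fringePattern_iff {m : ℕ} [NeZero m] {σ : Equiv.Perm (Fin m)} {i : ℕ} (hm : k + 2 ≤ m) :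
    (FringePattern k P fun x => cycSeq σ (i + x)) ↔
      HeapIn k P (fun x => cycSeq σ (i + 1 + x)) ∧
      (IsMinAt (block m i (k + 1)) (Fin.ofNat m i) σ ∧
        IsMinAt (block m (i + 1) (k + 1)) (Fin.ofNat m (i + k + 1)) σ) := by
  rw [FringePattern, and_comm]
  simp only [← add_assoc, add_zero]
  refine and_congr_right fun _ => ⟨fun h => ⟨?_, ?_⟩, fun ⟨h1, h2⟩ x => ⟨?_, ?_⟩⟩
  · refine isMinAt_block fun x hx1 hx2 hne => ?_
    have hxi : x ≠ i := fun h => hne (by rw [h])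
    have := (h ⟨x - i - 1, by omega⟩).1
    simpa only [show i + 1 + (x - i - 1) = x by omega] using this
  · refine isMinAt_block fun x hx1 hx2 hne => ?_
    have hxi : x ≠ i + k + 1 := fun h => hne (by rw [h])
    have := (h ⟨x - i - 1, by omega⟩).2
    simpa only [show i + 1 + (x - i - 1) = x by omega] using this
  · refine h1 _ (ofNat_mem_block (by omega) (by omega)) fun h => ?_
    have := eq_of_ofNat_eq (s := i) (by omega) (by omega) (by omega) (by omega) h
    omega
  · refine h2 _ (ofNat_mem_block (by omega) (by omega)) fun h => ?_
    have := eq_of_ofNat_eq (s := i) (by omega) (by omega) (by omega) (by omega) h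
    omega

/-- One border is smaller than the other: it is the minimum of the whole block, and the other border
that of the rest. Each case has probability 1/((w+1)(w+2)). -/
theorem isMinAt_block_cases {m : ℕ} [NeZero m] {σ : Equiv.Perm (Fin m)} {i w : ℕ} (hw : w + 2 ≤ m) :
    ind (IsMinAt (block m i (w + 1)) (Fin.ofNat m i) σ ∧
      IsMinAt (block m (i + 1) (w + 1)) (Fin.ofNat m (i + w + 1)) σ) =
    ind (IsMinAt (block m (i + 1) (w + 1)) (Fin.ofNat m (i + w + 1)) σ) *
      ind (IsMinAt (block m i (w + 2)) (Fin.ofNat m i) σ) +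
    ind (IsMinAt (block m i (w + 1)) (Fin.ofNat m i) σ) *
      ind (IsMinAt (block m i (w + 2)) (Fin.ofNat m (i + w + 1)) σ) := by
  have hA : IsMinAt (block m i (w + 2)) (Fin.ofNat m i) σ ↔
      IsMinAt (block m i (w + 1)) (Fin.ofNat m i) σ ∧ cycSeq σ i < cycSeq σ (i + w + 1) := by
    refine ⟨fun h => ⟨fun y hy => h y (block_subset (by omega) (by omega) hy),
      h.lt_of_block (by omega) (by omega) (by omega) (by omega) (by omega)⟩,
      fun ⟨h1, h2⟩ => isMinAt_block fun x hx1 hx2 hne => ?_⟩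
    rcases eq_or_ne x (i + w + 1) with rfl | hx
    · exact h2
    · exact h1 _ (ofNat_mem_block hx1 (by omega)) hne
  have hB : IsMinAt (block m i (w + 2)) (Fin.ofNat m (i + w + 1)) σ ↔
      IsMinAt (block m (i + 1) (w + 1)) (Fin.ofNat m (i + w + 1)) σ ∧
        cycSeq σ (i + w + 1) < cycSeq σ i := by
    refine ⟨fun h => ⟨fun y hy => h y (block_subset (by omega) (by omega) hy),
      h.lt_of_block (by omega) (by omega) (by omega) (by omega) (by omega)⟩,
      fun ⟨h1, h2⟩ => isMinAt_block fun x hx1 hx2 hne => ?_⟩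
    rcases eq_or_ne x i with rfl | hx
    · exact h2
    · exact h1 _ (ofNat_mem_block (by omega) (by omega)) hne
  have hne : cycSeq σ i ≠ cycSeq σ (i + w + 1) := by
    intro h
    have := eq_of_ofNat_eq (s := i) le_rfl (by omega) (by omega) (by omega)
      (σ.injective (Fin.ext h))
    omega
  rw [ind_congr hA, ind_congr hB]
  rcases lt_or_gt_of_ne hne with hlt | hlt <;>
    simp only [ind_and, ind_true hlt, ind_false hlt.not_gt] <;> ring

theorem patternProb_fringePattern [NeZero k] (hP : IsProperty P) :
    patternProb (k + 2) (FringePattern k P) = 2 * bstProb k P / ((k + 1) * (k + 2)) := by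
  have h1 := expect_occ (m := k + 2) (isPattern_fringePattern k hP) le_rfl 0
  rw [← h1]
  have h2 : ∀ σ : Equiv.Perm (Fin (k + 2)), occ (FringePattern k P) 0 σ =
      ind (HeapIn k P (fun x => cycSeq σ (1 + x))) *
      ind (IsMinAt (block (k + 2) 0 (k + 1)) (Fin.ofNat (k + 2) 0) σ ∧
        IsMinAt (block (k + 2) 1 (k + 1)) (Fin.ofNat (k + 2) (k + 1)) σ) := by
    intro σ
    rw [occ, ind_congr (fringePattern_iff le_rfl), ind_and]
    simp only [zero_add]
  have h3 := fun σ : Equiv.Perm (Fin (k + 2)) => isMinAt_block_cases (σ := σ) (i := 0) (w := k) le_rfl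
  simp only [zero_add] at h3
  rw [Finset.expect_congr rfl fun σ _ => h2 σ, expect_pattern_block_mul (isPattern_heapIn k hP)
    (by omega) 1 _ fun σ π hπ hπ' => ?_, patternProb_heapIn hP,
    Finset.expect_congr rfl fun σ _ => h3 σ, Finset.expect_add_distrib, expect_isMinAt_pair,
    expect_isMinAt_pair]
  · rw [card_block (by omega), card_block (by omega), card_block (by omega)]
    push_cast
    field_simp
    ring
  · exact ofNat_mem_block (by omega) (by omega)
  · exact ofNat_mem_block (by omega) (by omega)
  · exact block_subset (by omega) (by omega)
  · exact ofNat_notMem_block (s' := 0) (by omega) (by omega) (by omega) (by omega) (by omega)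
  · exact ofNat_mem_block (by omega) (by omega)
  · exact ofNat_mem_block (by omega) (by omega)
  · exact block_subset (by omega) (by omega)
  · exact ofNat_notMem_block (s' := 0) (by omega) (by omega) (by omega) (by omega) (by omega)
  · refine ind_congr (and_congr ?_ ?_)
    · exact isMinAt_mul_of_block hπ hπ'
        (ofNat_notMem_block (s' := 0) (by omega) (by omega) (by omega) (by omega) (by omega))
        (block_subset (by omega) (by omega))
    · exact isMinAt_mul_of_block hπ hπ'
        (ofNat_notMem_block (s' := 0) (by omega) (by omega) (by omega) (by omega) (by omega))
        (block_subset (by omega) (by omega))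

/-- The right border of the first window and the left border of the second are each interior to the
other window, so each would be smaller than the other. -/
theorem occ_fringePattern_mul_eq_zero {m : ℕ} [NeZero m] {i d : ℕ} (hd : 1 ≤ d) (hdk : d < k + 1)
    (σ : Equiv.Perm (Fin m)) :
    occ (FringePattern k P) i σ * occ (FringePattern k P) (i + d) σ = 0 := by
  rw [occ, occ, ← ind_and]
  refine ind_false fun ⟨h1, h2⟩ => ?_
  have e1 := (h1.1 ⟨d - 1, by omega⟩).2
  have e2 := (h2.1 ⟨k - d, by omega⟩).1
  simp only [add_zero] at e1 e2
  rw [show i + (1 + (d - 1)) = i + d by omega] at e1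
  rw [show i + d + (1 + (k - d)) = i + (k + 1) by omega] at e2
  omega

/-- Two adjacent subtrees. -/
theorem expect_occ_fringePattern_mul [NeZero k] (hP : IsProperty P) {m : ℕ} [NeZero m] (i : ℕ)
    (hm : 2 * k + 2 ≤ m) {b : ℝ}
    (hb : 𝔼 σ : Equiv.Perm (Fin m),
      ind ((IsMinAt (block m i (k + 1)) (Fin.ofNat m i) σ ∧
        IsMinAt (block m (i + 1) (k + 1)) (Fin.ofNat m (i + k + 1)) σ) ∧
        (IsMinAt (block m (i + k + 1) (k + 1)) (Fin.ofNat m (i + k + 1)) σ ∧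
        IsMinAt (block m (i + k + 2) (k + 1)) (Fin.ofNat m (i + 2 * k + 2)) σ)) ≤ b) :
    𝔼 σ : Equiv.Perm (Fin m), occ (FringePattern k P) i σ *
      occ (FringePattern k P) (i + (k + 1)) σ ≤ bstProb k P ^ 2 * b := by
  have hk := NeZero.pos k
  -- The two interiors are disjoint, and each is independent of the rest. The outer borders coincide
  -- if m = 2k + 2.
  have h2 : ∀ σ : Equiv.Perm (Fin m), occ (FringePattern k P) i σ *
      occ (FringePattern k P) (i + (k + 1)) σ =
      ind (HeapIn k P (fun x => cycSeq σ (i + 1 + x))) *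
      (ind (HeapIn k P (fun x => cycSeq σ (i + k + 2 + x))) *
        ind ((IsMinAt (block m i (k + 1)) (Fin.ofNat m i) σ ∧
        IsMinAt (block m (i + 1) (k + 1)) (Fin.ofNat m (i + k + 1)) σ) ∧
        (IsMinAt (block m (i + k + 1) (k + 1)) (Fin.ofNat m (i + k + 1)) σ ∧
        IsMinAt (block m (i + k + 2) (k + 1)) (Fin.ofNat m (i + 2 * k + 2)) σ))) := by
    intro σ
    rw [occ, occ, ind_congr (fringePattern_iff (by omega)), ind_congr (fringePattern_iff (by omega)),
      show i + (k + 1) + 1 = i + k + 2 by omega, show i + (k + 1) = i + k + 1 by omega,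
      show i + k + 1 + k + 1 = i + 2 * k + 2 by omega]
    simp only [ind_and]
    ring
  have hW : ∀ {s a s' : ℕ} {σ π : Equiv.Perm (Fin m)}, (∀ y ∉ block m s k, π y = y) →
      (∀ y, π y ∈ block m s k ↔ y ∈ block m s k) → s' ≤ s → s ≤ s' + 1 →
      Fin.ofNat m a ∉ block m s k →
      (IsMinAt (block m s' (k + 1)) (Fin.ofNat m a) (σ * π) ↔
        IsMinAt (block m s' (k + 1)) (Fin.ofNat m a) σ) :=
    fun h1 h2 h3 h4 h5 => isMinAt_mul_of_block h1 h2 h5 (block_subset h3 (by omega))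
  have hV : ∀ {s a s' : ℕ} {σ π : Equiv.Perm (Fin m)}, (∀ y ∉ block m s k, π y = y) →
      Disjoint (block m s k) (block m s' (k + 1)) →
      Fin.ofNat m a ∉ block m s k →
      (IsMinAt (block m s' (k + 1)) (Fin.ofNat m a) (σ * π) ↔
        IsMinAt (block m s' (k + 1)) (Fin.ofNat m a) σ) := by
    intro s a s' σ π h1 h2 h3
    refine isMinAt_mul (h1 _ h3) fun y => ?_
    by_cases hy : y ∈ block m s k
    · refine iff_of_false (fun h => ?_) (Finset.disjoint_left.1 h2 hy)
      have : π y ∉ block m s k := fun h' => Finset.disjoint_left.1 h2 h' h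
      rw [π.injective (h1 _ this)] at this
      exact this hy
    · rw [h1 y hy]
  have hlast : Fin.ofNat m (i + 2 * k + 2) ∉ block m (i + 1) k :=
    ofNat_notMem_block (s' := i + 1) (by omega) (by omega) (by omega) (by omega) (by omega)
  have hfirst : Fin.ofNat m i ∉ block m (i + k + 2) k :=
    ofNat_notMem_block (s' := i) (by omega) (by omega) (by omega) (by omega) (by omega)
  have hmid : Fin.ofNat m (i + k + 1) ∉ block m (i + 1) k :=
    ofNat_notMem_block (s' := i) (by omega) (by omega) (by omega) (by omega) (by omega)
  have hmid' : Fin.ofNat m (i + k + 1) ∉ block m (i + k + 2) k :=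
    ofNat_notMem_block (s' := i) (by omega) (by omega) (by omega) (by omega) (by omega)
  have hfirst' : Fin.ofNat m i ∉ block m (i + 1) k :=
    ofNat_notMem_block (s' := i) (by omega) (by omega) (by omega) (by omega) (by omega)
  have hlast' : Fin.ofNat m (i + 2 * k + 2) ∉ block m (i + k + 2) k :=
    ofNat_notMem_block (s' := i + k + 2) (by omega) (by omega) (by omega) (by omega) (by omega)
  rw [Finset.expect_congr rfl fun σ _ => h2 σ, expect_pattern_block_mul (isPattern_heapIn k hP)
    (by omega) (i + 1) _ fun σ π hπ hπ' => ?_, expect_pattern_block_mul (isPattern_heapIn k hP)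
    (by omega) (i + k + 2) _ fun σ π hπ hπ' => ?_, patternProb_heapIn hP, ← mul_assoc, ← sq]
  · gcongr
  · refine ind_congr (and_congr (and_congr ?_ ?_) (and_congr ?_ ?_))
    · exact hV hπ (disjoint_block (m := m) (s := i) (w := k + 1) (by omega) (by omega)).symm hfirst
    · exact hV hπ (disjoint_block (m := m) (s := i + 1) (w := k + 1) (by omega) (by omega)).symm
        hmid'
    · exact hW hπ hπ' (by omega) (by omega) hmid'
    · exact hW hπ hπ' (by omega) (by omega) hlast'
  · refine congrArg₂ (· * ·) (ind_congr ?_)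
      (ind_congr (and_congr (and_congr ?_ ?_) (and_congr ?_ ?_)))
    · exact pattern_mul_of_block (isPattern_heapIn k hP) hπ (disjoint_block (by omega) (by omega))
    · exact hW hπ hπ' (by omega) (by omega) hfirst'
    · exact hW hπ hπ' (by omega) (by omega) hmid
    · exact hV hπ (disjoint_block (by omega) (by omega)) hmid
    · exact hV hπ (disjoint_block (by omega) (by omega)) hlast

theorem expect_occ_fringePattern_mul_le [NeZero k] (hP : IsProperty P) {m : ℕ} [NeZero m]
    (hm : 2 * k + 3 ≤ m) (i : ℕ) :
    𝔼 σ : Equiv.Perm (Fin m), occ (FringePattern k P) i σ *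
      occ (FringePattern k P) (i + (k + 1)) σ ≤
      bstProb k P ^ 2 * (3 / ((2 * k + 3) * (k + 1) ^ 2)) := by
  refine expect_occ_fringePattern_mul hP i (by omega) ?_
  have hE : ∀ σ : Equiv.Perm (Fin m),
      ind ((IsMinAt (block m i (k + 1)) (Fin.ofNat m i) σ ∧
        IsMinAt (block m (i + 1) (k + 1)) (Fin.ofNat m (i + k + 1)) σ) ∧
        (IsMinAt (block m (i + k + 1) (k + 1)) (Fin.ofNat m (i + k + 1)) σ ∧
        IsMinAt (block m (i + k + 2) (k + 1)) (Fin.ofNat m (i + 2 * k + 2)) σ)) ≤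
      ind (IsMinAt (block m (i + k + 2) (k + 1)) (Fin.ofNat m (i + 2 * k + 2)) σ) *
        (ind (IsMinAt (block m (i + 1) (k + 1)) (Fin.ofNat m (i + k + 1)) σ) *
          ind (IsMinAt (block m i (2 * k + 3)) (Fin.ofNat m i) σ)) +
      ind (IsMinAt (block m (i + k + 2) (k + 1)) (Fin.ofNat m (i + 2 * k + 2)) σ) *
        (ind (IsMinAt (block m i (k + 1)) (Fin.ofNat m i) σ) *
          ind (IsMinAt (block m i (2 * k + 3)) (Fin.ofNat m (i + k + 1)) σ)) +
      ind (IsMinAt (block m (i + k + 1) (k + 1)) (Fin.ofNat m (i + k + 1)) σ) *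
        (ind (IsMinAt (block m i (k + 1)) (Fin.ofNat m i) σ) *
          ind (IsMinAt (block m i (2 * k + 3)) (Fin.ofNat m (i + 2 * k + 2)) σ)) := by
    intro σ
    simp only [← ind_and]
    by_cases hE : (IsMinAt (block m i (k + 1)) (Fin.ofNat m i) σ ∧
        IsMinAt (block m (i + 1) (k + 1)) (Fin.ofNat m (i + k + 1)) σ) ∧
        (IsMinAt (block m (i + k + 1) (k + 1)) (Fin.ofNat m (i + k + 1)) σ ∧
        IsMinAt (block m (i + k + 2) (k + 1)) (Fin.ofNat m (i + 2 * k + 2)) σ)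
    · obtain ⟨⟨h1, h2⟩, h3, h4⟩ := hE
      obtain ⟨x, hx1, hx2, hx⟩ := exists_isMinAt_block σ i (w := 2 * k + 3) (by omega)
      -- An interior entry exceeds a border, so the minimum is at one of the three borders. In each
      -- case the two remaining conditions concern disjoint blocks of length k + 1.
      have hcase : x = i ∨ x = i + k + 1 ∨ x = i + 2 * k + 2 := by
        by_contra hne
        push Not at hne
        rcases lt_or_ge x (i + k + 1) with hlt | hge
        · have e1 := h1.lt_of_block (x := x) (by omega) (by omega) (by omega) (by omega) (by omega)
          have e2 := hx.lt_of_block (x := i) (by omega) (by omega) (by omega) (by omega) (by omega)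
          omega
        · have e1 := h3.lt_of_block (x := x) (by omega) (by omega) (by omega) (by omega) (by omega)
          have e2 := hx.lt_of_block (x := i + k + 1) (by omega) (by omega) (by omega) (by omega)
            (by omega)
          omega
      refine (ind_le_one _).trans ?_
      rcases hcase with rfl | rfl | rfl
      · rw [ind_true (⟨h4, h2, hx⟩ : _ ∧ _ ∧ _), add_assoc]
        exact le_add_of_nonneg_right (add_nonneg (ind_nonneg _) (ind_nonneg _))
      · rw [add_right_comm, ind_true (⟨h4, h1, hx⟩ : _ ∧ _ ∧ _)]
        exact le_add_of_nonneg_left (add_nonneg (ind_nonneg _) (ind_nonneg _))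
      · rw [ind_true (⟨h3, h1, hx⟩ : _ ∧ _ ∧ _)]
        exact le_add_of_nonneg_left (add_nonneg (ind_nonneg _) (ind_nonneg _))
    · rw [ind_false hE]
      exact add_nonneg (add_nonneg (ind_nonneg _) (ind_nonneg _)) (ind_nonneg _)
  refine (Finset.expect_le_expect fun σ _ => hE σ).trans (le_of_eq ?_)
  rw [Finset.expect_add_distrib, Finset.expect_add_distrib, expect_isMinAt_triple,
    expect_isMinAt_triple, expect_isMinAt_triple]
  · simp only [card_block (m := m) (w := k + 1) (by omega), card_block (m := m) (w := 2 * k + 3) hm]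
    push_cast
    field_simp
    ring
  all_goals first
    | exact ofNat_mem_block (by omega) (by omega)
    | exact block_subset (by omega) (by omega)
    | exact disjoint_block (by omega) (by omega)
    | exact ofNat_notMem_block (s' := i) (by omega) (by omega) (by omega) (by omega) (by omega)

/-- The windows share both borders and fill the cycle, so one minimum over 2k + 2 and one over k + 1
positions remain, in two cases: 2/((2k+2)(k+1)). -/
theorem expect_occ_fringePattern_mul_le_of_eq [NeZero k] (hP : IsProperty P) (i : ℕ) :
    𝔼 σ : Equiv.Perm (Fin (2 * k + 2)), occ (FringePattern k P) i σ *
      occ (FringePattern k P) (i + (k + 1)) σ ≤ bstProb k P ^ 2 * (1 / (k + 1) ^ 2) := by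
  refine expect_occ_fringePattern_mul hP i le_rfl ?_
  set m := 2 * k + 2 with hm
  have hE : ∀ σ : Equiv.Perm (Fin m),
      ind ((IsMinAt (block m i (k + 1)) (Fin.ofNat m i) σ ∧
        IsMinAt (block m (i + 1) (k + 1)) (Fin.ofNat m (i + k + 1)) σ) ∧
        (IsMinAt (block m (i + k + 1) (k + 1)) (Fin.ofNat m (i + k + 1)) σ ∧
        IsMinAt (block m (i + k + 2) (k + 1)) (Fin.ofNat m (i + 2 * k + 2)) σ)) ≤
      ind (IsMinAt (block m (i + 1) (k + 1)) (Fin.ofNat m (i + k + 1)) σ) *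
          ind (IsMinAt (block m i (2 * k + 2)) (Fin.ofNat m i) σ) +
      ind (IsMinAt (block m i (k + 1)) (Fin.ofNat m i) σ) *
          ind (IsMinAt (block m i (2 * k + 2)) (Fin.ofNat m (i + k + 1)) σ) := by
    intro σ
    simp only [← ind_and]
    by_cases hE : (IsMinAt (block m i (k + 1)) (Fin.ofNat m i) σ ∧
        IsMinAt (block m (i + 1) (k + 1)) (Fin.ofNat m (i + k + 1)) σ) ∧
        (IsMinAt (block m (i + k + 1) (k + 1)) (Fin.ofNat m (i + k + 1)) σ ∧
        IsMinAt (block m (i + k + 2) (k + 1)) (Fin.ofNat m (i + 2 * k + 2)) σ)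
    · obtain ⟨⟨h1, h2⟩, h3, h4⟩ := hE
      obtain ⟨x, hx1, hx2, hx⟩ := exists_isMinAt_block σ i (w := 2 * k + 2) (by omega)
      have hcase : x = i ∨ x = i + k + 1 := by
        by_contra hne
        push Not at hne
        rcases lt_or_ge x (i + k + 1) with hlt | hge
        · have e1 := h1.lt_of_block (x := x) (by omega) (by omega) (by omega) (by omega) (by omega)
          have e2 := hx.lt_of_block (x := i) (by omega) (by omega) (by omega) (by omega) (by omega)
          omega
        · have e1 := h3.lt_of_block (x := x) (by omega) (by omega) (by omega) (by omega) (by omega)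
          have e2 := hx.lt_of_block (x := i + k + 1) (by omega) (by omega) (by omega) (by omega)
            (by omega)
          omega
      refine (ind_le_one _).trans ?_
      rcases hcase with rfl | rfl
      · rw [ind_true (⟨h2, hx⟩ : _ ∧ _)]
        exact le_add_of_nonneg_right (ind_nonneg _)
      · rw [ind_true (⟨h1, hx⟩ : _ ∧ IsMinAt (block m i (2 * k + 2)) _ _)]
        exact le_add_of_nonneg_left (ind_nonneg _)
    · rw [ind_false hE]
      exact add_nonneg (ind_nonneg _) (ind_nonneg _)
  refine (Finset.expect_le_expect fun σ _ => hE σ).trans (le_of_eq ?_)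
  rw [Finset.expect_add_distrib, expect_isMinAt_pair, expect_isMinAt_pair]
  · simp only [card_block (m := m) (w := k + 1) (by omega), card_block (m := m) (w := 2 * k + 2)
      le_rfl]
    push_cast
    field_simp
    ring
  all_goals first
    | exact ofNat_mem_block (by omega) (by omega)
    | exact block_subset (by omega) (by omega)
    | exact ofNat_notMem_block (s' := i) (by omega) (by omega) (by omega) (by omega) (by omega)

end BST

/-! ### Fringe subtrees of the random recursive tree -/

section RRT

open BinaryTree

variable {k : ℕ} {P : Set (OrdTree ℕ)}

theorem recursivePattern_iff {m : ℕ} [NeZero m] {σ : Equiv.Perm (Fin m)} {i : ℕ} (hm : k + 1 ≤ m) :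
    (RecursivePattern k P fun x => cycSeq σ (i + x)) ↔
      HeapIn k (binProperty P) (fun x => cycSeq σ (i + x)) ∧
      IsMinAt (block m i (k + 1)) (Fin.ofNat m (i + k)) σ := by
  rw [RecursivePattern, and_comm]
  refine and_congr_right fun _ => ⟨fun h => ?_, fun h x => ?_⟩
  · refine isMinAt_block fun x hx1 hx2 hne => ?_
    have hxi : x ≠ i + k := fun h => hne (by rw [h])
    have := h ⟨x - i, by omega⟩
    simpa only [show i + (x - i) = x by omega] using this
  · exact h.lt_of_block (by omega) (by omega) (by omega) (by omega) (by omega)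

theorem patternProb_recursivePattern [NeZero k] (hP : OrdTree.IsProperty P) :
    patternProb (k + 1) (RecursivePattern k P) = rrtProb k P / (k * (k + 1)) := by
  have hk : (k : ℝ) ≠ 0 := by exact_mod_cast NeZero.ne k
  rw [← expect_occ (m := k + 1) (isPattern_recursivePattern k hP) le_rfl 0]
  have h2 : ∀ σ : Equiv.Perm (Fin (k + 1)), occ (RecursivePattern k P) 0 σ =
      ind (HeapIn k (binProperty P) (fun x => cycSeq σ (0 + x))) *
      ind (IsMinAt (block (k + 1) 0 (k + 1)) (Fin.ofNat (k + 1) (0 + k)) σ) := by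
    intro σ
    rw [occ, ind_congr (recursivePattern_iff le_rfl), ind_and]
  rw [Finset.expect_congr rfl fun σ _ => h2 σ,
    expect_pattern_block_mul (isPattern_heapIn k (isProperty_binProperty hP))
    (by omega) 0 _ fun σ π hπ hπ' => ?_, patternProb_heapIn_binProperty hP, expect_isMinAt]
  · rw [card_block le_rfl]
    push_cast
    field_simp
  · exact ofNat_mem_block (by omega) (by omega)
  · exact ind_congr (isMinAt_mul_of_block hπ hπ'
      (ofNat_notMem_block (s' := 0) (by omega) (by omega) (by omega) (by omega) (by omega))
      (block_subset (by omega) (by omega)))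

/-- The entry that ends the first window is smaller than the first entry of the second, yet lies in
the second window, of which the first entry is the minimum. -/
theorem occ_recursivePattern_mul_eq_zero {m : ℕ} [NeZero m] {i d : ℕ} (hd : 1 ≤ d) (hdk : d < k)
    (σ : Equiv.Perm (Fin m)) :
    occ (RecursivePattern k P) i σ * occ (RecursivePattern k P) (i + d) σ = 0 := by
  rw [occ, occ, ← ind_and]
  refine ind_false fun ⟨h1, h2⟩ => ?_
  have e1 := h1.1 ⟨d, hdk⟩
  have e2 := lt_of_heapIn_binProperty h2.2 (x := k - d) (by omega) (by omega)
  simp only [add_zero] at e1 e2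
  rw [show i + d + (k - d) = i + k by omega] at e2
  omega

theorem expect_occ_recursivePattern_mul_le [NeZero k] (hP : OrdTree.IsProperty P) {m : ℕ}
    [NeZero m] (hm : k + 1 ≤ m) (i : ℕ) :
    𝔼 σ : Equiv.Perm (Fin m), occ (RecursivePattern k P) i σ *
      occ (RecursivePattern k P) (i + k) σ ≤ (rrtProb k P / k) ^ 2 * (1 / (2 * k + 1)) := by
  have hk := NeZero.pos k
  have hQ := isPattern_heapIn k (isProperty_binProperty hP)
  rcases lt_trichotomy m (2 * k) with hlt | rfl | hgt
  · rw [Finset.expect_eq_zero fun σ _ => ?_]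
    · positivity
    · have := occ_recursivePattern_mul_eq_zero (k := k) (P := P) (i := i + k) (d := m - k)
        (by omega) (by omega) σ
      rwa [show i + k + (m - k) = i + m by omega, occ_add_self, mul_comm] at this
  · rw [Finset.expect_eq_zero fun σ _ => ?_]
    · positivity
    · rw [occ, occ, ← ind_and]
      refine ind_false fun ⟨h1, h2⟩ => ?_
      have e1 := h1.1 ⟨0, hk⟩
      have e2 := h2.1 ⟨0, hk⟩
      simp only [add_zero] at e1 e2
      rw [show i + k + k = i + 2 * k by omega, cycSeq_add_self] at e2
      omega
  -- The final entry is smaller than the second window, whose first entry is smaller than the first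
  -- window; so it is the minimum of 2k + 1 entries.
  · have h2 : ∀ σ : Equiv.Perm (Fin m), occ (RecursivePattern k P) i σ *
        occ (RecursivePattern k P) (i + k) σ ≤
        ind (HeapIn k (binProperty P) (fun x => cycSeq σ (i + x))) *
        (ind (HeapIn k (binProperty P) (fun x => cycSeq σ (i + k + x))) *
          ind (IsMinAt (block m i (2 * k + 1)) (Fin.ofNat m (i + 2 * k)) σ)) := by
      intro σ
      rw [occ, occ, ← ind_and, ← ind_and, ← ind_and]
      refine ind_mono fun ⟨h1, h2⟩ => ⟨h1.2, h2.2, isMinAt_block fun x hx1 hx2 hne => ?_⟩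
      have hxi : x ≠ i + 2 * k := fun h => hne (by rw [h])
      have e0 := h2.1 ⟨0, hk⟩
      simp only [add_zero, show i + k + k = i + 2 * k by omega] at e0
      rcases lt_or_ge x (i + k) with hx | hx
      · have e1 := h1.1 ⟨x - i, by omega⟩
        simp only [show i + (x - i) = x by omega] at e1
        omega
      · have e1 := h2.1 ⟨x - i - k, by omega⟩
        simpa only [show i + k + (x - i - k) = x by omega,
          show i + k + k = i + 2 * k by omega] using e1
    refine (Finset.expect_le_expect fun σ _ => h2 σ).trans (le_of_eq ?_)
    rw [expect_pattern_block_mul hQ (by omega) i _ fun σ π hπ hπ' => ?_,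
      expect_pattern_block_mul hQ (by omega) (i + k) _ fun σ π hπ hπ' => ?_,
      patternProb_heapIn_binProperty hP, expect_isMinAt, card_block (by omega)]
    · push_cast
      ring
    · exact ofNat_mem_block (by omega) (by omega)
    · exact ind_congr (isMinAt_mul_of_block hπ hπ'
        (ofNat_notMem_block (s' := i) (by omega) (by omega) (by omega) (by omega) (by omega))
        (block_subset (by omega) (by omega)))
    · refine congrArg₂ (· * ·) (ind_congr ?_) (ind_congr ?_)
      · exact pattern_mul_of_block hQ hπ (disjoint_block (by omega) (by omega))
      · exact isMinAt_mul_of_block hπ hπ'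
          (ofNat_notMem_block (s' := i) (by omega) (by omega) (by omega) (by omega) (by omega))
          (block_subset (by omega) (by omega))

end RRT

/-! ### Poisson approximation -/

theorem integral_occCount {m w : ℕ} [NeZero m] [NeZero w] {Q : (ℕ → ℕ) → Prop}
    (hQ : IsPattern w Q) (hwm : w ≤ m) {L : Measure ℕ}
    (hL : L = ((PMF.uniformOfFintype (Equiv.Perm (Fin m))).map (occCount Q)).toMeasure) :
    Integrable (fun l : ℕ => (l : ℝ)) L ∧ ∫ l, (l : ℝ) ∂L = m * patternProb w Q := by
  subst hL
  have h := integral_uniform_map (occCount Q : Equiv.Perm (Fin m) → ℕ) (fun l => (l : ℝ))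
  exact ⟨h.1, h.2.trans (expect_occCount hQ hwm)⟩

theorem hasSum_tvDist_poisson (L : Measure ℕ) [IsProbabilityMeasure L] {r : ℝ} (hr : 0 ≤ r) :
    HasSum (fun l : ℕ => |L.real {l} - Real.exp (-r) * r ^ l / (l.factorial : ℝ)|)
      (2 * tvDist L (poissonMeasure r.toNNReal)) := by
  have := hasSum_abs_sub_measureReal_singleton L (poissonMeasure r.toNNReal)
  simpa only [poissonMeasure_real_singleton, Real.coe_toNNReal r hr] using this

theorem tvDist_occCount_le {m w : ℕ} [NeZero m] [NeZero w] {Q : (ℕ → ℕ) → Prop}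
    (hQ : IsPattern w Q) (hw : 2 ≤ w) (hwm : w ≤ m) {c : ℝ} (hc : 0 ≤ c)
    (h0 : ∀ i d, 1 ≤ d → d < w - 1 → ∀ σ : Equiv.Perm (Fin m), occ Q i σ * occ Q (i + d) σ = 0)
    (h1 : ∀ i, 𝔼 σ : Equiv.Perm (Fin m), occ Q i σ * occ Q (i + (w - 1)) σ ≤ c) {r : ℝ}
    (hr : r = m * patternProb w Q) :
    tvDist ((PMF.uniformOfFintype (Equiv.Perm (Fin m))).map (occCount Q)).toMeasure
      (poissonMeasure r.toNNReal) ≤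
      min 1 (1 / r) * (2 * w * patternProb w Q * r + 2 * m * c) := by
  have hr0 : 0 ≤ r := hr ▸ mul_nonneg (Nat.cast_nonneg _) (patternProb_nonneg _ _)
  rcases hr0.eq_or_lt with hz | hpos
  -- With mean zero the Stein equation is not available, but both laws are the point mass at 0.
  · have hX : ∀ σ : Equiv.Perm (Fin m), occCount Q σ = 0 := by
      have h2 := expect_occCount hQ hwm
      rw [← hr, ← hz, Finset.expect_eq_zero_iff_of_nonneg
        fun σ _ => Nat.cast_nonneg _] at h2
      exact fun σ => by exact_mod_cast h2 σ (Finset.mem_univ σ)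
    have h3 : tvDist ((PMF.uniformOfFintype (Equiv.Perm (Fin m))).map (occCount Q)).toMeasure
        (poissonMeasure r.toNNReal) = 0 := by
      have h4 := hasSum_tvDist_poisson
        ((PMF.uniformOfFintype (Equiv.Perm (Fin m))).map (occCount Q)).toMeasure hr0
      have h5 : (fun l : ℕ =>
          |((PMF.uniformOfFintype (Equiv.Perm (Fin m))).map (occCount Q)).toMeasure.real {l} -
          Real.exp (-r) * r ^ l / (l.factorial : ℝ)|) = fun _ => 0 := by
        funext l
        rw [measureReal_uniform_map]
        simp only [hX, Fintype.expect_const]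
        rw [← hz]
        rcases l with _ | l <;> simp
      rw [h5] at h4
      have := h4.unique hasSum_zero
      linarith
    rw [h3, ← hz]
    simp
  · have hpos' : 0 < r.toNNReal := Real.toNNReal_pos.2 hpos
    have h2 := tvDist_poisson_le (occCount Q : Equiv.Perm (Fin m) → ℕ) hpos'
      (c := m * (2 * w) * patternProb w Q ^ 2 + 2 * m * c) fun g d hg => by
        have := abs_expect_stein_occCount_le hQ hw hwm hc h0 h1 hg
        rwa [← hr, ← Real.coe_toNNReal r hr0] at this
    rw [Real.coe_toNNReal r hr0] at h2
    refine h2.trans (le_of_eq ?_)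
    rw [hr]
    ring

/-! ### Means, explicit constants and the resulting limits -/

section Bounds

open BinaryTree

theorem bstProb_nonneg (k : ℕ) (P : Set (BinaryTree ℕ)) : 0 ≤ bstProb k P := ENNReal.toReal_nonneg

theorem rrtProb_nonneg (k : ℕ) (P : Set (OrdTree ℕ)) : 0 ≤ rrtProb k P := ENNReal.toReal_nonneg

theorem PMF.toReal_toOuterMeasure_le_one {α : Type*} (p : PMF α) (s : Set α) :
    (p.toOuterMeasure s).toReal ≤ 1 := by
  refine ENNReal.toReal_le_of_le_ofReal zero_le_one ?_
  rw [ENNReal.ofReal_one]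
  calc p.toOuterMeasure s ≤ p.toOuterMeasure Set.univ := p.toOuterMeasure.mono (Set.subset_univ s)
    _ = 1 := (p.toOuterMeasure_apply_eq_one_iff _).2 (Set.subset_univ _)

theorem bstMean_spec {n k : ℕ} (hk : 1 ≤ k) (hkn : k < n) {P : Set (BinaryTree ℕ)}
    (hP : IsProperty P) :
    Integrable (fun l : ℕ => (l : ℝ)) (bstLaw n k P) ∧
      bstMean n k P = 2 * ((n : ℝ) + 1) * bstProb k P / (((k : ℝ) + 1) * ((k : ℝ) + 2)) := by
  have : NeZero k := ⟨by omega⟩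
  obtain ⟨h1, h2⟩ := integral_occCount (m := n + 1) (isPattern_fringePattern k hP) (by omega)
    (bstLaw_eq (n := n) hk hP)
  refine ⟨h1, h2.trans ?_⟩
  rw [patternProb_fringePattern hP]
  push_cast
  ring

theorem rrtMean_spec {n k : ℕ} (hk : 1 ≤ k) (hkn : k < n) {P : Set (OrdTree ℕ)}
    (hP : OrdTree.IsProperty P) :
    Integrable (fun l : ℕ => (l : ℝ)) (rrtLaw n k P) ∧
      rrtMean n k P = (n : ℝ) * rrtProb k P / ((k : ℝ) * ((k : ℝ) + 1)) := by
  have : NeZero k := ⟨by omega⟩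
  obtain ⟨n, rfl⟩ : ∃ N, n = N + 1 := ⟨n - 1, by omega⟩
  obtain ⟨h1, h2⟩ := integral_occCount (m := n + 1) (isPattern_recursivePattern k hP) (by omega)
    (rrtLaw_eq hk hkn hP)
  refine ⟨h1, h2.trans ?_⟩
  rw [patternProb_recursivePattern hP]
  ring

theorem bstMean_nonneg (n k : ℕ) (P : Set (BinaryTree ℕ)) : 0 ≤ bstMean n k P :=
  integral_nonneg fun _ => Nat.cast_nonneg _

theorem rrtMean_nonneg (n k : ℕ) (P : Set (OrdTree ℕ)) : 0 ≤ rrtMean n k P :=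
  integral_nonneg fun _ => Nat.cast_nonneg _

theorem bstPoissonDist_le_of_ne {n k : ℕ} (hk : 1 ≤ k) (hkn : k < n) {P : Set (BinaryTree ℕ)}
    (hP : IsProperty P) (hne : 2 * k + 1 ≠ n) :
    bstPoissonDist n k P ≤
      min 1 (1 / bstMean n k P) * (7 * (bstProb k P / k * bstMean n k P)) := by
  have : NeZero k := ⟨by omega⟩
  have hk0 : (0 : ℝ) < k := by exact_mod_cast hk
  have hp := bstProb_nonneg k P
  have hmean := (bstMean_spec hk hkn hP).2
  have hq := patternProb_fringePattern (k := k) hP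
  rw [bstPoissonDist, bstLaw_eq hk hP]
  refine (tvDist_occCount_le (isPattern_fringePattern k hP) (by omega) (by omega)
    (c := bstProb k P ^ 2 * (3 / ((2 * k + 3) * (k + 1) ^ 2))) (by positivity)
    (fun i d h1 h2 σ => occ_fringePattern_mul_eq_zero h1 (by omega) σ) (fun i => ?_) ?_).trans ?_
  · rw [show k + 2 - 1 = k + 1 by omega]
    -- As n differs from 2k + 1, the first case means n ≤ 2k, and the windows overlap at distance n
    -- - k ≤ k on the other side of the cycle.
    rcases lt_or_ge n (2 * k + 2) with hlt | hge
    · rw [Finset.expect_eq_zero fun σ _ => ?_]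
      · positivity
      · have := occ_fringePattern_mul_eq_zero (k := k) (P := P) (i := i + (k + 1)) (d := n - k)
          (by omega) (by omega) σ
        rwa [show i + (k + 1) + (n - k) = i + (n + 1) by omega, occ_add_self, mul_comm] at this
    · exact expect_occ_fringePattern_mul_le hP (by omega) i
  · rw [hmean, hq]; push_cast; ring
  · have hmn := bstMean_nonneg n k P
    refine mul_le_mul_of_nonneg_left ?_ (le_min zero_le_one (by positivity))
    -- The constant 7 is 4 from the product of probabilities over a neighbourhood and 3 from
    -- adjacent pairs.
    have e1 : 2 * ((k + 2 : ℕ) : ℝ) * patternProb (k + 2) (FringePattern k P) * bstMean n k P ≤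
        4 * (bstProb k P / k * bstMean n k P) := by
      rw [hq]
      have : 2 * ((k + 2 : ℕ) : ℝ) * (2 * bstProb k P / ((k + 1) * (k + 2))) =
          4 * (bstProb k P / (k + 1)) := by push_cast; field_simp; ring
      rw [this, mul_assoc]
      gcongr
      linarith
    have e2 : 2 * ((n + 1 : ℕ) : ℝ) * (bstProb k P ^ 2 * (3 / ((2 * k + 3) * (k + 1) ^ 2))) ≤
        3 * (bstProb k P / k * bstMean n k P) := by
      rw [hmean]
      have h3 : 3 * (bstProb k P / k * (2 * ((n : ℝ) + 1) * bstProb k P / ((k + 1) * (k + 2)))) =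
          2 * ((n : ℝ) + 1) * (bstProb k P ^ 2 * (3 / (k * ((k + 1) * (k + 2))))) := by
        field_simp
      rw [h3]
      push_cast
      have h4 : (k : ℝ) * ((k + 1) * (k + 2)) ≤ (2 * k + 3) * (k + 1) ^ 2 := by nlinarith
      gcongr
    linarith

theorem bstPoissonDist_le_of_eq {n k : ℕ} (hk : 1 ≤ k) {P : Set (BinaryTree ℕ)}
    (hP : IsProperty P) (hn : 2 * k + 1 = n) :
    bstPoissonDist n k P ≤ 20 * (bstProb k P ^ 2 / k) := by
  have : NeZero k := ⟨by omega⟩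
  have hk0 : (0 : ℝ) < k := by exact_mod_cast hk
  have hp := bstProb_nonneg k P
  have hmean := (bstMean_spec (n := n) hk (by omega) hP).2
  have hq := patternProb_fringePattern (k := k) hP
  subst hn
  rw [bstPoissonDist, bstLaw_eq hk hP]
  refine (tvDist_occCount_le (isPattern_fringePattern k hP) (by omega) (by omega)
    (c := bstProb k P ^ 2 * (1 / (k + 1) ^ 2)) (by positivity)
    (fun i d h1 h2 σ => occ_fringePattern_mul_eq_zero h1 (by omega) σ)
    (fun i => expect_occ_fringePattern_mul_le_of_eq hP i) ?_).trans ?_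
  · rw [hmean, hq]; push_cast; ring
  · have hmn := bstMean_nonneg (2 * k + 1) k P
    -- Here μ = 4p/(k+2), so the first term is 16 p²/((k+1)(k+2)); adjacent pairs add 4 p²/(k+1),
    -- and the factor min(1, 1/μ) is bounded by 1.
    have e1 : 2 * ((k + 2 : ℕ) : ℝ) * patternProb (k + 2) (FringePattern k P) *
        bstMean (2 * k + 1) k P ≤ 16 * (bstProb k P ^ 2 / k) := by
      rw [hq, hmean]
      have h3 : 2 * ((k + 2 : ℕ) : ℝ) * (2 * bstProb k P / ((k + 1) * (k + 2))) *
          (2 * (((2 * k + 1 : ℕ) : ℝ) + 1) * bstProb k P / ((k + 1) * (k + 2))) =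
          16 * (bstProb k P ^ 2 / ((k + 1) * (k + 2))) := by push_cast; field_simp; ring
      rw [h3]
      gcongr
      nlinarith
    have e2 : 2 * ((2 * k + 1 + 1 : ℕ) : ℝ) * (bstProb k P ^ 2 * (1 / (k + 1) ^ 2)) ≤
        4 * (bstProb k P ^ 2 / k) := by
      have h3 : 2 * ((2 * k + 1 + 1 : ℕ) : ℝ) * (bstProb k P ^ 2 * (1 / (k + 1) ^ 2)) =
          4 * (bstProb k P ^ 2 / (k + 1)) := by push_cast; field_simp; ring
      rw [h3]
      gcongr
      linarith
    have e3 : 0 ≤ 2 * ((k + 2 : ℕ) : ℝ) * patternProb (k + 2) (FringePattern k P) *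
        bstMean (2 * k + 1) k P +
        2 * ((2 * k + 1 + 1 : ℕ) : ℝ) * (bstProb k P ^ 2 * (1 / (k + 1) ^ 2)) := by
      have := patternProb_nonneg (k + 2) (FringePattern k P)
      positivity
    refine (mul_le_of_le_one_left e3 (min_le_left _ _)).trans ?_
    linarith

theorem rrtPoissonDist_le {n k : ℕ} (hk : 1 ≤ k) (hkn : k < n) {P : Set (OrdTree ℕ)}
    (hP : OrdTree.IsProperty P) :
    rrtPoissonDist n k P ≤
      min 1 (1 / rrtMean n k P) * (4 * (rrtProb k P / k * rrtMean n k P)) := by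
  have : NeZero k := ⟨by omega⟩
  have hk0 : (0 : ℝ) < k := by exact_mod_cast hk
  have hp := rrtProb_nonneg k P
  have hmean := (rrtMean_spec hk hkn hP).2
  have hq := patternProb_recursivePattern (k := k) hP
  obtain ⟨n, rfl⟩ : ∃ N, n = N + 1 := ⟨n - 1, by omega⟩
  rw [rrtPoissonDist, rrtLaw_eq hk hkn hP]
  refine (tvDist_occCount_le (isPattern_recursivePattern k hP) (by omega) (by omega)
    (c := (rrtProb k P / k) ^ 2 * (1 / (2 * k + 1))) (by positivity)
    (fun i d h1 h2 σ => occ_recursivePattern_mul_eq_zero h1 (by omega) σ)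
    (fun i => expect_occ_recursivePattern_mul_le hP (by omega) i) ?_).trans ?_
  · rw [hmean, hq]; ring
  · have hmn := rrtMean_nonneg (n + 1) k P
    refine mul_le_mul_of_nonneg_left ?_ (le_min zero_le_one (by positivity))
    -- The neighbourhood term and the adjacent pairs contribute 2 each.
    have e1 : 2 * ((k + 1 : ℕ) : ℝ) * patternProb (k + 1) (RecursivePattern k P) *
        rrtMean (n + 1) k P = 2 * (rrtProb k P / k * rrtMean (n + 1) k P) := by
      rw [hq]
      push_cast
      field_simp
    have e2 : 2 * ((n + 1 : ℕ) : ℝ) * ((rrtProb k P / k) ^ 2 * (1 / (2 * k + 1))) ≤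
        2 * (rrtProb k P / k * rrtMean (n + 1) k P) := by
      rw [hmean]
      have h3 : 2 * (rrtProb k P / k * (((n + 1 : ℕ) : ℝ) * rrtProb k P / (k * (k + 1)))) =
          2 * ((n + 1 : ℕ) : ℝ) * ((rrtProb k P / k) ^ 2 * (1 / (k + 1))) := by
        field_simp
      rw [h3]
      gcongr
      linarith
    linarith

theorem min_mul_le_of_one_le {r a C : ℝ} (hr : 1 ≤ r) (hC : 0 ≤ C * a) :
    min 1 (1 / r) * (C * (a * r)) ≤ C * a := by
  calc min 1 (1 / r) * (C * (a * r)) ≤ 1 / r * (C * (a * r)) := by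
        refine mul_le_mul_of_nonneg_right (min_le_right _ _) ?_
        rw [← mul_assoc]
        exact mul_nonneg hC (by linarith)
    _ = C * a := by field_simp

theorem min_mul_le_self {r a : ℝ} (ha : 0 ≤ a) : min 1 (1 / r) * a ≤ a :=
  mul_le_of_le_one_left ha (min_le_left _ _)

theorem bstPoissonDist_le {n k : ℕ} (hk : 1 ≤ k) (hkn : k < n) {P : Set (BinaryTree ℕ)}
    (hP : IsProperty P) :
    (2 * k + 1 ≠ n → 1 ≤ bstMean n k P → bstPoissonDist n k P ≤ 20 * (bstProb k P / k)) ∧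
    (2 * k + 1 ≠ n → bstMean n k P < 1 →
      bstPoissonDist n k P ≤ 20 * (bstProb k P / k * bstMean n k P)) ∧
    (2 * k + 1 = n → bstPoissonDist n k P ≤ 20 * (bstProb k P ^ 2 / k)) := by
  have hp := bstProb_nonneg k P
  have hm := bstMean_nonneg n k P
  have h1 : 0 ≤ bstProb k P / k := by positivity
  have h2 : 0 ≤ bstProb k P / k * bstMean n k P := by positivity
  refine ⟨fun hne hr => ?_, fun hne _ => ?_, fun h => bstPoissonDist_le_of_eq hk hP h⟩
  · have := (bstPoissonDist_le_of_ne hk hkn hP hne).trans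
      (min_mul_le_of_one_le hr (by positivity))
    linarith
  · have := (bstPoissonDist_le_of_ne hk hkn hP hne).trans (min_mul_le_self (by positivity))
    linarith

theorem rrtPoissonDist_le_cases {n k : ℕ} (hk : 1 ≤ k) (hkn : k < n) {P : Set (OrdTree ℕ)}
    (hP : OrdTree.IsProperty P) :
    (1 ≤ rrtMean n k P → rrtPoissonDist n k P ≤ 4 * (rrtProb k P / k)) ∧
    (rrtMean n k P < 1 → rrtPoissonDist n k P ≤ 4 * (rrtProb k P / k * rrtMean n k P)) := by
  have hp := rrtProb_nonneg k P
  have hm := rrtMean_nonneg n k P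
  exact ⟨fun hr => (rrtPoissonDist_le hk hkn hP).trans (min_mul_le_of_one_le hr (by positivity)),
    fun _ => (rrtPoissonDist_le hk hkn hP).trans (min_mul_le_self (by positivity))⟩

theorem bstPoissonDist_le_div {n k : ℕ} (hk : 1 ≤ k) (hkn : k < n) {P : Set (BinaryTree ℕ)}
    (hP : IsProperty P) : bstPoissonDist n k P ≤ 20 / k := by
  obtain ⟨h1, h2, h3⟩ := bstPoissonDist_le hk hkn hP
  have hp := bstProb_nonneg k P
  have hp1 : bstProb k P ≤ 1 := PMF.toReal_toOuterMeasure_le_one _ P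
  have hm := bstMean_nonneg n k P
  have e1 : 20 * (bstProb k P / k) ≤ 20 / k := by
    rw [mul_div_assoc']; gcongr; linarith
  by_cases hn : 2 * k + 1 = n
  · refine (h3 hn).trans ?_
    rw [mul_div_assoc']
    gcongr
    nlinarith
  · rcases le_or_gt 1 (bstMean n k P) with hr | hr
    · exact (h1 hn hr).trans e1
    · refine (h2 hn hr).trans (le_trans ?_ e1)
      gcongr
      exact mul_le_of_le_one_right (by positivity) hr.le

theorem rrtPoissonDist_le_div {n k : ℕ} (hk : 1 ≤ k) (hkn : k < n) {P : Set (OrdTree ℕ)}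
    (hP : OrdTree.IsProperty P) : rrtPoissonDist n k P ≤ 4 / k := by
  obtain ⟨h1, h2⟩ := rrtPoissonDist_le_cases hk hkn hP
  have hp := rrtProb_nonneg k P
  have hp1 : rrtProb k P ≤ 1 := PMF.toReal_toOuterMeasure_le_one _ P
  have hm := rrtMean_nonneg n k P
  have e1 : 4 * (rrtProb k P / k) ≤ 4 / k := by
    rw [mul_div_assoc']; gcongr; linarith
  rcases le_or_gt 1 (rrtMean n k P) with hr | hr
  · exact (h1 hr).trans e1
  · refine (h2 hr).trans (le_trans ?_ e1)
    gcongr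
    exact mul_le_of_le_one_right (by positivity) hr.le

theorem tendsto_zero_of_le_div {d : ℕ → ℝ} {k : ℕ → ℕ} {C : ℝ} (hd : ∀ n, 0 ≤ d n)
    (h : ∀ᶠ n in atTop, d n ≤ C / k n) (hk : Tendsto k atTop atTop) :
    Tendsto d atTop (𝓝 0) :=
  tendsto_of_tendsto_of_tendsto_of_le_of_le' tendsto_const_nhds
    (Tendsto.div_atTop tendsto_const_nhds (tendsto_natCast_atTop_atTop.comp hk))
    (Eventually.of_forall hd) h

end Bounds

theorem theorem3 :
    -- binary search tree: mean, and total variation distance as half the `ℓ¹` distance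
    (∀ P : Set (BinaryTree ℕ), BinaryTree.IsProperty P → ∀ n k : ℕ, 1 ≤ k → k < n →
      Integrable (fun l : ℕ => (l : ℝ)) (bstLaw n k P) ∧
      bstMean n k P = 2 * ((n : ℝ) + 1) * bstProb k P / (((k : ℝ) + 1) * ((k : ℝ) + 2)) ∧
      HasSum (fun l : ℕ => |(bstLaw n k P).real {l} -
          Real.exp (-bstMean n k P) * bstMean n k P ^ l / (l.factorial : ℝ)|)
        (2 * bstPoissonDist n k P)) ∧
    -- binary search tree: bounds
    (∃ C : ℝ, ∀ P : Set (BinaryTree ℕ), BinaryTree.IsProperty P →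
      ∀ n k : ℕ, 1 ≤ k → k < n →
      (2 * k + 1 ≠ n → 1 ≤ bstMean n k P →
        bstPoissonDist n k P ≤ C * (bstProb k P / k)) ∧
      (2 * k + 1 ≠ n → bstMean n k P < 1 →
        bstPoissonDist n k P ≤ C * (bstProb k P / k * bstMean n k P)) ∧
      (2 * k + 1 = n →
        bstPoissonDist n k P ≤ C * (bstProb k P ^ 2 / k))) ∧
    -- random recursive tree: mean, and total variation distance as half the `ℓ¹` distance
    (∀ P : Set (OrdTree ℕ), OrdTree.IsProperty P → ∀ n k : ℕ, 1 ≤ k → k < n →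
      Integrable (fun l : ℕ => (l : ℝ)) (rrtLaw n k P) ∧
      rrtMean n k P = (n : ℝ) * rrtProb k P / ((k : ℝ) * ((k : ℝ) + 1)) ∧
      HasSum (fun l : ℕ => |(rrtLaw n k P).real {l} -
          Real.exp (-rrtMean n k P) * rrtMean n k P ^ l / (l.factorial : ℝ)|)
        (2 * rrtPoissonDist n k P)) ∧
    -- random recursive tree: bounds
    (∃ C : ℝ, ∀ P : Set (OrdTree ℕ), OrdTree.IsProperty P →
      ∀ n k : ℕ, 1 ≤ k → k < n →
      (1 ≤ rrtMean n k P →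
        rrtPoissonDist n k P ≤ C * (rrtProb k P / k)) ∧
      (rrtMean n k P < 1 →
        rrtPoissonDist n k P ≤ C * (rrtProb k P / k * rrtMean n k P))) ∧
    -- convergence to zero as `n → ∞` and `k = k_n → ∞`
    (∀ (P : ℕ → Set (BinaryTree ℕ)) (k : ℕ → ℕ), (∀ n, BinaryTree.IsProperty (P n)) →
      (∀ᶠ n in atTop, k n < n) → Tendsto k atTop atTop →
      Tendsto (fun n => bstPoissonDist n (k n) (P n)) atTop (𝓝 0)) ∧
    (∀ (P : ℕ → Set (OrdTree ℕ)) (k : ℕ → ℕ), (∀ n, OrdTree.IsProperty (P n)) →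
      (∀ᶠ n in atTop, k n < n) → Tendsto k atTop atTop →
      Tendsto (fun n => rrtPoissonDist n (k n) (P n)) atTop (𝓝 0)) := by
  refine ⟨fun P hP n k hk hkn => ?_, ⟨20, fun P hP n k hk hkn => bstPoissonDist_le hk hkn hP⟩,
    fun P hP n k hk hkn => ?_, ⟨4, fun P hP n k hk hkn => rrtPoissonDist_le_cases hk hkn hP⟩,
    fun P k hP hkn hk => ?_, fun P k hP hkn hk => ?_⟩
  · obtain ⟨h1, h2⟩ := bstMean_spec hk hkn hP
    have : IsProbabilityMeasure (bstLaw n k P) := PMF.toMeasure.isProbabilityMeasure _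
    exact ⟨h1, h2, hasSum_tvDist_poisson _ (bstMean_nonneg n k P)⟩
  · obtain ⟨h1, h2⟩ := rrtMean_spec hk hkn hP
    have : IsProbabilityMeasure (rrtLaw n k P) := PMF.toMeasure.isProbabilityMeasure _
    exact ⟨h1, h2, hasSum_tvDist_poisson _ (rrtMean_nonneg n k P)⟩
  · refine tendsto_zero_of_le_div (C := 20) (fun n => tvDist_nonneg _ _) ?_ hk
    filter_upwards [hkn, hk.eventually_ge_atTop 1] with n h1 h2
    exact bstPoissonDist_le_div h2 h1 (hP n)
  · refine tendsto_zero_of_le_div (C := 4) (fun n => tvDist_nonneg _ _) ?_ hk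
    filter_upwards [hkn, hk.eventually_ge_atTop 1] with n h1 h2
    exact rrtPoissonDist_le_div h2 h1 (hP n)
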